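/- Let $V$ be a Euclidean space with a basis of simple roots whose Gram matrix is the Cartan matrix of type $E_7$ (resp. $E_8$), let $G\subset O(V)$ be the Weyl group generated by the reflections in the simple roots, $R\subset V$ the root lattice and $P$ the weight lattice. An *involution* of $G$ is an element $u$ with $u^2=1$; its degree is the dimension of its $(-1)$-eigenspace; a *reflection* is an involution of degree $1$; the *reduced rank* of $G$ is the largest degree of an involution of $G$. A *cube* of $G$ is an abelian subgroup $C$ generated by reflections; its *base* $S$ is the set of reflections contained in $C$, and $C$ is *maximal* if $|S|$ equals the reduced rank of $G$. For a maximal cube $C$ with normalizer $N_C$ put $\Phi=\Phi_C=N_C/C$; it acts on $S$ by conjugation. Every reflection $s$ of $G$ is of the form $s=s_\alpha$ for a root $\alpha$; the image of $\alpha$ in $R/2P$ (type $E_7$), resp. in $R/2R$ (type $E_8$), depends only on $s$ and is denoted by $\tilde s$. **Type $E_7$.** Equip the $\mathbf F_2$-vector space $V_6=R/2P$ with the bilinear form induced by the scalar product. The bases of the maximal cubes are exactly the sets of reflections that $s\mapsto\tilde s$ maps bijectively onto the set of nonzero vectors of a maximal totally isotropic subspace of $V_6$. Moreover: (a) Sending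 a maximal cube to the span of $\{\tilde s : s\in S\}$ is a bijection from the set of maximal cubes onto the set of maximal totally isotropic subspaces of $V_6$; there are $135$ maximal cubes. (b) For a maximal cube with base $S$, the span $W$ of $\{\tilde s : s\in S\}$ has dimension $3$, and $s\mapsto\mathbf F_2\tilde s$ is a bijection of $S$ onto the projective plane $\mathbf P(W)$ over $\mathbf F_2$. (c) The action of $\Phi$ on $S$ is faithful and identifies $\Phi$ with the group of all permutations of $S$ that preserve collinearity in this projective plane. The group $\Phi$ is simple of order $168$ and is isomorphic to $\mathrm{GL}_3(\mathbf F_2)$. **Type $E_8$.** Let $C$ be a maximal cube with base $S$. For $A\subset S$ put $e(A)=\sum_{s\in A}\tilde s\in V_8=R/2R$. (i) For every three-element subset $A$ of $S$ there is a unique $s\in S\setminus A$ with $\tilde s=e(A)$. (ii) Let $\mathcal B$ be the set of four-element subsets $B$ of $S$ with $e(B)=0$. Then $|S|=8$ and every three-element subset of $S$ is contained in exactly one element of $\mathcal B$; that is, $(S,\mathcal B)$ is a Steiner system $S(3,4,8)$. (iii) The map $s\mapsto\tilde s$ is a bijection of $S$ onto a $3$-dimensional affine subspace of the $\mathbf F_2$-vector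 space $V_8$, which makes $S$ an affine space of dimension $3$ over $\mathbf F_2$. The action of $\Phi$ on $S$ is faithful and identifies $\Phi$ with the group of all automorphisms of this affine space; $\Phi$ is isomorphic to the semidirect product $\mathbf F_2^3\rtimes \mathrm{GL}_3(\mathbf F_2)$ for the natural action of $\mathrm{GL}_3(\mathbf F_2)$ on $\mathbf F_2^3$. -/

import Mathlib

open scoped LinearAlgebra.Projectivization Matrix

noncomputable section

/-! ### Involutions, reflections and cubes in a group of isometries -/

section Cubes

variable {V : Type*} [NormedAddCommGroup V] [InnerProductSpace ℝ V]

/-- The degree of an involution `u`: the dimension of its `(-1)`-eigenspace. -/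
def involutionDegree (u : V ≃ₗᵢ[ℝ] V) : ℕ :=
  Module.finrank ℝ (Module.End.eigenspace (u.toLinearEquiv : V →ₗ[ℝ] V) (-1))

/-- The orthogonal reflection `s_α` in the hyperplane `α^⊥`. -/
def rootReflection (α : V) : V ≃ₗᵢ[ℝ] V := (ℝ ∙ α)ᗮ.reflection

variable {G : Subgroup (V ≃ₗᵢ[ℝ] V)}

/-- A reflection of `G` is an involution of `G` of degree `1`. -/
def IsGroupReflection (s : G) : Prop :=
  s ^ 2 = 1 ∧ involutionDegree (s : V ≃ₗᵢ[ℝ] V) = 1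

variable (G) in
/-- The reduced rank of `G`: the largest degree of an involution of `G` (an element `u` with
`u ^ 2 = 1`). -/
def reducedRank : ℕ :=
  sSup {d : ℕ | ∃ u : G, u ^ 2 = 1 ∧ involutionDegree (u : V ≃ₗᵢ[ℝ] V) = d}

/-- The base of a cube: the set of all reflections it contains. -/
def cubeBase (C : Subgroup G) : Set G := {s | s ∈ C ∧ IsGroupReflection s}

/-- A cube of `G` is an abelian subgroup generated by reflections. -/
def IsCube (C : Subgroup G) : Prop :=
  (∀ x ∈ C, ∀ y ∈ C, x * y = y * x) ∧ Subgroup.closure (cubeBase C) = C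

/-- A cube is maximal if its rank (the number of its reflections) is the reduced rank of `G`. -/
def IsMaximalCube (C : Subgroup G) : Prop :=
  IsCube C ∧ (cubeBase C).ncard = reducedRank G

/-- The group `Φ_C = N_C / C`, where `N_C` is the normalizer of `C` in `G`. -/
abbrev cubePhi (C : Subgroup G) : Type _ :=
  (Subgroup.normalizer (C : Set G)) ⧸ C.subgroupOf (Subgroup.normalizer (C : Set G))

/-- The homomorphism `f` from `Φ_C` to the permutations of the base is the one induced by
conjugation. -/
def IsConjugationAction {C : Subgroup G} (f : cubePhi C →* Equiv.Perm (cubeBase C)) : Prop :=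
  ∀ (n : Subgroup.normalizer (C : Set G)) (s : cubeBase C),
    (f (n : cubePhi C) s : G) = n * s * (n : G)⁻¹

end Cubes

/-! ### Simply laced root systems -/

/-- A realization of a simply laced Cartan matrix `A` in a Euclidean space: a basis of simple roots,
of squared length `2`, whose Gram matrix is `A`. -/
structure SimpleRoots {n : ℕ} (A : Matrix (Fin n) (Fin n) ℤ) (V : Type*)
    [NormedAddCommGroup V] [InnerProductSpace ℝ V] where
  /-- The simple roots. -/
  basis : Module.Basis (Fin n) ℝ V
  inner_basis : ∀ i j, inner ℝ (basis i) (basis j) = (A i j : ℝ)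
  diag : ∀ i, A i i = 2

namespace SimpleRoots

variable {n : ℕ} {A : Matrix (Fin n) (Fin n) ℤ} {V : Type*}
  [NormedAddCommGroup V] [InnerProductSpace ℝ V] (D : SimpleRoots A V)

/-- The Weyl group, generated by the reflections in the simple roots. -/
def weylGroup : Subgroup (V ≃ₗᵢ[ℝ] V) :=
  Subgroup.closure (Set.range fun i => rootReflection (D.basis i))

/-- The roots: the images of the simple roots under the Weyl group. -/
def roots : Set V := {α | ∃ g ∈ D.weylGroup, ∃ i, α = g (D.basis i)}

/-- The root lattice `R`, generated by the roots. -/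
def rootLattice : Submodule ℤ V := Submodule.span ℤ D.roots

/-- The weight lattice `P`: the vectors `x` such that `2⟨x, α⟩ / ⟨α, α⟩` is an integer for every
root `α`. -/
def weightLattice : Submodule ℤ V where
  carrier := {x | ∀ α ∈ D.roots, ∃ k : ℤ, 2 * inner ℝ x α / inner ℝ α α = (k : ℝ)}
  zero_mem' := fun y _ => ⟨0, by simp⟩
  add_mem' := by
    intro a b ha hb y hy
    obtain ⟨k, hk⟩ := ha y hy
    obtain ⟨l, hl⟩ := hb y hy
    exact ⟨k + l, by rw [inner_add_left, mul_add, add_div, hk, hl]; push_cast; ring⟩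
  smul_mem' := by
    intro c a ha y hy
    obtain ⟨k, hk⟩ := ha y hy
    refine ⟨c * k, ?_⟩
    rw [← Int.cast_smul_eq_zsmul ℝ, real_inner_smul_left, Int.cast_mul, ← hk]
    ring

lemma inner_int_of_span {T : Set V} {x : V} (h : ∀ y ∈ T, ∃ k : ℤ, inner ℝ x y = (k : ℝ))
    {y : V} (hy : y ∈ Submodule.span ℤ T) : ∃ k : ℤ, inner ℝ x y = (k : ℝ) := by
  refine Submodule.span_induction (p := fun y _ => ∃ k : ℤ, inner ℝ x y = (k : ℝ))
    h ⟨0, by simp⟩ ?_ ?_ hy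
  · rintro a b - - ⟨k, hk⟩ ⟨l, hl⟩
    exact ⟨k + l, by rw [inner_add_right, hk, hl]; push_cast; ring⟩
  · rintro c a - ⟨k, hk⟩
    refine ⟨c * k, ?_⟩
    rw [← Int.cast_smul_eq_zsmul ℝ, real_inner_smul_right, hk]
    push_cast
    ring

lemma inner_int_of_span_basis {x y : V} (hx : x ∈ Submodule.span ℤ (Set.range D.basis))
    (hy : y ∈ Submodule.span ℤ (Set.range D.basis)) : ∃ k : ℤ, inner ℝ x y = (k : ℝ) := by
  refine inner_int_of_span ?_ hy
  rintro _ ⟨j, rfl⟩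
  rw [real_inner_comm]
  refine inner_int_of_span ?_ hx
  rintro _ ⟨i, rfl⟩
  exact ⟨A j i, D.inner_basis j i⟩

lemma basis_reflection_apply (i : Fin n) (x : V) :
    rootReflection (D.basis i) x = x - (inner ℝ (D.basis i) x : ℝ) • D.basis i := by
  have h2 : ‖D.basis i‖ ^ 2 = 2 := by
    rw [← real_inner_self_eq_norm_sq, D.inner_basis, D.diag]
    norm_num
  rw [rootReflection, Submodule.reflection_orthogonal_apply, Submodule.reflection_singleton_apply]
  simp only [RCLike.ofReal_real_eq_id, id_eq, h2]
  rw [neg_sub, ← Nat.cast_smul_eq_nsmul ℝ, smul_smul]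
  congr 2
  push_cast
  ring

lemma weylGroup_map_span_basis {g : V ≃ₗᵢ[ℝ] V} (hg : g ∈ D.weylGroup) :
    ∀ x, g x ∈ Submodule.span ℤ (Set.range D.basis) ↔
      x ∈ Submodule.span ℤ (Set.range D.basis) := by
  have key : ∀ (i : Fin n) (x : V), x ∈ Submodule.span ℤ (Set.range D.basis) →
      rootReflection (D.basis i) x ∈ Submodule.span ℤ (Set.range D.basis) := by
    intro i x hx
    have hi : D.basis i ∈ Submodule.span ℤ (Set.range D.basis) :=
      Submodule.subset_span ⟨i, rfl⟩
    obtain ⟨k, hk⟩ := D.inner_int_of_span_basis hi hx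
    rw [basis_reflection_apply, hk, Int.cast_smul_eq_zsmul ℝ]
    exact Submodule.sub_mem _ hx (Submodule.smul_mem _ k hi)
  refine Subgroup.closure_induction (p := fun g _ => ∀ x,
    g x ∈ Submodule.span ℤ (Set.range D.basis) ↔ x ∈ Submodule.span ℤ (Set.range D.basis))
    ?_ ?_ ?_ ?_ hg
  · rintro _ ⟨i, rfl⟩ x
    refine ⟨fun h => ?_, key i x⟩
    have := key i _ h
    rwa [show rootReflection (D.basis i) (rootReflection (D.basis i) x) = x from
      Submodule.reflection_reflection _ x] at this
  · intro x
    exact Iff.rfl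
  · intro a b _ _ ha hb x
    exact (ha (b x)).trans (hb x)
  · intro a _ ha x
    rw [← ha (a⁻¹ x)]
    exact iff_of_eq (congrArg (· ∈ Submodule.span ℤ (Set.range D.basis)) (a.apply_symm_apply x))

lemma rootLattice_le_span_basis :
    D.rootLattice ≤ Submodule.span ℤ (Set.range D.basis) := by
  refine Submodule.span_le.mpr ?_
  rintro _ ⟨g, hg, i, rfl⟩
  exact (D.weylGroup_map_span_basis hg _).mpr (Submodule.subset_span ⟨i, rfl⟩)

lemma inner_root_self {α : V} (hα : α ∈ D.roots) : inner ℝ α α = (2 : ℝ) := by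
  obtain ⟨g, -, i, rfl⟩ := hα
  rw [LinearIsometryEquiv.inner_map_map, D.inner_basis, D.diag]
  norm_num

lemma inner_int_of_rootLattice {x y : V} (hx : x ∈ D.rootLattice) (hy : y ∈ D.rootLattice) :
    ∃ k : ℤ, inner ℝ x y = (k : ℝ) :=
  D.inner_int_of_span_basis (D.rootLattice_le_span_basis hx) (D.rootLattice_le_span_basis hy)

lemma inner_int_of_weightLattice {x y : V} (hx : x ∈ D.weightLattice) (hy : y ∈ D.rootLattice) :
    ∃ k : ℤ, inner ℝ x y = (k : ℝ) := by
  refine inner_int_of_span (fun α hα => ?_) hy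
  obtain ⟨k, hk⟩ := hx α hα
  refine ⟨k, ?_⟩
  rw [← hk, D.inner_root_self hα]
  ring

lemma rootLattice_le_weightLattice : D.rootLattice ≤ D.weightLattice := by
  intro x hx α hα
  obtain ⟨k, hk⟩ := D.inner_int_of_rootLattice hx (Submodule.subset_span hα)
  refine ⟨k, ?_⟩
  rw [hk, D.inner_root_self hα]
  ring

/-- The subgroup `R ∩ 2P` of `R`; for type `E₇` it is all of `2P`. -/
def twoP : Submodule ℤ D.rootLattice :=
  (D.weightLattice.map ((2 : ℤ) • (LinearMap.id : V →ₗ[ℤ] V))).comap D.rootLattice.subtype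

/-- The subgroup `2R` of `R`. -/
def twoR : Submodule ℤ D.rootLattice :=
  LinearMap.range ((2 : ℤ) • (LinearMap.id : D.rootLattice →ₗ[ℤ] D.rootLattice))

/-- The quotient `R / 2P`. -/
abbrev ModTwoP : Type _ := D.rootLattice ⧸ D.twoP

/-- The quotient `R / 2R`. -/
abbrev ModTwoR : Type _ := D.rootLattice ⧸ D.twoR

instance moduleModTwoP : Module (ZMod 2) D.ModTwoP :=
  AddCommGroup.zmodModule (n := 2) (by
    intro x
    induction x using Submodule.Quotient.induction_on with
    | H x =>
      rw [← Submodule.Quotient.mk_smul, Submodule.Quotient.mk_eq_zero]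
      exact ⟨(x : V), D.rootLattice_le_weightLattice x.2, by simp [two_smul]⟩)

instance moduleModTwoR : Module (ZMod 2) D.ModTwoR :=
  AddCommGroup.zmodModule (n := 2) (by
    intro x
    induction x using Submodule.Quotient.induction_on with
    | H x =>
      rw [← Submodule.Quotient.mk_smul, Submodule.Quotient.mk_eq_zero]
      exact ⟨x, by simp [two_smul]⟩)

/-- The integer `⟨x, y⟩` for `x`, `y` in the root lattice. -/
def intInner (x y : D.rootLattice) : ℤ := ⌊inner ℝ (x : V) (y : V)⌋

lemma intInner_cast (x y : D.rootLattice) :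
    (D.intInner x y : ℝ) = inner ℝ (x : V) (y : V) := by
  obtain ⟨k, hk⟩ := D.inner_int_of_rootLattice x.2 y.2
  rw [intInner, hk, Int.floor_intCast]

lemma intInner_comm (x y : D.rootLattice) : D.intInner x y = D.intInner y x := by
  rw [intInner, intInner, real_inner_comm]

/-- The scalar product modulo `2` on the root lattice. -/
def innerModTwo : D.rootLattice →ₗ[ℤ] D.rootLattice →ₗ[ℤ] ZMod 2 :=
  LinearMap.mk₂ ℤ (fun x y => (D.intInner x y : ZMod 2))
    (by
      intro x y z
      have h : D.intInner (x + y) z = D.intInner x z + D.intInner y z := by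
        have : (D.intInner (x + y) z : ℝ) = D.intInner x z + D.intInner y z := by
          simp [intInner_cast, inner_add_left]
        exact_mod_cast this
      rw [h, Int.cast_add])
    (by
      intro c x z
      have h : D.intInner (c • x) z = c * D.intInner x z := by
        have : (D.intInner (c • x) z : ℝ) = c * D.intInner x z := by
          simp only [intInner_cast, Submodule.coe_smul]
          rw [← Int.cast_smul_eq_zsmul ℝ, real_inner_smul_left]
        exact_mod_cast this
      rw [h, Int.cast_mul, zsmul_eq_mul])
    (by
      intro x y z
      have h : D.intInner x (y + z) = D.intInner x y + D.intInner x z := by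
        have : (D.intInner x (y + z) : ℝ) = D.intInner x y + D.intInner x z := by
          simp [intInner_cast, inner_add_right]
        exact_mod_cast this
      rw [h, Int.cast_add])
    (by
      intro c x z
      have h : D.intInner x (c • z) = c * D.intInner x z := by
        have : (D.intInner x (c • z) : ℝ) = c * D.intInner x z := by
          simp only [intInner_cast, Submodule.coe_smul]
          rw [← Int.cast_smul_eq_zsmul ℝ, real_inner_smul_right]
        exact_mod_cast this
      rw [h, Int.cast_mul, zsmul_eq_mul])

lemma innerModTwo_apply (x y : D.rootLattice) :
    D.innerModTwo x y = (D.intInner x y : ZMod 2) := rfl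

lemma innerModTwo_eq_zero_left {x : D.rootLattice} (hx : x ∈ D.twoP) (y : D.rootLattice) :
    D.innerModTwo x y = 0 := by
  obtain ⟨p, hp, hpx⟩ := hx
  obtain ⟨k, hk⟩ := D.inner_int_of_weightLattice hp y.2
  have h : D.intInner x y = 2 * k := by
    have hpx' : (2 : ℤ) • p = (x : V) := hpx
    have : (D.intInner x y : ℝ) = 2 * k := by
      rw [intInner_cast, ← hpx', ← Int.cast_smul_eq_zsmul ℝ, real_inner_smul_left, hk]
      norm_num
    exact_mod_cast this
  rw [innerModTwo_apply, h, Int.cast_mul]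
  have : ((2 : ℤ) : ZMod 2) = 0 := by decide
  rw [this, zero_mul]

lemma innerModTwo_eq_zero_right (x : D.rootLattice) {y : D.rootLattice} (hy : y ∈ D.twoP) :
    D.innerModTwo x y = 0 := by
  rw [innerModTwo_apply, intInner_comm, ← innerModTwo_apply]
  exact D.innerModTwo_eq_zero_left hy x

/-- The additive version of the form on `R / 2P`. -/
def formAux : D.ModTwoP →ₗ[ℤ] D.ModTwoP →ₗ[ℤ] ZMod 2 :=
  D.twoP.liftQ
    (LinearMap.flip (D.twoP.liftQ D.innerModTwo.flip (by
      intro y hy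
      ext x
      exact D.innerModTwo_eq_zero_right x hy)))
    (by
      intro x hx
      rw [LinearMap.mem_ker]
      ext y
      exact D.innerModTwo_eq_zero_left hx y)

/-- The bilinear form on the `𝔽₂`-vector space `R / 2P` induced by the scalar product. -/
def form : LinearMap.BilinForm (ZMod 2) D.ModTwoP :=
  LinearMap.mk₂ (ZMod 2) (fun x y => D.formAux x y)
    (by intro x y z; simp)
    (by
      intro c x z
      exact ZMod.map_smul (LinearMap.flip D.formAux z) c x)
    (by intro x y z; simp)
    (by
      intro c x z
      exact ZMod.map_smul (D.formAux x) c z)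

lemma form_mk (x y : D.rootLattice) :
    D.form (D.twoP.mkQ x) (D.twoP.mkQ y) = (D.intInner x y : ZMod 2) := rfl

/-- Totally isotropic subspaces of `R / 2P`. -/
def IsTotallyIsotropic (W : Submodule (ZMod 2) D.ModTwoP) : Prop :=
  ∀ x ∈ W, ∀ y ∈ W, D.form x y = 0

open Classical in
/-- A root `α` (one of the two opposite ones) such that `s = s_α`; the junk value is `0`. -/
def rootOf (s : D.weylGroup) : D.rootLattice :=
  if h : ∃ α : D.rootLattice, (α : V) ∈ D.roots ∧ (s : V ≃ₗᵢ[ℝ] V) = rootReflection (α : V)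
  then h.choose else 0

/-- The class in `R / 2P` of the root of a reflection. -/
def tildeP (s : D.weylGroup) : D.ModTwoP := D.twoP.mkQ (D.rootOf s)

/-- The class in `R / 2R` of the root of a reflection. -/
def tildeR (s : D.weylGroup) : D.ModTwoR := D.twoR.mkQ (D.rootOf s)

/-- The subspace of `R / 2P` generated by the classes of the elements of the base of `C`. -/
def cubeSpan (C : Subgroup D.weylGroup) : Submodule (ZMod 2) D.ModTwoP :=
  Submodule.span (ZMod 2) (D.tildeP '' cubeBase C)

/-- The affine subspace of `R / 2R` generated by the classes of the elements of the base of `C`. -/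
def cubeAffineSpan (C : Subgroup D.weylGroup) : AffineSubspace (ZMod 2) D.ModTwoR :=
  affineSpan (ZMod 2) (D.tildeR '' cubeBase C)

/-- The sum `e(A)` in `R / 2R` of the classes of the elements of `A`. -/
def classSum (B : Finset D.weylGroup) : D.ModTwoR := ∑ s ∈ B, D.tildeR s

/-- The set of four-element subsets `B` of the base of `C` with `e(B) = 0`. -/
def cubeBlocks (C : Subgroup D.weylGroup) : Set (Finset D.weylGroup) :=
  {B | (B : Set D.weylGroup) ⊆ cubeBase C ∧ B.card = 4 ∧ D.classSum B = 0}

end SimpleRoots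

/-- A Steiner system `S(t, k, v)` on the set `S` with set of blocks `𝓑`. -/
def IsSteinerSystem {X : Type*} (t k v : ℕ) (S : Set X) (𝓑 : Set (Finset X)) : Prop :=
  S.Finite ∧ S.ncard = v ∧
  (∀ B ∈ 𝓑, (B : Set X) ⊆ S ∧ B.card = k) ∧
  ∀ T : Finset X, (T : Set X) ⊆ S → T.card = t → ∃! B, B ∈ 𝓑 ∧ T ⊆ B

/-- The natural action of `GL₃(𝔽₂)` on `𝔽₂³`. -/
def glThreeAction :
    GL (Fin 3) (ZMod 2) →* MulAut (Multiplicative (Fin 3 → ZMod 2)) where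
  toFun g := AddEquiv.toMultiplicative
    { toFun := fun v => g.val *ᵥ v
      invFun := fun v => g⁻¹.val *ᵥ v
      left_inv := fun v => by
        change _ *ᵥ (_ *ᵥ v) = v
        rw [Matrix.mulVec_mulVec, ← Units.val_mul, inv_mul_cancel, Units.val_one,
          Matrix.one_mulVec]
      right_inv := fun v => by
        change _ *ᵥ (_ *ᵥ v) = v
        rw [Matrix.mulVec_mulVec, ← Units.val_mul, mul_inv_cancel, Units.val_one,
          Matrix.one_mulVec]
      map_add' := fun v w => Matrix.mulVec_add _ v w }
  map_one' := by
    ext v : 1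
    exact congrArg Multiplicative.ofAdd (Matrix.one_mulVec v.toAdd)
  map_mul' g h := by
    ext v : 1
    exact congrArg Multiplicative.ofAdd (Matrix.mulVec_mulVec v.toAdd g.val h.val).symm

end

noncomputable section

/-! ### Reflections in vectors of squared length two -/

section Reflections

variable {V : Type*} [NormedAddCommGroup V] [InnerProductSpace ℝ V]

/-! Both types are treated through one list of properties of the lattices `R ⊆ P`, collected in
`IsTame`, and all computations take place in `R/2P`; for `E₈` one has `P = R`, so this is `R/2R`.
The vectors of `R` that pair evenly with `R` are those in `2P`, so the form on `R/2P` is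
nondegenerate, and it is alternating because `R` is even. A degree one involution of the Weyl group
is the reflection in a root (`IsTame.exists_root`). The roots of two distinct reflections have
scalar product `-1`, `0` or `1`, so the reflections commute exactly when their classes are
orthogonal: the classes of a cube span an isotropic subspace. As `-1` is a product of reflections in
`n` orthogonal roots, the reduced rank is `n`, and the base of a maximal cube gives an orthogonal
frame of roots.

Type `E₇`. The space has dimension 6 and the reflections correspond bijectively to its 63 nonzero
vectors. An isotropic subspace has dimension at most 3, hence at most 7 nonzero vectors, so the
seven classes of a maximal cube fill one exactly. Conversely, the reflections with classes in a
maximal isotropic subspace commute and generate a maximal cube. There are `63 · 30 · 12` isotropic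
frames of length 3, and each subspace has `168` of them as bases, whence `135`.

Type `E₈`. The space has dimension 8, so isotropic subspaces have dimension at most 4. On such a
subspace `(x, x)/2` modulo 2 is additive; it equals 1 on roots, so it vanishes on the direction of
the affine span of the base. This direction therefore has dimension at most 3, and the eight classes
fill the affine span. The sum of three points of an affine space over `𝔽₂` is the fourth point of
their plane, which gives (i) and the Steiner system.

The group `Φ`. An element fixing the base pointwise changes at most the signs of an orthogonal
frame, so it lies in `C`: the action is faithful (`IsTame.cubeAction_injective`). It is induced by
linear maps of `R/2P`, so it acts by linear, resp. affine, permutations. In the other direction, if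
four classes of the base have sum zero, half the sum of the roots lies in `R`, and two reflections
in half-sums with signs compose to a double transposition of the base
(`IsTame.swap_mul_swap_mem_range`). By `mem_of_affine` these double transpositions generate all of
`GL₃(𝔽₂)`, resp. the affine group. Simplicity of `GL₃(𝔽₂)` is Iwasawa's criterion for the action on
the projective plane, applied to the groups of elations. -/

lemma rootReflection_apply {α : V} (hα : inner ℝ α α = (2 : ℝ)) (x : V) :
    rootReflection α x = x - (inner ℝ α x : ℝ) • α := by
  have h2 : ‖α‖ ^ 2 = 2 := by rw [← real_inner_self_eq_norm_sq, hα]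
  rw [rootReflection, Submodule.reflection_orthogonal_apply, Submodule.reflection_singleton_apply]
  simp only [RCLike.ofReal_real_eq_id, id_eq, h2]
  rw [neg_sub, ← Nat.cast_smul_eq_nsmul ℝ, smul_smul]
  congr 2
  push_cast
  ring

lemma rootReflection_self (α : V) : rootReflection α α = -α := by
  rw [rootReflection, Submodule.reflection_orthogonal_apply,
    Submodule.reflection_mem_subspace_eq_self (Submodule.mem_span_singleton_self α)]

lemma rootReflection_of_inner_eq_zero {α x : V} (h : inner ℝ α x = (0 : ℝ)) :
    rootReflection α x = x :=
  Submodule.reflection_mem_subspace_eq_self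
    ((Submodule.mem_orthogonal_singleton_iff_inner_right).mpr h)

lemma rootReflection_mul_self (α : V) : rootReflection α * rootReflection α = 1 :=
  Submodule.reflection_mul_reflection _

lemma rootReflection_neg (α : V) : rootReflection (-α) = rootReflection α := by
  simp only [rootReflection]
  congr 2
  rw [← Set.neg_singleton, Submodule.span_neg]

lemma ne_zero_of_inner_self_eq_two {α : V} (hα : inner ℝ α α = (2 : ℝ)) : α ≠ 0 := by
  rintro rfl
  simp at hα

lemma conj_rootReflection (g : V ≃ₗᵢ[ℝ] V) {α : V} (hα : inner ℝ α α = (2 : ℝ)) :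
    g * rootReflection α * g⁻¹ = rootReflection (g α) := by
  have hg : inner ℝ (g α) (g α) = (2 : ℝ) := by rw [g.inner_map_map, hα]
  refine LinearIsometryEquiv.ext fun x => ?_
  obtain ⟨y, rfl⟩ := g.surjective x
  have hy : g⁻¹ (g y) = y := g.symm_apply_apply y
  change g (rootReflection α (g⁻¹ (g y))) = _
  rw [hy, rootReflection_apply hα, rootReflection_apply hg, g.inner_map_map]
  simp

lemma eq_or_eq_neg_of_smul {α β : V} (hα : inner ℝ α α = (2 : ℝ)) (hβ : inner ℝ β β = (2 : ℝ))
    {c : ℝ} (h : β = c • α) : β = α ∨ β = -α := by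
  have hc : (c - 1) * (c + 1) = 0 := by
    rw [h, real_inner_smul_left, real_inner_smul_right, hα] at hβ
    linarith
  rcases mul_eq_zero.mp hc with h1 | h1
  · left
    rw [h, show c = 1 by linarith, one_smul]
  · right
    rw [h, show c = -1 by linarith, neg_one_smul]

lemma eq_smul_of_rootReflection_eq_neg {α x : V} (hα : inner ℝ α α = (2 : ℝ))
    (h : rootReflection α x = -x) : x = ((inner ℝ α x : ℝ) / 2) • α := by
  rw [rootReflection_apply hα] at h
  have h2 : (2 : ℝ) • x = (inner ℝ α x : ℝ) • α := by
    rw [two_smul, ← sub_eq_zero, ← sub_eq_zero.mpr h]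
    abel
  rw [div_eq_inv_mul, mul_smul, ← h2, smul_smul]
  norm_num

lemma eq_or_eq_neg_of_rootReflection_eq {α β : V} (hα : inner ℝ α α = (2 : ℝ))
    (hβ : inner ℝ β β = (2 : ℝ)) (h : rootReflection α = rootReflection β) :
    β = α ∨ β = -α := by
  refine eq_or_eq_neg_of_smul hα hβ (eq_smul_of_rootReflection_eq_neg hα ?_)
  rw [h, rootReflection_self]

/-- Conjugating `s_β` by `s_α` gives the reflection in `s_α β`, so commuting forces `s_α β = ±β`.
The sign `+` means orthogonality; the sign `-` puts `β` on the line of `α`, and equal lengths leave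
`±α`. -/
lemma eq_or_eq_neg_or_orthogonal_of_commute {α β : V} (hα : inner ℝ α α = (2 : ℝ))
    (hβ : inner ℝ β β = (2 : ℝ))
    (h : rootReflection α * rootReflection β = rootReflection β * rootReflection α) :
    β = α ∨ β = -α ∨ inner ℝ α β = (0 : ℝ) := by
  have h1 : rootReflection β = rootReflection (rootReflection α β) := by
    rw [← conj_rootReflection _ hβ, h, mul_inv_cancel_right]
  rcases eq_or_eq_neg_of_rootReflection_eq hβ (by rw [LinearIsometryEquiv.inner_map_map, hβ]) h1
    with h2 | h2
  · right; right
    rw [rootReflection_apply hα, sub_eq_self, smul_eq_zero] at h2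
    exact h2.resolve_right (ne_zero_of_inner_self_eq_two hα)
  · rcases eq_or_eq_neg_of_smul hα hβ (eq_smul_of_rootReflection_eq_neg hα h2) with h3 | h3
    · exact Or.inl h3
    · exact Or.inr (Or.inl h3)

lemma commute_rootReflection_of_orthogonal {α β : V} (hβ : inner ℝ β β = (2 : ℝ))
    (h : inner ℝ α β = (0 : ℝ)) :
    rootReflection α * rootReflection β = rootReflection β * rootReflection α := by
  have h1 := conj_rootReflection (rootReflection α) hβ
  rw [rootReflection_of_inner_eq_zero h] at h1
  rw [← h1, inv_mul_cancel_right, h1]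

lemma involutionDegree_rootReflection {α : V} (hα : inner ℝ α α = (2 : ℝ)) :
    involutionDegree (rootReflection α) = 1 := by
  rw [involutionDegree]
  have : Module.End.eigenspace ((rootReflection α).toLinearEquiv : V →ₗ[ℝ] V) (-1) = ℝ ∙ α := by
    ext x
    rw [Module.End.mem_eigenspace_iff, Submodule.mem_span_singleton]
    change rootReflection α x = (-1 : ℝ) • x ↔ _
    rw [neg_one_smul]
    constructor
    · intro h
      exact ⟨_, (eq_smul_of_rootReflection_eq_neg hα h).symm⟩
    · rintro ⟨c, rfl⟩
      rw [map_smul, rootReflection_self, smul_neg]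
  rw [this, finrank_span_singleton (ne_zero_of_inner_self_eq_two hα)]

lemma exists_of_involutionDegree_eq_one {u : V ≃ₗᵢ[ℝ] V}
    (h1 : involutionDegree u = 1) :
    ∃ v : V, v ≠ 0 ∧ u v = -v ∧ ∀ x, u x = -x → ∃ c : ℝ, x = c • v := by
  obtain ⟨⟨v, hv⟩, hv0, hv1⟩ := finrank_eq_one_iff'.mp h1
  rw [Module.End.mem_eigenspace_iff] at hv
  refine ⟨v, fun h => hv0 (Subtype.ext h), ?_, fun x hx => ?_⟩
  · simpa using hv
  · obtain ⟨c, hc⟩ := hv1 ⟨x, by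
      rw [Module.End.mem_eigenspace_iff, neg_one_smul]; exact hx⟩
    exact ⟨c, (congrArg Subtype.val hc).symm⟩

end Reflections

/-! ### Simply laced root systems -/

namespace SimpleRoots

variable {n : ℕ} {A : Matrix (Fin n) (Fin n) ℤ} {V : Type*}
  [NormedAddCommGroup V] [InnerProductSpace ℝ V] (D : SimpleRoots A V)

lemma basis_mem_roots (i : Fin n) : D.basis i ∈ D.roots :=
  ⟨1, one_mem _, i, rfl⟩

lemma rootLattice_eq_span_basis : D.rootLattice = Submodule.span ℤ (Set.range D.basis) := by
  refine le_antisymm D.rootLattice_le_span_basis (Submodule.span_mono ?_)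
  rintro _ ⟨i, rfl⟩
  exact D.basis_mem_roots i

lemma mem_rootLattice_iff {x : V} :
    x ∈ D.rootLattice ↔ ∃ c : Fin n → ℤ, ∑ i, c i • D.basis i = x := by
  rw [rootLattice_eq_span_basis, Submodule.mem_span_range_iff_exists_fun]

lemma map_mem_rootLattice {g : V ≃ₗᵢ[ℝ] V} (hg : g ∈ D.weylGroup) {x : V}
    (hx : x ∈ D.rootLattice) : g x ∈ D.rootLattice := by
  rw [rootLattice_eq_span_basis] at *
  exact (D.weylGroup_map_span_basis hg x).mpr hx

lemma map_mem_roots {g : V ≃ₗᵢ[ℝ] V} (hg : g ∈ D.weylGroup) {x : V}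
    (hx : x ∈ D.roots) : g x ∈ D.roots := by
  obtain ⟨h, hh, i, rfl⟩ := hx
  exact ⟨g * h, mul_mem hg hh, i, rfl⟩

lemma rootReflection_mem_weylGroup {α : V} (hα : α ∈ D.roots) :
    rootReflection α ∈ D.weylGroup := by
  obtain ⟨g, hg, i, rfl⟩ := hα
  rw [← conj_rootReflection g (D.inner_root_self (D.basis_mem_roots i))]
  exact mul_mem (mul_mem hg (Subgroup.subset_closure ⟨i, rfl⟩)) (inv_mem hg)

lemma neg_mem_roots {α : V} (hα : α ∈ D.roots) : -α ∈ D.roots := by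
  rw [← rootReflection_self]
  exact D.map_mem_roots (D.rootReflection_mem_weylGroup hα) hα

lemma even_inner_self {x : V} (hx : x ∈ D.rootLattice) :
    ∃ k : ℤ, inner ℝ x x = (2 * k : ℝ) := by
  refine Submodule.span_induction (p := fun x _ => ∃ k : ℤ, inner ℝ x x = (2 * k : ℝ))
    ?_ ⟨0, by simp⟩ ?_ ?_ hx
  · exact fun α hα => ⟨1, by rw [D.inner_root_self hα]; norm_num⟩
  · rintro a b ha hb ⟨k, hk⟩ ⟨l, hl⟩
    obtain ⟨m, hm⟩ := D.inner_int_of_rootLattice ha hb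
    refine ⟨k + l + m, ?_⟩
    rw [real_inner_add_add_self, hk, hl, hm]
    push_cast
    ring
  · rintro c a - ⟨k, hk⟩
    refine ⟨c * c * k, ?_⟩
    rw [← Int.cast_smul_eq_zsmul ℝ, real_inner_smul_left, real_inner_smul_right, hk]
    push_cast
    ring

/-- Descent on the sum of the absolute values of the coordinates. Since `∑ cᵢ (x, αᵢ) = (x, x) > 0`,
some `cᵢ` and `(x, αᵢ)` have the same sign. If `|(x, αᵢ)| = 2`, then `x = ±αᵢ`; otherwise it is 1,
and reflecting in `αᵢ` brings `cᵢ` one step closer to 0. -/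
lemma mem_roots_of_inner_self {x : V} (hx : x ∈ D.rootLattice) (h2 : inner ℝ x x = (2 : ℝ)) :
    x ∈ D.roots := by
  obtain ⟨c, rfl⟩ := D.mem_rootLattice_iff.mp hx
  clear hx
  induction h : ∑ i, (c i).natAbs using Nat.strong_induction_on generalizing c with
  | _ N ih =>
  set x := ∑ i, c i • D.basis i with hxdef
  have hx : x ∈ D.rootLattice := D.mem_rootLattice_iff.mpr ⟨c, rfl⟩
  have hb : ∀ i, D.basis i ∈ D.rootLattice := fun i => Submodule.subset_span (D.basis_mem_roots i)
  choose k hk using fun i => D.inner_int_of_rootLattice hx (hb i)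
  have hpos : (0 : ℝ) < ∑ i, (c i * k i : ℝ) := by
    have : inner ℝ x x = ∑ i, (c i * k i : ℝ) := by
      conv_lhs => rw [hxdef, ← hxdef, hxdef, sum_inner]
      refine Finset.sum_congr rfl fun i _ => ?_
      rw [← Int.cast_smul_eq_zsmul ℝ, real_inner_smul_left, real_inner_comm, ← hxdef, hk]
    rw [← this, h2]
    norm_num
  obtain ⟨i, -, hi⟩ := Finset.exists_lt_of_sum_lt (s := Finset.univ) (f := fun _ => (0 : ℝ))
    (by simpa using hpos)
  have hi' : 0 < c i * k i := by exact_mod_cast hi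
  have hbi : inner ℝ (D.basis i) (D.basis i) = (2 : ℝ) := D.inner_root_self (D.basis_mem_roots i)
  have hsub : inner ℝ (x - D.basis i) (x - D.basis i) = (4 - 2 * k i : ℝ) := by
    rw [real_inner_sub_sub_self, h2, hbi, hk]; ring
  have hadd : inner ℝ (x + D.basis i) (x + D.basis i) = (4 + 2 * k i : ℝ) := by
    rw [real_inner_add_add_self, h2, hbi, hk]; ring
  have hle : k i ≤ 2 := by
    have := real_inner_self_nonneg (x := x - D.basis i)
    rw [hsub] at this
    have : (k i : ℝ) ≤ 2 := by linarith
    exact_mod_cast this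
  have hge : -2 ≤ k i := by
    have := real_inner_self_nonneg (x := x + D.basis i)
    rw [hadd] at this
    have : (-2 : ℝ) ≤ (k i : ℝ) := by linarith
    exact_mod_cast this
  rcases eq_or_lt_of_le hle with h2' | hlt
  · rw [h2'] at hsub
    norm_num at hsub
    rw [sub_eq_zero.mp hsub]
    exact D.basis_mem_roots i
  rcases eq_or_lt_of_le hge with h2' | hgt
  · rw [← h2'] at hadd
    norm_num at hadd
    rw [eq_neg_of_add_eq_zero_left hadd]
    exact D.neg_mem_roots (D.basis_mem_roots i)
  have hne : k i ≠ 0 := by rintro h0; simp [h0] at hi'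
  have hrefl : rootReflection (D.basis i) x = ∑ j, (c j - Pi.single (M := fun _ => ℤ) i (k i) j) • D.basis j := by
    rw [rootReflection_apply hbi, real_inner_comm, hk, hxdef]
    simp only [sub_smul, Finset.sum_sub_distrib]
    congr 1
    rw [Finset.sum_eq_single i (fun j _ hj => by simp [hj]) (by simp)]
    simp [Int.cast_smul_eq_zsmul ℝ]
  have key := ih (∑ j, (c j - Pi.single (M := fun _ => ℤ) i (k i) j).natAbs) (by
      rw [← h]
      refine Finset.sum_lt_sum (fun j _ => ?_) ⟨i, Finset.mem_univ i, ?_⟩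
      · by_cases hj : j = i
        · subst hj
          have h1 : k j = 1 ∨ k j = -1 := by omega
          rw [Pi.single_eq_same]
          rcases h1 with h1 | h1 <;> rw [h1] at hi' ⊢ <;> omega
        · simp [hj]
      · have h1 : k i = 1 ∨ k i = -1 := by omega
        rw [Pi.single_eq_same]
        rcases h1 with h1 | h1 <;> rw [h1] at hi' ⊢ <;> omega)
    (fun j => c j - Pi.single (M := fun _ => ℤ) i (k i) j)
    (by rw [← hrefl, LinearIsometryEquiv.inner_map_map, h2]) rfl
  rw [← hrefl] at key
  have hm := D.rootReflection_mem_weylGroup (D.basis_mem_roots i)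
  have := D.map_mem_roots hm key
  rwa [show rootReflection (D.basis i) (rootReflection (D.basis i) x) = x from
    Submodule.reflection_reflection _ x] at this

/-! ### The weight lattice, the lattices `2P` and `2R`, and nondegeneracy of the form -/

lemma mem_weightLattice_iff {x : V} :
    x ∈ D.weightLattice ↔ ∀ i, ∃ k : ℤ, inner ℝ x (D.basis i) = (k : ℝ) := by
  constructor
  · exact fun h i => D.inner_int_of_weightLattice h (Submodule.subset_span (D.basis_mem_roots i))
  · intro h α hα
    obtain ⟨k, hk⟩ := inner_int_of_span (T := Set.range D.basis) (x := x)
      (by rintro _ ⟨i, rfl⟩; exact h i) (D.rootLattice_le_span_basis (Submodule.subset_span hα))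
    exact ⟨k, by rw [D.inner_root_self hα, hk]; ring⟩

lemma mem_twoP_iff {x : D.rootLattice} :
    x ∈ D.twoP ↔ ∃ p ∈ D.weightLattice, (2 : ℝ) • p = (x : V) := by
  constructor
  · rintro ⟨p, hp, h⟩
    refine ⟨p, hp, ?_⟩
    rw [Submodule.subtype_apply] at h
    rw [← h]
    simp [two_smul]
  · rintro ⟨p, hp, h⟩
    refine ⟨p, hp, ?_⟩
    rw [Submodule.subtype_apply, ← h]
    simp [two_smul]

/-- The vector `x/2` is a weight exactly when `x` pairs evenly with the simple roots. This
identifies the radical of the form modulo 2 and makes the form on `R/2P` nondegenerate. -/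
lemma mem_twoP_iff_form {x : D.rootLattice} : x ∈ D.twoP ↔ ∀ y, D.innerModTwo x y = 0 := by
  refine ⟨fun h y => D.innerModTwo_eq_zero_left h y, fun h => ?_⟩
  refine D.mem_twoP_iff.mpr ⟨(2⁻¹ : ℝ) • (x : V), D.mem_weightLattice_iff.mpr fun i => ?_, ?_⟩
  · have hi := h ⟨D.basis i, Submodule.subset_span (D.basis_mem_roots i)⟩
    rw [innerModTwo_apply, ZMod.intCast_zmod_eq_zero_iff_dvd] at hi
    obtain ⟨k, hk⟩ := hi
    refine ⟨k, ?_⟩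
    have := D.intInner_cast x ⟨D.basis i, Submodule.subset_span (D.basis_mem_roots i)⟩
    rw [hk] at this
    rw [real_inner_smul_left, ← this]
    push_cast
    ring
  · rw [smul_smul]
    norm_num

lemma mem_twoR_iff {x : D.rootLattice} :
    x ∈ D.twoR ↔ ∃ p ∈ D.rootLattice, (2 : ℝ) • p = (x : V) := by
  constructor
  · rintro ⟨p, h⟩
    refine ⟨p, p.2, ?_⟩
    rw [← h]
    simp [two_smul]
  · rintro ⟨p, hp, h⟩
    refine ⟨⟨p, hp⟩, Subtype.ext ?_⟩
    rw [← h]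
    simp [two_smul]

lemma form_self (x : D.ModTwoP) : D.form x x = 0 := by
  induction x using Submodule.Quotient.induction_on with
  | H x =>
  change (D.intInner x x : ZMod 2) = 0
  obtain ⟨k, hk⟩ := D.even_inner_self x.2
  rw [← D.intInner_cast] at hk
  have : D.intInner x x = 2 * k := by exact_mod_cast hk
  rw [ZMod.intCast_zmod_eq_zero_iff_dvd, this]
  exact ⟨k, rfl⟩

lemma eq_zero_of_form {x : D.ModTwoP} (h : ∀ y, D.form x y = 0) : x = 0 := by
  induction x using Submodule.Quotient.induction_on with
  | H x =>
  rw [Submodule.Quotient.mk_eq_zero]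
  exact D.mem_twoP_iff_form.mpr fun y => h (D.twoP.mkQ y)

lemma form_isAlt : D.form.IsAlt := D.form_self

instance finite_rootLattice : Module.Finite ℤ D.rootLattice := by
  rw [rootLattice_eq_span_basis]
  exact Module.Finite.span_of_finite ℤ (Set.finite_range _)

instance finite_modTwoP : Module.Finite (ZMod 2) D.ModTwoP :=
  Module.Finite.of_restrictScalars_finite ℤ _ _

lemma form_nondegenerate : D.form.Nondegenerate :=
  (LinearMap.BilinForm.nondegenerate_iff_ker_eq_bot.mpr
    (LinearMap.ker_eq_bot'.mpr fun _ h => D.eq_zero_of_form fun y => LinearMap.congr_fun h y))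

end SimpleRoots

namespace SimpleRoots

variable {n : ℕ} {A : Matrix (Fin n) (Fin n) ℤ} {V : Type*}
  [NormedAddCommGroup V] [InnerProductSpace ℝ V] (D : SimpleRoots A V)

/-- The properties shared by the types `E₇` and `E₈`: the weight lattice is contained in half the
root lattice, its short vectors are controlled, and there are as many orthogonal roots as the
rank. -/
structure IsTame : Prop where
  two_smul_mem : ∀ p ∈ D.weightLattice, (2 : ℝ) • p ∈ D.rootLattice
  inner_self_ne_half : ∀ p ∈ D.weightLattice, inner ℝ p p ≠ (1 / 2 : ℝ)
  inner_self_ne_one : ∀ p ∈ D.weightLattice, inner ℝ p p ≠ (1 : ℝ)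
  mem_of_inner_self : ∀ p ∈ D.weightLattice, inner ℝ p p = (2 : ℝ) → p ∈ D.rootLattice
  frame : ∃ v : Fin n → V, (∀ i, v i ∈ D.roots) ∧ ∀ i j, i ≠ j → inner ℝ (v i) (v j) = (0 : ℝ)

variable {D}

/-! ### Reflections of the Weyl group -/

/-- The (-1)-eigenspace is a line that meets `R`, because `αᵢ - u αᵢ` is nonzero for some `i`. A
shortest nonzero lattice vector on this line generates the lattice vectors on it: a nonintegral
multiple `t w` would leave the shorter remainder `(t - ⌊t⌋) w`. -/
lemma exists_primitive_of_involution {u : V ≃ₗᵢ[ℝ] V} (hu : u ∈ D.weylGroup) (hu2 : u * u = 1)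
    (h1 : involutionDegree u = 1) :
    ∃ w ∈ D.rootLattice, w ≠ 0 ∧ u w = -w ∧ (∀ x, u x = -x → ∃ t : ℝ, x = t • w) ∧
      ∀ x ∈ D.rootLattice, u x = -x → ∃ k : ℤ, x = (k : ℝ) • w := by
  obtain ⟨v, hv0, hv, hv1⟩ := exists_of_involutionDegree_eq_one h1
  have huu : ∀ x, u (u x) = x := fun x => by
    change (u * u) x = x
    rw [hu2]; rfl
  have hb : ∀ i, D.basis i ∈ D.rootLattice := fun i => Submodule.subset_span (D.basis_mem_roots i)
  obtain ⟨i, hi⟩ : ∃ i, u (D.basis i) ≠ D.basis i := by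
    by_contra! h
    have h3 : (u.toLinearEquiv : V →ₗ[ℝ] V) = LinearMap.id := D.basis.ext fun i => h i
    have h4 : u v = v := LinearMap.congr_fun h3 v
    rw [h4] at hv
    have h5 : (2 : ℝ) • v = 0 := by rw [two_smul, ← eq_neg_iff_add_eq_zero, ← hv]
    exact hv0 ((smul_eq_zero.mp h5).resolve_left two_ne_zero)
  obtain ⟨w, ⟨hwR, hw0, hw⟩, hmin⟩ := (measure fun x : V => ⌊(inner ℝ x x : ℝ)⌋₊).wf.has_min
    {x | x ∈ D.rootLattice ∧ x ≠ 0 ∧ u x = -x}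
    ⟨D.basis i - u (D.basis i), sub_mem (hb i) (D.map_mem_rootLattice hu (hb i)),
      fun h => hi (sub_eq_zero.mp h).symm, by rw [map_sub, huu]; abel⟩
  have hspan : ∀ x, u x = -x → ∃ t : ℝ, x = t • w := by
    intro x hx
    obtain ⟨c, rfl⟩ := hv1 x hx
    obtain ⟨c', rfl⟩ := hv1 w hw
    have : c' ≠ 0 := by rintro rfl; simp at hw0
    exact ⟨c / c', by rw [smul_smul, div_mul_cancel₀ _ this]⟩
  refine ⟨w, hwR, hw0, hw, hspan, fun x hxR hx => ?_⟩
  obtain ⟨t, rfl⟩ := hspan x hx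
  refine ⟨⌊t⌋, ?_⟩
  by_contra hne
  have hyR : t • w - (⌊t⌋ : ℝ) • w ∈ D.rootLattice := by
    rw [Int.cast_smul_eq_zsmul ℝ]
    exact sub_mem hxR (Submodule.smul_mem _ _ hwR)
  -- Norms on `R` are integers, so the rounding in the measure that `w` minimises loses nothing.
  have hcast : ∀ y ∈ D.rootLattice, ((⌊(inner ℝ y y : ℝ)⌋₊ : ℕ) : ℝ) = inner ℝ y y := by
    intro y hy
    obtain ⟨k, hk⟩ := D.inner_int_of_rootLattice hy hy
    have h0 : (0 : ℝ) ≤ inner ℝ y y := real_inner_self_nonneg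
    rw [hk] at h0 ⊢
    lift k to ℕ using by exact_mod_cast h0
    simp
  refine hmin _ ⟨hyR, sub_ne_zero.mpr hne, ?_⟩ ?_
  · simp only [map_sub, map_smul, hw]
    module
  · change (_ : ℕ) < _
    rw [← Nat.cast_lt (α := ℝ), hcast _ hyR, hcast _ hwR, ← sub_smul, real_inner_smul_left,
      real_inner_smul_right]
    have hw2 : (0 : ℝ) < inner ℝ w w := real_inner_self_pos.mpr hw0
    have h3 : 0 ≤ t - ⌊t⌋ := sub_nonneg.mpr (Int.floor_le t)
    have h4 : t - ⌊t⌋ < 1 := by linarith [Int.lt_floor_add_one t]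
    have h5 : (t - ⌊t⌋) * (t - ⌊t⌋) < 1 := by nlinarith
    rw [← mul_assoc]
    exact mul_lt_of_lt_one_left hw2 h5

/-- Let `w` generate the lattice points of the (-1)-eigenspace and put `(w, w) = 2m`. Then `p =
2w/(w, w)` is a weight, and `2p ∈ R` is an integral multiple `k w` with `m k = 2`. For `m = 1` the
vector `w` is a root; for `m = 2` the weight `p` would have norm 1. -/
lemma IsTame.exists_root (hD : D.IsTame) (s : D.weylGroup) (hs : IsGroupReflection s) :
    ∃ α ∈ D.roots, (s : V ≃ₗᵢ[ℝ] V) = rootReflection α := by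
  obtain ⟨hs2, hs1⟩ := hs
  have hu2 : (s : V ≃ₗᵢ[ℝ] V) * s = 1 := by
    rw [← Subgroup.coe_mul, ← sq, hs2, Subgroup.coe_one]
  obtain ⟨w, hwR, hw0, hw, hspan, hwint⟩ := exists_primitive_of_involution s.2 hu2 hs1
  set u : V ≃ₗᵢ[ℝ] V := s.1
  have huu : ∀ x, u (u x) = x := fun x => by
    change (u * u) x = x
    rw [hu2]; rfl
  have hb : ∀ i, D.basis i ∈ D.rootLattice := fun i => Submodule.subset_span (D.basis_mem_roots i)
  have hw2 : (0 : ℝ) < inner ℝ w w := real_inner_self_pos.mpr hw0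
  have hflip : ∀ x, u (x - u x) = -(x - u x) := fun x => by rw [map_sub, huu]; abel
  have hinner : ∀ x, inner ℝ (x - u x) w = (2 * inner ℝ x w : ℝ) := by
    intro x
    have : inner ℝ (u x) w = (-inner ℝ x w : ℝ) := by
      rw [← u.inner_map_map x w, hw, inner_neg_right, neg_neg]
    rw [inner_sub_left, this]
    ring
  set p : V := (2 / inner ℝ w w : ℝ) • w with hp
  have hpP : p ∈ D.weightLattice := by
    refine D.mem_weightLattice_iff.mpr fun i => ?_
    -- The difference `αᵢ - u αᵢ` is an integral multiple of `w`, and the coefficient is `(p, αᵢ)`.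
    obtain ⟨k, hk⟩ := hwint _ (sub_mem (hb i) (D.map_mem_rootLattice s.2 (hb i))) (hflip _)
    refine ⟨k, ?_⟩
    have h3 := hinner (D.basis i)
    rw [hk, real_inner_smul_left] at h3
    rw [hp, real_inner_smul_left, real_inner_comm (D.basis i) w,
      div_mul_eq_mul_div, ← h3]
    field_simp
  obtain ⟨k, hk⟩ := hwint _ (hD.two_smul_mem p hpP) (by simp only [hp, map_smul, hw]; module)
  obtain ⟨m, hm⟩ := D.even_inner_self hwR
  have hk' : (2 : ℝ) * (2 / inner ℝ w w) = k := by
    rw [hp, smul_smul] at hk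
    exact smul_left_injective ℝ hw0 hk
  have hmk : m * k = 2 := by
    have : (m : ℝ) * k = 2 := by
      rw [← hk']
      field_simp
      linarith
    exact_mod_cast this
  have hm0 : 0 < m := by
    rw [hm] at hw2
    have : (0 : ℝ) < m := by linarith
    exact_mod_cast this
  have hm1 : m = 1 ∨ m = 2 := by
    have : m ≤ 2 := Int.le_of_dvd (by norm_num) ⟨k, hmk.symm⟩
    omega
  rcases hm1 with rfl | rfl
  · have hw2' : inner ℝ w w = (2 : ℝ) := by rw [hm]; norm_num
    refine ⟨w, D.mem_roots_of_inner_self hwR hw2', LinearIsometryEquiv.ext fun x => ?_⟩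
    obtain ⟨t, ht⟩ := hspan _ (hflip x)
    have h3 := hinner x
    rw [ht, real_inner_smul_left, hw2'] at h3
    rw [rootReflection_apply hw2', real_inner_comm, show (inner ℝ x w : ℝ) = t by linarith, ← ht]
    abel
  · refine absurd ?_ (hD.inner_self_ne_one p hpP)
    rw [hp, real_inner_smul_left, real_inner_smul_right, hm]
    norm_num

lemma isGroupReflection_of_root {s : D.weylGroup} {α : V} (hα : α ∈ D.roots)
    (hs : (s : V ≃ₗᵢ[ℝ] V) = rootReflection α) : IsGroupReflection s := by
  refine ⟨Subtype.ext ?_, ?_⟩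
  · rw [sq, Subgroup.coe_mul, hs, rootReflection_mul_self, Subgroup.coe_one]
  · rw [hs, involutionDegree_rootReflection (D.inner_root_self hα)]

lemma rootOf_spec {s : D.weylGroup} {α : V} (hα : α ∈ D.roots)
    (hs : (s : V ≃ₗᵢ[ℝ] V) = rootReflection α) :
    (D.rootOf s : V) ∈ D.roots ∧ (s : V ≃ₗᵢ[ℝ] V) = rootReflection (D.rootOf s : V) := by
  have h : ∃ α : D.rootLattice, (α : V) ∈ D.roots ∧
      (s : V ≃ₗᵢ[ℝ] V) = rootReflection (α : V) := ⟨⟨α, Submodule.subset_span hα⟩, hα, hs⟩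
  rw [rootOf, dif_pos h]
  exact h.choose_spec

lemma rootOf_eq_or_eq_neg {s : D.weylGroup} {α : D.rootLattice} (hα : (α : V) ∈ D.roots)
    (hs : (s : V ≃ₗᵢ[ℝ] V) = rootReflection (α : V)) : D.rootOf s = α ∨ D.rootOf s = -α := by
  obtain ⟨h1, h2⟩ := rootOf_spec hα hs
  rcases eq_or_eq_neg_of_rootReflection_eq (D.inner_root_self hα) (D.inner_root_self h1)
    (hs.symm.trans h2) with h | h
  · exact Or.inl (Subtype.ext h)
  · exact Or.inr (Subtype.ext h)

lemma tildeP_eq {s : D.weylGroup} {α : D.rootLattice} (hα : (α : V) ∈ D.roots)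
    (hs : (s : V ≃ₗᵢ[ℝ] V) = rootReflection (α : V)) : D.tildeP s = D.twoP.mkQ α := by
  rcases rootOf_eq_or_eq_neg hα hs with h | h
  · rw [tildeP, h]
  · rw [tildeP, h, map_neg]
    exact ZModModule.neg_eq_self (D.twoP.mkQ α)

lemma tildeR_eq {s : D.weylGroup} {α : D.rootLattice} (hα : (α : V) ∈ D.roots)
    (hs : (s : V ≃ₗᵢ[ℝ] V) = rootReflection (α : V)) : D.tildeR s = D.twoR.mkQ α := by
  rcases rootOf_eq_or_eq_neg hα hs with h | h
  · rw [tildeR, h]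
  · rw [tildeR, h, map_neg]
    exact ZModModule.neg_eq_self (D.twoR.mkQ α)

/-! ### Classes of reflections modulo `2P`: injectivity, and commutation as orthogonality -/

namespace IsTame

variable (hD : D.IsTame)
include hD

lemma rootOf_mem {s : D.weylGroup} (hs : IsGroupReflection s) : (D.rootOf s : V) ∈ D.roots := by
  obtain ⟨α, hα, h⟩ := hD.exists_root s hs
  exact (rootOf_spec hα h).1

lemma coe_eq {s : D.weylGroup} (hs : IsGroupReflection s) :
    (s : V ≃ₗᵢ[ℝ] V) = rootReflection (D.rootOf s : V) := by
  obtain ⟨α, hα, h⟩ := hD.exists_root s hs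
  exact (rootOf_spec hα h).2

lemma inner_rootOf_self {s : D.weylGroup} (hs : IsGroupReflection s) :
    inner ℝ (D.rootOf s : V) (D.rootOf s : V) = (2 : ℝ) :=
  D.inner_root_self (hD.rootOf_mem hs)

lemma eq_of_rootOf {s t : D.weylGroup} (hs : IsGroupReflection s) (ht : IsGroupReflection t)
    (h : (D.rootOf s : V) = D.rootOf t ∨ (D.rootOf s : V) = -D.rootOf t) : s = t := by
  refine Subtype.ext ?_
  rw [hD.coe_eq hs, hD.coe_eq ht]
  rcases h with h | h
  · rw [h]
  · rw [h, rootReflection_neg]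

/-- Strict Cauchy–Schwarz: roots of distinct reflections are not proportional, so their sum and
difference have positive norms `4 ± 2k`. -/
lemma inner_rootOf_cases {s t : D.weylGroup} (hs : IsGroupReflection s)
    (ht : IsGroupReflection t) (hst : s ≠ t) :
    D.intInner (D.rootOf s) (D.rootOf t) = -1 ∨ D.intInner (D.rootOf s) (D.rootOf t) = 0 ∨
      D.intInner (D.rootOf s) (D.rootOf t) = 1 := by
  have hc := D.intInner_cast (D.rootOf s) (D.rootOf t)
  set k := D.intInner (D.rootOf s) (D.rootOf t)
  have hsub : (4 - 2 * k : ℝ) = inner ℝ ((D.rootOf s : V) - D.rootOf t)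
      ((D.rootOf s : V) - D.rootOf t) := by
    rw [real_inner_sub_sub_self, hD.inner_rootOf_self hs, hD.inner_rootOf_self ht, hc]; ring
  have hadd : (4 + 2 * k : ℝ) = inner ℝ ((D.rootOf s : V) + D.rootOf t)
      ((D.rootOf s : V) + D.rootOf t) := by
    rw [real_inner_add_add_self, hD.inner_rootOf_self hs, hD.inner_rootOf_self ht, hc]; ring
  have h1 : (0 : ℝ) < 4 - 2 * k := by
    rw [hsub]
    exact real_inner_self_pos.mpr (sub_ne_zero.mpr fun h =>
      hst (hD.eq_of_rootOf hs ht (Or.inl h)))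
  have h2 : (0 : ℝ) < 4 + 2 * k := by
    rw [hadd]
    exact real_inner_self_pos.mpr fun h =>
      hst (hD.eq_of_rootOf hs ht (Or.inr (eq_neg_of_add_eq_zero_left h)))
  have h3 : 0 < 4 - 2 * k := by exact_mod_cast h1
  have h4 : 0 < 4 + 2 * k := by exact_mod_cast h2
  omega

/-- A root of the form `2p` would give a weight `p` of norm `1/2`. -/
lemma tildeP_ne_zero {s : D.weylGroup} (hs : IsGroupReflection s) : D.tildeP s ≠ 0 := by
  intro h
  rw [tildeP, Submodule.mkQ_apply, Submodule.Quotient.mk_eq_zero, mem_twoP_iff] at h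
  obtain ⟨p, hp, h⟩ := h
  have h2 := hD.inner_rootOf_self hs
  rw [← h, real_inner_smul_left, real_inner_smul_right] at h2
  exact hD.inner_self_ne_half p hp (by linarith)

/-- If `α - β = 2p`, pairing with `α` shows that `(α, β)` is even. For distinct reflections it is
then 0, and `p` would be a weight of norm 1. -/
lemma tildeP_injOn : Set.InjOn D.tildeP {s | IsGroupReflection s} := by
  intro s hs t ht h
  by_contra hne
  rw [tildeP, tildeP, ← sub_eq_zero, ← map_sub, Submodule.mkQ_apply,
    Submodule.Quotient.mk_eq_zero, mem_twoP_iff] at h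
  obtain ⟨p, hp, h⟩ := h
  rw [Submodule.coe_sub] at h
  obtain ⟨m, hm⟩ := D.inner_int_of_weightLattice hp (D.rootOf s).2
  have hc := D.intInner_cast (D.rootOf s) (D.rootOf t)
  have h1 : (2 * m : ℝ) = 2 - D.intInner (D.rootOf s) (D.rootOf t) := by
    rw [← hm, hc, ← real_inner_smul_left, h, inner_sub_left, hD.inner_rootOf_self hs,
      real_inner_comm]
  have h1' : 2 * m = 2 - D.intInner (D.rootOf s) (D.rootOf t) := by exact_mod_cast h1
  have h0 : D.intInner (D.rootOf s) (D.rootOf t) = 0 := by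
    have := hD.inner_rootOf_cases hs ht hne
    omega
  refine hD.inner_self_ne_one p hp ?_
  have h2 := congrArg (fun x : V => (inner ℝ x x : ℝ)) h
  rw [real_inner_sub_sub_self, real_inner_smul_left, real_inner_smul_right,
    hD.inner_rootOf_self hs, hD.inner_rootOf_self ht, ← hc, h0] at h2
  push_cast at h2
  linarith

lemma inner_eq_zero_of_form {s t : D.weylGroup} (hs : IsGroupReflection s)
    (ht : IsGroupReflection t) (hst : s ≠ t) (h : D.form (D.tildeP s) (D.tildeP t) = 0) :
    inner ℝ (D.rootOf s : V) (D.rootOf t : V) = (0 : ℝ) := by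
  rw [tildeP, tildeP, form_mk, ZMod.intCast_zmod_eq_zero_iff_dvd] at h
  rw [← D.intInner_cast]
  have := hD.inner_rootOf_cases hs ht hst
  have h0 : D.intInner (D.rootOf s) (D.rootOf t) = 0 := by omega
  rw [h0, Int.cast_zero]

lemma inner_eq_zero_of_commute {s t : D.weylGroup} (hs : IsGroupReflection s)
    (ht : IsGroupReflection t) (hst : s ≠ t) (h : s * t = t * s) :
    inner ℝ (D.rootOf s : V) (D.rootOf t : V) = (0 : ℝ) := by
  have h' : (s : V ≃ₗᵢ[ℝ] V) * t = t * s := congrArg Subtype.val h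
  rw [hD.coe_eq hs, hD.coe_eq ht] at h'
  rcases eq_or_eq_neg_or_orthogonal_of_commute (hD.inner_rootOf_self hs)
    (hD.inner_rootOf_self ht) h' with h | h | h
  · exact absurd (hD.eq_of_rootOf ht hs (Or.inl h)).symm hst
  · exact absurd (hD.eq_of_rootOf ht hs (Or.inr h)).symm hst
  · exact h

lemma commute_of_inner_eq_zero {s t : D.weylGroup} (hs : IsGroupReflection s)
    (ht : IsGroupReflection t) (h : inner ℝ (D.rootOf s : V) (D.rootOf t : V) = (0 : ℝ)) :
    s * t = t * s := by
  refine Subtype.ext ?_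
  rw [Subgroup.coe_mul, Subgroup.coe_mul, hD.coe_eq hs, hD.coe_eq ht]
  exact commute_rootReflection_of_orthogonal (hD.inner_rootOf_self ht) h

lemma form_eq_zero_of_commute {s t : D.weylGroup} (hs : IsGroupReflection s)
    (ht : IsGroupReflection t) (h : s * t = t * s) : D.form (D.tildeP s) (D.tildeP t) = 0 := by
  by_cases hst : s = t
  · rw [hst, form_self]
  · have h0 := hD.inner_eq_zero_of_commute hs ht hst h
    rw [← D.intInner_cast, Int.cast_eq_zero] at h0
    rw [tildeP, tildeP, form_mk, h0, Int.cast_zero]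

lemma commute_of_form_eq_zero {s t : D.weylGroup} (hs : IsGroupReflection s)
    (ht : IsGroupReflection t) (h : D.form (D.tildeP s) (D.tildeP t) = 0) : s * t = t * s := by
  by_cases hst : s = t
  · rw [hst]
  · exact hD.commute_of_inner_eq_zero hs ht (hD.inner_eq_zero_of_form hs ht hst h)

end IsTame

end SimpleRoots

/-! ### The conjugation action on the base of a cube -/

section CubeAction

variable {V : Type*} [NormedAddCommGroup V] [InnerProductSpace ℝ V]

lemma involutionDegree_conj (g u : V ≃ₗᵢ[ℝ] V) :
    involutionDegree (g * u * g⁻¹) = involutionDegree u := by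
  have h : Module.End.eigenspace ((g * u * g⁻¹).toLinearEquiv : V →ₗ[ℝ] V) (-1) =
      (Module.End.eigenspace (u.toLinearEquiv : V →ₗ[ℝ] V) (-1)).map
        (g.toLinearEquiv : V →ₗ[ℝ] V) := by
    ext x
    obtain ⟨y, rfl⟩ := g.surjective x
    have hy : g⁻¹ (g y) = y := g.symm_apply_apply y
    have : g y ∈ (Module.End.eigenspace (u.toLinearEquiv : V →ₗ[ℝ] V) (-1)).map
        (g.toLinearEquiv : V →ₗ[ℝ] V) ↔
        y ∈ Module.End.eigenspace (u.toLinearEquiv : V →ₗ[ℝ] V) (-1) :=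
      ⟨fun ⟨z, hz, e⟩ => g.injective e ▸ hz, fun h => ⟨y, h, rfl⟩⟩
    rw [this, Module.End.mem_eigenspace_iff, Module.End.mem_eigenspace_iff]
    change g (u (g⁻¹ (g y))) = (-1 : ℝ) • g y ↔ u y = (-1 : ℝ) • y
    rw [hy, ← map_smul]
    exact g.injective.eq_iff
  rw [involutionDegree, h, involutionDegree]
  exact LinearEquiv.finrank_map_eq g.toLinearEquiv _

variable {G : Subgroup (V ≃ₗᵢ[ℝ] V)} {C : Subgroup G}

lemma IsGroupReflection.conj {s : G} (hs : IsGroupReflection s) (g : G) :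
    IsGroupReflection (g * s * g⁻¹) := by
  refine ⟨?_, ?_⟩
  · rw [conj_pow, hs.1, mul_one, mul_inv_cancel]
  · rw [Subgroup.coe_mul, Subgroup.coe_mul, Subgroup.coe_inv, involutionDegree_conj, hs.2]

lemma conj_mem_cubeBase {g : G} (hg : g ∈ Subgroup.normalizer (C : Set G)) {s : G}
    (hs : s ∈ cubeBase C) : g * s * g⁻¹ ∈ cubeBase C :=
  ⟨(Subgroup.mem_normalizer_iff.mp hg s).mp hs.1, hs.2.conj g⟩

variable (C) in
/-- The normalizer of `C` acts by conjugation on the reflections in `C`. -/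
def normalizerAction : Subgroup.normalizer (C : Set G) →* Equiv.Perm (cubeBase C) where
  toFun g :=
    { toFun := fun s => ⟨g * s * (g : G)⁻¹, conj_mem_cubeBase g.2 s.2⟩
      invFun := fun s => ⟨(g : G)⁻¹ * s * ((g : G)⁻¹)⁻¹, conj_mem_cubeBase (inv_mem g.2) s.2⟩
      left_inv := fun s => Subtype.ext (by simp [mul_assoc])
      right_inv := fun s => Subtype.ext (by simp [mul_assoc]) }
  map_one' := Equiv.ext fun s => Subtype.ext (by simp)
  map_mul' g h := Equiv.ext fun s => Subtype.ext (by simp [mul_assoc])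

/-- The group `Φ_C` acts by conjugation on the reflections in `C`. -/
def cubeAction (hC : IsCube C) : cubePhi C →* Equiv.Perm (cubeBase C) :=
  QuotientGroup.lift _ (normalizerAction C) (by
    intro g hg
    refine Equiv.ext fun s => Subtype.ext ?_
    change (g : G) * s * (g : G)⁻¹ = s
    rw [hC.1 g hg s s.2.1, mul_inv_cancel_right])

lemma cubeAction_mk (hC : IsCube C) (g : Subgroup.normalizer (C : Set G)) (s : cubeBase C) :
    (cubeAction hC (g : cubePhi C) s : G) = g * s * (g : G)⁻¹ := rfl

lemma isConjugationAction_cubeAction (hC : IsCube C) : IsConjugationAction (cubeAction hC) :=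
  cubeAction_mk hC

end CubeAction

namespace SimpleRoots

variable {n : ℕ} {A : Matrix (Fin n) (Fin n) ℤ} {V : Type*}
  [NormedAddCommGroup V] [InnerProductSpace ℝ V] {D : SimpleRoots A V}

/-! ### Orthogonal frames of roots -/

lemma finrank_eq (D : SimpleRoots A V) : Module.finrank ℝ V = n := by
  rw [Module.finrank_eq_card_basis D.basis, Fintype.card_fin]

lemma finiteDimensional (D : SimpleRoots A V) : FiniteDimensional ℝ V :=
  Module.Basis.finiteDimensional_of_finite D.basis

lemma ext_of_frame (D : SimpleRoots A V) {ι : Type*} [Fintype ι] (hι : Fintype.card ι = n)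
    {v : ι → V} (hv : ∀ i, v i ∈ D.roots) (ho : ∀ i j, i ≠ j → inner ℝ (v i) (v j) = (0 : ℝ))
    {g h : V ≃ₗᵢ[ℝ] V} (hgh : ∀ i, g (v i) = h (v i)) : g = h := by
  have := D.finiteDimensional
  have hli : LinearIndependent ℝ v := linearIndependent_of_ne_zero_of_inner_eq_zero
    (fun i => ne_zero_of_inner_self_eq_two (D.inner_root_self (hv i))) fun i j hij => ho i j hij
  have hspan : Submodule.span ℝ (Set.range v) = ⊤ :=
    hli.span_eq_top_of_card_eq_finrank' (by rw [hι, D.finrank_eq])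
  have key : (g.toLinearEquiv : V →ₗ[ℝ] V) = h.toLinearEquiv :=
    LinearMap.ext_on_range hspan hgh
  exact LinearIsometryEquiv.ext fun x => LinearMap.congr_fun key x

/-- An isometry that only changes signs in an orthogonal frame is the product of the reflections in
the vectors it reverses. The product is built up over finite subsets `F` of the frame. -/
lemma mem_of_frame (D : SimpleRoots A V) {ι : Type*} [Fintype ι] (hι : Fintype.card ι = n)
    {v : ι → V} (hv : ∀ i, v i ∈ D.roots) (ho : ∀ i j, i ≠ j → inner ℝ (v i) (v j) = (0 : ℝ))
    {K : Subgroup (V ≃ₗᵢ[ℝ] V)} (hK : ∀ i, rootReflection (v i) ∈ K) {g : V ≃ₗᵢ[ℝ] V}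
    (hg : ∀ i, g (v i) = v i ∨ g (v i) = -v i) : g ∈ K := by
  classical
  have key : ∀ F : Finset ι, ∃ h ∈ K, (∀ i ∈ F, h (v i) = g (v i)) ∧ ∀ i ∉ F, h (v i) = v i := by
    intro F
    induction F using Finset.induction_on with
    | empty => exact ⟨1, one_mem _, by simp, fun i _ => rfl⟩
    | insert j F hj ih =>
      obtain ⟨h, hK', h1, h2⟩ := ih
      rcases hg j with hgj | hgj
      · refine ⟨h, hK', fun i hi => ?_, fun i hi => h2 i fun h => hi (Finset.mem_insert_of_mem h)⟩
        rcases Finset.mem_insert.mp hi with rfl | hi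
        · rw [h2 i hj, hgj]
        · exact h1 i hi
      · refine ⟨h * rootReflection (v j), mul_mem hK' (hK j), fun i hi => ?_, fun i hi => ?_⟩
        · change h (rootReflection (v j) (v i)) = _
          rcases Finset.mem_insert.mp hi with rfl | hi
          · rw [rootReflection_self, map_neg, h2 i hj, hgj]
          · rw [rootReflection_of_inner_eq_zero (ho j i (by rintro rfl; exact hj hi)), h1 i hi]
        · change h (rootReflection (v j) (v i)) = _
          rw [Finset.mem_insert, not_or] at hi
          rw [rootReflection_of_inner_eq_zero (ho j i (Ne.symm hi.1)), h2 i hi.2]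
  obtain ⟨h, hhK, h1, -⟩ := key Finset.univ
  rwa [← D.ext_of_frame hι hv ho fun i => h1 i (Finset.mem_univ i)]

namespace IsTame

variable (hD : D.IsTame)
include hD

/-- The frame of `n` orthogonal roots puts `-1` in the Weyl group, and no degree exceeds the
dimension `n`. -/
lemma reducedRank_eq : reducedRank D.weylGroup = n := by
  have := D.finiteDimensional
  obtain ⟨v, hv, ho⟩ := hD.frame
  have hneg : LinearIsometryEquiv.neg ℝ ∈ D.weylGroup :=
    D.mem_of_frame (Fintype.card_fin n) hv ho (fun i => D.rootReflection_mem_weylGroup (hv i))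
      fun i => Or.inr rfl
  refine IsGreatest.csSup_eq ⟨⟨⟨_, hneg⟩, Subtype.ext ?_, ?_⟩, ?_⟩
  · refine LinearIsometryEquiv.ext fun x => ?_
    rw [sq]
    exact neg_neg x
  · have : Module.End.eigenspace
        ((LinearIsometryEquiv.neg ℝ : V ≃ₗᵢ[ℝ] V).toLinearEquiv : V →ₗ[ℝ] V) (-1) = ⊤ := by
      refine eq_top_iff.mpr fun x _ => ?_
      rw [Module.End.mem_eigenspace_iff, neg_one_smul]
      rfl
    rw [involutionDegree, this, finrank_top, D.finrank_eq]
  · rintro _ ⟨u, -, rfl⟩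
    exact (Submodule.finrank_le _).trans D.finrank_eq.le

/-! ### Cubes and orthogonal roots -/

/-- Every element of the closure acts by signs on the roots of `S` and fixes the vectors orthogonal
to all of them. A reflection of the closure outside `S` would have its root orthogonal to all roots
of `S`, hence would fix the root it reverses. So a commuting set of reflections gains no new
reflection when it generates a cube. -/
lemma isCube_closure {S : Set D.weylGroup} (hS : ∀ s ∈ S, IsGroupReflection s)
    (hc : ∀ s ∈ S, ∀ t ∈ S, s * t = t * s) :
    IsCube (Subgroup.closure S) ∧ cubeBase (Subgroup.closure S) = S := by
  have ho : ∀ s ∈ S, ∀ t ∈ S, s ≠ t → inner ℝ (D.rootOf s : V) (D.rootOf t : V) = (0 : ℝ) :=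
    fun s hs t ht hst => hD.inner_eq_zero_of_commute (hS s hs) (hS t ht) hst (hc s hs t ht)
  have hsign : ∀ g ∈ Subgroup.closure S,
      (∀ s ∈ S, (g : V ≃ₗᵢ[ℝ] V) (D.rootOf s : V) = D.rootOf s ∨
        (g : V ≃ₗᵢ[ℝ] V) (D.rootOf s : V) = -D.rootOf s) ∧
      ∀ x : V, (∀ s ∈ S, inner ℝ (D.rootOf s : V) x = (0 : ℝ)) → (g : V ≃ₗᵢ[ℝ] V) x = x := by
    intro g hg
    induction hg using Subgroup.closure_induction with
    | mem t ht =>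
      refine ⟨fun s hs => ?_, fun x hx => ?_⟩
      · rw [hD.coe_eq (hS t ht)]
        by_cases hst : t = s
        · right
          rw [hst, rootReflection_self]
        · left
          rw [rootReflection_of_inner_eq_zero (ho t ht s hs hst)]
      · rw [hD.coe_eq (hS t ht), rootReflection_of_inner_eq_zero (hx t ht)]
    | one => exact ⟨fun s _ => Or.inl rfl, fun x _ => rfl⟩
    | mul a b _ _ iha ihb =>
      refine ⟨fun s hs => ?_, fun x hx => ?_⟩
      · change (a : V ≃ₗᵢ[ℝ] V) ((b : V ≃ₗᵢ[ℝ] V) _) = _ ∨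
          (a : V ≃ₗᵢ[ℝ] V) ((b : V ≃ₗᵢ[ℝ] V) _) = _
        rcases ihb.1 s hs with h | h <;> rw [h] <;> rcases iha.1 s hs with h' | h' <;> simp [h']
      · change (a : V ≃ₗᵢ[ℝ] V) ((b : V ≃ₗᵢ[ℝ] V) x) = x
        rw [ihb.2 x hx, iha.2 x hx]
    | inv a _ iha =>
      have hinv : ∀ x, (a : V ≃ₗᵢ[ℝ] V) x = x → ((a⁻¹ : D.weylGroup) : V ≃ₗᵢ[ℝ] V) x = x := by
        intro x hx
        conv_lhs => rw [← hx]
        exact (a : V ≃ₗᵢ[ℝ] V).symm_apply_apply x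
      refine ⟨fun s hs => ?_, fun x hx => hinv x (iha.2 x hx)⟩
      rcases iha.1 s hs with h | h
      · exact Or.inl (hinv _ h)
      · right
        have h' : (a : V ≃ₗᵢ[ℝ] V) (-(D.rootOf s : V)) = D.rootOf s := by rw [map_neg, h, neg_neg]
        conv_lhs => rw [← h']
        exact (a : V ≃ₗᵢ[ℝ] V).symm_apply_apply _
  have hbase : cubeBase (Subgroup.closure S) = S := by
    refine Set.Subset.antisymm ?_ fun s hs => ⟨Subgroup.subset_closure hs, hS s hs⟩
    rintro t ⟨htC, ht⟩
    obtain ⟨h1, h2⟩ := hsign t htC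
    rw [hD.coe_eq ht] at h1 h2
    have ht0 := ne_zero_of_inner_self_eq_two (hD.inner_rootOf_self ht)
    by_contra htS
    have hort : ∀ s ∈ S, inner ℝ (D.rootOf s : V) (D.rootOf t : V) = (0 : ℝ) := by
      intro s hs
      rcases h1 s hs with h | h
      · rw [rootReflection_apply (hD.inner_rootOf_self ht), sub_eq_self, smul_eq_zero] at h
        rw [real_inner_comm]
        exact h.resolve_right ht0
      · have h3 := eq_or_eq_neg_of_smul (hD.inner_rootOf_self ht) (hD.inner_rootOf_self (hS s hs))
          (eq_smul_of_rootReflection_eq_neg (hD.inner_rootOf_self ht) h)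
        exact absurd (hD.eq_of_rootOf (hS s hs) ht h3 ▸ hs) htS
    have h3 := h2 _ hort
    rw [rootReflection_self] at h3
    have h5 : (2 : ℝ) • (D.rootOf t : V) = 0 := by
      rw [two_smul, ← eq_neg_iff_add_eq_zero, h3]
    exact ht0 ((smul_eq_zero.mp h5).resolve_left two_ne_zero)
  refine ⟨⟨fun x hx y hy => ?_, by rw [hbase]⟩, hbase⟩
  exact Subgroup.closure_induction₂ (p := fun x y _ _ => Commute x y) (fun s t hs ht => hc s hs t ht)
    (fun x _ => Commute.one_left x) (fun x _ => Commute.one_right x)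
    (fun _ _ _ _ _ _ h1 h2 => h1.mul_left h2) (fun _ _ _ _ _ _ h1 h2 => h1.mul_right h2)
    (fun _ _ _ _ h => h.inv_left) (fun _ _ _ _ h => h.inv_right) hx hy

lemma ncard_cubeBase {C : Subgroup D.weylGroup} (hC : IsMaximalCube C) :
    (cubeBase C).ncard = n := by
  rw [hC.2, hD.reducedRank_eq]

lemma inner_cubeBase {C : Subgroup D.weylGroup} (hC : IsCube C) {s t : D.weylGroup}
    (hs : s ∈ cubeBase C) (ht : t ∈ cubeBase C) (hst : s ≠ t) :
    inner ℝ (D.rootOf s : V) (D.rootOf t : V) = (0 : ℝ) :=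
  hD.inner_eq_zero_of_commute hs.2 ht.2 hst (hC.1 s hs.1 t ht.1)

lemma finite_cubeBase [NeZero n] {C : Subgroup D.weylGroup} (hC : IsMaximalCube C) :
    (cubeBase C).Finite :=
  Set.finite_of_ncard_ne_zero (by rw [hD.ncard_cubeBase hC]; exact NeZero.ne n)

/-- Commuting with the reflection in `α` means sending `α` to `±α`. The roots of the base form an
orthogonal frame, so such an element is a product of reflections of the base. -/
lemma cubeAction_injective [NeZero n] {C : Subgroup D.weylGroup} (hC : IsMaximalCube C) :
    Function.Injective (cubeAction hC.1) := by
  rw [injective_iff_map_eq_one]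
  intro x hx
  induction x using QuotientGroup.induction_on with
  | H g =>
  rw [QuotientGroup.eq_one_iff, Subgroup.mem_subgroupOf]
  have := (hD.finite_cubeBase hC).fintype
  have hmem : ((g : D.weylGroup) : V ≃ₗᵢ[ℝ] V) ∈ C.map D.weylGroup.subtype := by
    refine D.mem_of_frame (ι := cubeBase C) (v := fun s => (D.rootOf s : V)) ?_
      (fun s => hD.rootOf_mem s.2.2)
      (fun s t hst => hD.inner_cubeBase hC.1 s.2 t.2 fun h => hst (Subtype.ext h)) ?_ ?_
    · rw [← Nat.card_eq_fintype_card, Nat.card_coe_set_eq, hD.ncard_cubeBase hC]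
    · intro s
      rw [← hD.coe_eq s.2.2]
      exact Subgroup.mem_map_of_mem _ s.2.1
    · intro s
      have h1 := congrArg (fun π : Equiv.Perm (cubeBase C) => (π s : D.weylGroup)) hx
      have h2 := congrArg (Subtype.val : D.weylGroup → _)
        ((cubeAction_mk hC.1 g s).symm.trans h1)
      have h3 := hD.inner_rootOf_self s.2.2
      simp only [Subgroup.coe_mul, Subgroup.coe_inv, Equiv.Perm.coe_one, id_eq] at h2
      rw [hD.coe_eq s.2.2, conj_rootReflection _ h3] at h2
      exact eq_or_eq_neg_of_rootReflection_eq h3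
        (by rw [LinearIsometryEquiv.inner_map_map, h3]) h2.symm
  obtain ⟨c, hc, hcg⟩ := hmem
  rwa [show (g : D.weylGroup) = c from Subtype.ext hcg.symm]

end IsTame

end SimpleRoots

namespace SimpleRoots

variable {n : ℕ} {A : Matrix (Fin n) (Fin n) ℤ} {V : Type*}
  [NormedAddCommGroup V] [InnerProductSpace ℝ V] {D : SimpleRoots A V}

/-! ### Double transpositions of the base -/

namespace IsTame

variable (hD : D.IsTame)
include hD

/-- The sum of the four roots is `2p` with `p` a weight, and orthogonality gives `4 (p, p) = 8`;
weights of norm 2 lie in `R` by tameness. -/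
lemma half_sum_mem {a b c d : D.weylGroup} (ha : IsGroupReflection a) (hb : IsGroupReflection b)
    (hc : IsGroupReflection c) (hd : IsGroupReflection d)
    (hab : inner ℝ (D.rootOf a : V) (D.rootOf b : V) = (0 : ℝ))
    (hac : inner ℝ (D.rootOf a : V) (D.rootOf c : V) = (0 : ℝ))
    (had : inner ℝ (D.rootOf a : V) (D.rootOf d : V) = (0 : ℝ))
    (hbc : inner ℝ (D.rootOf b : V) (D.rootOf c : V) = (0 : ℝ))
    (hbd : inner ℝ (D.rootOf b : V) (D.rootOf d : V) = (0 : ℝ))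
    (hcd : inner ℝ (D.rootOf c : V) (D.rootOf d : V) = (0 : ℝ))
    (hsum : D.tildeP a + D.tildeP b + D.tildeP c + D.tildeP d = 0) :
    (2⁻¹ : ℝ) • ((D.rootOf a : V) + D.rootOf b + D.rootOf c + D.rootOf d) ∈ D.rootLattice := by
  simp only [tildeP, ← map_add] at hsum
  rw [Submodule.mkQ_apply, Submodule.Quotient.mk_eq_zero, mem_twoP_iff] at hsum
  obtain ⟨p, hp, h⟩ := hsum
  simp only [Submodule.coe_add] at h
  rw [← h, smul_smul, inv_mul_cancel₀ two_ne_zero, one_smul]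
  refine hD.mem_of_inner_self p hp ?_
  have h2 := congrArg (fun x : V => (inner ℝ x x : ℝ)) h
  simp only [inner_add_left, inner_add_right, real_inner_smul_left, real_inner_smul_right,
    hD.inner_rootOf_self ha, hD.inner_rootOf_self hb, hD.inner_rootOf_self hc,
    hD.inner_rootOf_self hd, hab, hac, had, hbc, hbd, hcd, real_inner_comm (D.rootOf a : V),
    real_inner_comm (D.rootOf b : V), real_inner_comm (D.rootOf c : V)] at h2
  linarith

end IsTame

section Swap

variable {V : Type*} [NormedAddCommGroup V] [InnerProductSpace ℝ V]

/-- The product of the reflections in `(a - b + c - d) / 2` and `(a - b - c + d) / 2` exchanges `a`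
with `b` and `c` with `d`. -/
lemma rootReflection_half_apply {a b c d : V}
    (ha : inner ℝ a a = (2 : ℝ)) (hb : inner ℝ b b = (2 : ℝ)) (hc : inner ℝ c c = (2 : ℝ))
    (hd : inner ℝ d d = (2 : ℝ)) (hab : inner ℝ a b = (0 : ℝ)) (hac : inner ℝ a c = (0 : ℝ))
    (had : inner ℝ a d = (0 : ℝ)) (hbc : inner ℝ b c = (0 : ℝ)) (hbd : inner ℝ b d = (0 : ℝ))
    (hcd : inner ℝ c d = (0 : ℝ)) :
    inner ℝ ((2⁻¹ : ℝ) • (a - b + c - d)) ((2⁻¹ : ℝ) • (a - b + c - d)) = (2 : ℝ) ∧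
    inner ℝ ((2⁻¹ : ℝ) • (a - b - c + d)) ((2⁻¹ : ℝ) • (a - b - c + d)) = (2 : ℝ) ∧
    ∀ x, rootReflection ((2⁻¹ : ℝ) • (a - b + c - d))
      (rootReflection ((2⁻¹ : ℝ) • (a - b - c + d)) x) =
        x - (2⁻¹ * (inner ℝ x a - inner ℝ x b) : ℝ) • (a - b)
          - (2⁻¹ * (inner ℝ x c - inner ℝ x d) : ℝ) • (c - d) := by
  have hba : inner ℝ b a = (0 : ℝ) := by rw [real_inner_comm, hab]
  have hca : inner ℝ c a = (0 : ℝ) := by rw [real_inner_comm, hac]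
  have hda : inner ℝ d a = (0 : ℝ) := by rw [real_inner_comm, had]
  have hcb : inner ℝ c b = (0 : ℝ) := by rw [real_inner_comm, hbc]
  have hdb : inner ℝ d b = (0 : ℝ) := by rw [real_inner_comm, hbd]
  have hdc : inner ℝ d c = (0 : ℝ) := by rw [real_inner_comm, hcd]
  have h1 : inner ℝ ((2⁻¹ : ℝ) • (a - b + c - d)) ((2⁻¹ : ℝ) • (a - b + c - d)) = (2 : ℝ) := by
    simp only [inner_add_left, inner_add_right, inner_sub_left, inner_sub_right,
      real_inner_smul_left, real_inner_smul_right, ha, hb, hc, hd, hab, hac, had, hbc, hbd, hcd,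
      hba, hca, hda, hcb, hdb, hdc]
    norm_num
  have h2 : inner ℝ ((2⁻¹ : ℝ) • (a - b - c + d)) ((2⁻¹ : ℝ) • (a - b - c + d)) = (2 : ℝ) := by
    simp only [inner_add_left, inner_add_right, inner_sub_left, inner_sub_right,
      real_inner_smul_left, real_inner_smul_right, ha, hb, hc, hd, hab, hac, had, hbc, hbd, hcd,
      hba, hca, hda, hcb, hdb, hdc]
    norm_num
  -- The two vectors are orthogonal and span the plane of `a - b` and `c - d`; the product of their
  -- reflections is `-1` on this plane and the identity on its orthogonal complement.
  refine ⟨h1, h2, fun x => ?_⟩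
  rw [rootReflection_apply h1, rootReflection_apply h2]
  simp only [inner_add_left, inner_add_right, inner_sub_left, inner_sub_right,
    real_inner_smul_left, real_inner_smul_right, ha, hb, hc, hd, hab, hac, had, hbc, hbd, hcd,
    hba, hca, hda, hcb, hdb, hdc, real_inner_comm x a, real_inner_comm x b, real_inner_comm x c,
    real_inner_comm x d]
  module

end Swap

namespace IsTame

variable (hD : D.IsTame)
include hD

/-- The isometry exchanging the roots of `a` and `b` and those of `c` and `d` is a product of
reflections in two vectors of norm 2, which lie in `R` because the half-sum of the four roots does.
It permutes the base, hence normalizes the cube the base generates. -/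
lemma swap_mul_swap_mem_range {C : Subgroup D.weylGroup} (hC : IsCube C)
    [DecidableEq (cubeBase C)] {a b c d : cubeBase C} (hab : a ≠ b) (hac : a ≠ c) (had : a ≠ d)
    (hbc : b ≠ c) (hbd : b ≠ d) (hcd : c ≠ d)
    (hsum : D.tildeP a + D.tildeP b + D.tildeP c + D.tildeP d = 0) :
    Equiv.swap a b * Equiv.swap c d ∈ (cubeAction hC).range := by
  have ho : ∀ {s t : cubeBase C}, s ≠ t →
      inner ℝ (D.rootOf s : V) (D.rootOf t : V) = (0 : ℝ) :=
    fun {s t} hst => hD.inner_cubeBase hC s.2 t.2 fun h => hst (Subtype.ext h)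
  have hs : ∀ s : cubeBase C, inner ℝ (D.rootOf s : V) (D.rootOf s : V) = (2 : ℝ) :=
    fun s => hD.inner_rootOf_self s.2.2
  have hp := hD.half_sum_mem a.2.2 b.2.2 c.2.2 d.2.2 (ho hab) (ho hac) (ho had) (ho hbc) (ho hbd)
    (ho hcd) hsum
  obtain ⟨h1, h2, hx⟩ := rootReflection_half_apply (hs a) (hs b) (hs c) (hs d) (ho hab) (ho hac)
    (ho had) (ho hbc) (ho hbd) (ho hcd)
  -- `(a - b + c - d)/2` is the half-sum minus `b` and `d`; the second vector is the half-sum minus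
  -- `b` and `c`.
  have hr1 := D.rootReflection_mem_weylGroup (D.mem_roots_of_inner_self
    (by convert sub_mem (sub_mem hp (D.rootOf b).2) (D.rootOf d).2 using 1; module) h1)
  have hr2 := D.rootReflection_mem_weylGroup (D.mem_roots_of_inner_self
    (by convert sub_mem (sub_mem hp (D.rootOf b).2) (D.rootOf c).2 using 1; module) h2)
  set g : D.weylGroup := ⟨_, mul_mem hr1 hr2⟩ with hg
  have hgx : ∀ s : cubeBase C, (g : V ≃ₗᵢ[ℝ] V) (D.rootOf s : V) =
      D.rootOf ((Equiv.swap a b * Equiv.swap c d) s : cubeBase C) := by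
    intro s
    refine (hx _).trans ?_
    rw [Equiv.Perm.mul_apply]
    by_cases hsa : s = a
    · rw [hsa, Equiv.swap_apply_of_ne_of_ne hac had, Equiv.swap_apply_left, hs a, ho hab, ho hac,
        ho had]
      module
    by_cases hsb : s = b
    · rw [hsb, Equiv.swap_apply_of_ne_of_ne hbc hbd, Equiv.swap_apply_right, hs b, ho hab.symm,
        ho hbc, ho hbd]
      module
    by_cases hsc : s = c
    · rw [hsc, Equiv.swap_apply_left, Equiv.swap_apply_of_ne_of_ne had.symm hbd.symm, hs c,
        ho hac.symm, ho hbc.symm, ho hcd]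
      module
    by_cases hsd : s = d
    · rw [hsd, Equiv.swap_apply_right, Equiv.swap_apply_of_ne_of_ne hac.symm hbc.symm, hs d,
        ho had.symm, ho hbd.symm, ho hcd.symm]
      module
    · rw [Equiv.swap_apply_of_ne_of_ne hsc hsd, Equiv.swap_apply_of_ne_of_ne hsa hsb, ho hsa,
        ho hsb, ho hsc, ho hsd]
      module
  have hconj : ∀ s : cubeBase C, g * s * g⁻¹ = (Equiv.swap a b * Equiv.swap c d) s := by
    intro s
    refine Subtype.ext ?_
    rw [Subgroup.coe_mul, Subgroup.coe_mul, Subgroup.coe_inv, hD.coe_eq s.2.2,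
      conj_rootReflection _ (hs s), hgx s,
      ← hD.coe_eq ((Equiv.swap a b * Equiv.swap c d) s).2.2]
  have hN : g ∈ Subgroup.normalizer (C : Set D.weylGroup) := by
    have : g ∈ Subgroup.normalizer (cubeBase C) := by
      rw [Subgroup.mem_normalizer_iff_conj_image_eq]
      ext t
      constructor
      · rintro ⟨s, hs, rfl⟩
        rw [MulAut.conj_apply, hconj ⟨s, hs⟩]
        exact Subtype.prop _
      · intro ht
        refine ⟨_, ((Equiv.swap a b * Equiv.swap c d)⁻¹ ⟨t, ht⟩).2, ?_⟩
        rw [MulAut.conj_apply, hconj]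
        simp
    have h := Subgroup.normalizer_le_normalizer_closure _ this
    rwa [hC.2] at h
  exact ⟨((⟨g, hN⟩ : Subgroup.normalizer (C : Set D.weylGroup)) : cubePhi C),
    Equiv.ext fun s => Subtype.ext (hconj s)⟩

end IsTame

end SimpleRoots

/-! ### Affine permutations of a three-dimensional space over the field with two elements -/

section AffineGeneration

variable {M : Type*} [AddCommGroup M] [Module (ZMod 2) M]

lemma zmod_two_eq_one_of_ne_zero {x : ZMod 2} (h : x ≠ 0) : x = 1 := by
  revert x
  decide

lemma zmod_two_eq_zero_or_one (x : ZMod 2) : x = 0 ∨ x = 1 := by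
  revert x
  decide

/-- A nonempty affine plane, the fibre of a linear form, is the union of two pairs exchanged by
translation by a vector in its direction. -/
lemma exists_fibre_eq [Finite M] (hM : Nat.card M = 8) {ψ : M →ₗ[ZMod 2] ZMod 2} (hψ : ψ ≠ 0)
    (t : ZMod 2) {v : M} (hv : v ≠ 0) (hψv : ψ v = 0) :
    ∃ a c : M, c ≠ a ∧ c ≠ a + v ∧ ∀ x, ψ x = t ↔ x = a ∨ x = a + v ∨ x = c ∨ x = c + v := by
  classical
  have := Fintype.ofFinite M
  have hsurj : Function.Surjective ψ := LinearMap.surjective hψ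
  have hcard : Nat.card (LinearMap.ker ψ) = 4 := by
    have h1 := Submodule.card_eq_card_quotient_mul_card (LinearMap.ker ψ)
    rw [hM, Nat.card_congr (ψ.quotKerEquivOfSurjective hsurj).toEquiv, Nat.card_zmod] at h1
    omega
  obtain ⟨a, ha⟩ := hsurj t
  have hS : (Finset.univ.filter fun x => ψ x = 0).card = 4 := by
    rw [← hcard, Nat.card_eq_fintype_card, Fintype.card_subtype]
    exact congrArg _ (Finset.filter_congr fun x _ => LinearMap.mem_ker.symm)
  -- The kernel has four elements, so with a further vector `u` it is `{0, v, u, u + v}`; the fibre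
  -- is its translate by `a`.
  obtain ⟨u, hu, hu'⟩ : ∃ u ∈ Finset.univ.filter fun x => ψ x = 0, u ∉ ({0, v} : Finset M) := by
    refine Finset.exists_mem_notMem_of_card_lt_card ?_
    rw [hS]
    exact (Finset.card_le_two).trans_lt (by norm_num)
  simp only [Finset.mem_filter, Finset.mem_univ, true_and] at hu
  simp only [Finset.mem_insert, Finset.mem_singleton, not_or] at hu'
  have hall : ({0, v, u, u + v} : Finset M) = Finset.univ.filter fun x => ψ x = 0 := by
    refine Finset.eq_of_subset_of_card_le ?_ ?_
    · intro x hx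
      simp only [Finset.mem_insert, Finset.mem_singleton] at hx
      rw [Finset.mem_filter]
      refine ⟨Finset.mem_univ _, ?_⟩
      rcases hx with rfl | rfl | rfl | rfl <;> simp [hψv, hu]
    · have huv : u + v ≠ 0 := by
        intro h
        rw [← ZModModule.sub_eq_add, sub_eq_zero] at h
        exact hu'.2 h
      rw [hS, Finset.card_insert_of_notMem, Finset.card_insert_of_notMem,
        Finset.card_insert_of_notMem, Finset.card_singleton]
      · simpa using hv
      · simp [Ne.symm hu'.2, hu'.1]
      · simp [Ne.symm hv, Ne.symm hu'.1, Ne.symm huv]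
  refine ⟨a, a + u, by simpa using hu'.1, by simpa using hu'.2, fun x => ?_⟩
  have hx : ψ x = t ↔ x - a ∈ ({0, v, u, u + v} : Finset M) := by
    rw [hall, Finset.mem_filter, map_sub, ha, sub_eq_zero]
    simp
  rw [hx]
  simp only [Finset.mem_insert, Finset.mem_singleton, sub_eq_iff_eq_add']
  rw [add_zero, add_assoc]

/-- An affine map `φ` with a point `d` such that `φ d` is not fixed admits an affine form that
vanishes on the fixed points of `φ`, takes equal values at `d` and `φ d` and is not constant. -/
lemma exists_affine_form [Finite M] (hM : 4 ≤ Nat.card M) {φ : M → M}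
    (hφ : ∀ x y z, φ (x + y + z) = φ x + φ y + φ z) {d : M} (hd : φ d ≠ d)
    (hd' : φ (φ d) ≠ φ d) :
    ∃ (ψ : M →ₗ[ZMod 2] ZMod 2) (t : ZMod 2), ψ ≠ 0 ∧ ψ (d + φ d) = 0 ∧ ψ d + t = 1 ∧
      ∀ f, φ f = f → ψ f + t = 0 := by
  classical
  have := Fintype.ofFinite M
  set v := d + φ d with hv
  by_cases hF : ∃ f, φ f = f
  · obtain ⟨f₀, hf₀⟩ := hF
    -- The fixed points of an affine map form an affine subspace; `U` is its direction, with base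
    -- point `f₀`.
    let U : Submodule (ZMod 2) M := AddSubgroup.toZModSubmodule 2
      { carrier := {u | φ (f₀ + u) = f₀ + u}
        zero_mem' := by simpa using hf₀
        add_mem' := by
          intro a b ha hb
          change φ (f₀ + (a + b)) = _
          have : f₀ + (a + b) = (f₀ + a) + (f₀ + b) + f₀ := by
            rw [show f₀ + a + (f₀ + b) + f₀ = (f₀ + f₀) + (f₀ + (a + b)) by abel,
              ZModModule.add_self, zero_add]
          rw [this, hφ, ha, hb, hf₀]
        neg_mem' := by
          intro a ha
          rwa [ZModModule.neg_eq_self a] }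
    have hU : ∀ u, u ∈ U ↔ φ (f₀ + u) = f₀ + u := fun u => Iff.rfl
    -- Otherwise `d` or `d + v = φ d` would be a fixed point. A linear form that kills `U` and `v`
    -- but not `f₀ + d` is then what is wanted.
    have hnot : f₀ + d ∉ U ⊔ Submodule.span (ZMod 2) {v} := by
      rw [Submodule.mem_sup]
      rintro ⟨u, hu, w, hw, huw⟩
      rw [Submodule.mem_span_singleton] at hw
      obtain ⟨c, rfl⟩ := hw
      rw [hU] at hu
      have hd2 : ∀ x : M, f₀ + (f₀ + x) = x := fun x => by
        rw [← add_assoc, ZModModule.add_self, zero_add]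
      rcases zmod_two_eq_zero_or_one c with rfl | rfl
      · rw [zero_smul, add_zero] at huw
        rw [huw, hd2] at hu
        exact hd hu
      · rw [one_smul] at huw
        have : f₀ + u = φ d := by
          rw [← add_left_inj v, add_assoc, huw, hd2, hv, add_comm d, ← add_assoc,
            ZModModule.add_self, zero_add]
        rw [this] at hu
        exact hd' hu
    obtain ⟨ψ, hψ1, hψ2⟩ := Submodule.exists_le_ker_of_notMem hnot
    refine ⟨ψ, ψ f₀, fun h => hψ1 (by rw [h]; rfl), ?_, ?_, fun f hf => ?_⟩
    · exact hψ2 (Submodule.mem_sup_right (Submodule.mem_span_singleton_self v))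
    · rw [← map_add, add_comm]
      exact zmod_two_eq_one_of_ne_zero hψ1
    · rw [← map_add]
      refine hψ2 (Submodule.mem_sup_left ((hU _).mpr ?_))
      rw [add_comm f, ← add_assoc, ZModModule.add_self, zero_add, hf]
  -- Without fixed points any nonzero form killing `v` will do, and the constant is chosen to make
  -- the value at `d` equal to 1.
  · obtain ⟨w, hw⟩ : ∃ w, w ∉ Submodule.span (ZMod 2) {v} := by
      by_contra! h
      have hle : (Finset.univ : Finset M) ⊆ {0, v} := by
        intro x _
        obtain ⟨c, rfl⟩ := Submodule.mem_span_singleton.mp (h x)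
        rcases zmod_two_eq_zero_or_one c with rfl | rfl <;> simp
      have := (Finset.card_le_card hle).trans Finset.card_le_two
      rw [Finset.card_univ, ← Nat.card_eq_fintype_card] at this
      omega
    obtain ⟨ψ, hψ1, hψ2⟩ := Submodule.exists_le_ker_of_notMem hw
    refine ⟨ψ, ψ d + 1, fun h => hψ1 (by rw [h]; rfl),
      hψ2 (Submodule.mem_span_singleton_self v), ?_, fun f hf => absurd ⟨f, hf⟩ hF⟩
    rw [← add_assoc, ZModModule.add_self, zero_add]

/-- Let `X` be a subset of a three-dimensional space over the field with two elements. Every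
permutation of `X` that extends to an affine map fixing all points outside `X` is a product of
the double transpositions `(a b) (c d)` with `a + b + c + d = 0`. -/
lemma mem_of_affine [Finite M] (hM : Nat.card M = 8) {X : Type*} [DecidableEq X] {τ : X → M}
    (hτ : Function.Injective τ) (K : Subgroup (Equiv.Perm X))
    (hK : ∀ a b c d : X, a ≠ b → a ≠ c → a ≠ d → b ≠ c → b ≠ d → c ≠ d →
      τ a + τ b + τ c + τ d = 0 → Equiv.swap a b * Equiv.swap c d ∈ K)
    (φ : M → M) (hφ : ∀ x y z, φ (x + y + z) = φ x + φ y + φ z)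
    (hfix : ∀ m, m ∉ Set.range τ → φ m = m) (g : Equiv.Perm X)
    (hg : ∀ x, τ (g x) = φ (τ x)) : g ∈ K := by
  -- Induction on the number of points moved: `φ` is followed by a double transposition that keeps
  -- its fixed points and makes `d` fixed as well.
  induction hN : {m | φ m ≠ m}.ncard using Nat.strong_induction_on generalizing φ g with
  | _ N ih =>
  by_cases hall : ∀ m, φ m = m
  · have : g = 1 := Equiv.ext fun x => hτ (by rw [hg, hall]; rfl)
    rw [this]
    exact one_mem K
  push Not at hall
  obtain ⟨d, hd⟩ := hall
  have hrange : ∀ m, φ m ≠ m → ∃ x, τ x = m := fun m hm => by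
    by_contra h
    exact hm (hfix m h)
  have hd' : φ (φ d) ≠ φ d := by
    obtain ⟨x, rfl⟩ := hrange d hd
    intro h
    rw [← hg, ← hg] at h
    rw [← hg, g.injective (hτ h)] at hd
    exact hd rfl
  obtain ⟨ψ, t, hψ, hψv, hψd, hψf⟩ := exists_affine_form (by rw [hM]; norm_num) hφ hd hd'
  set v := d + φ d with hvdef
  have hv : v ≠ 0 := by
    intro h
    rw [hvdef, ← ZModModule.sub_eq_add, sub_eq_zero] at h
    exact hd h.symm
  obtain ⟨a, c, hca, hcav, hfib⟩ := exists_fibre_eq hM hψ (1 + t) hv hψv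
  have hfib' : ∀ x, ψ x + t = 1 ↔ x = a ∨ x = a + v ∨ x = c ∨ x = c + v := by
    intro x
    rw [← hfib, ← eq_sub_iff_add_eq, ZModModule.sub_eq_add]
  -- The plane `ψ + t = 1` contains no fixed point of `φ`, so all of it comes from `X`; this is
  -- where the hypothesis on the points outside `X` enters.
  have hex : ∀ x, ψ x + t = 1 → ∃ y, τ y = x := by
    intro x hx
    refine hrange x fun h => ?_
    rw [hψf x h] at hx
    exact zero_ne_one hx
  obtain ⟨a', rfl⟩ := hex a ((hfib' a).mpr (Or.inl rfl))
  obtain ⟨b', hb'⟩ := hex _ ((hfib' _).mpr (Or.inr (Or.inl rfl)))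
  obtain ⟨c', rfl⟩ := hex c ((hfib' c).mpr (Or.inr (Or.inr (Or.inl rfl))))
  obtain ⟨d', hd'eq⟩ := hex _ ((hfib' _).mpr (Or.inr (Or.inr (Or.inr rfl))))
  have hvv : ∀ x : M, x + v + v = x := fun x => by rw [add_assoc, ZModModule.add_self, add_zero]
  have hab : a' ≠ b' := by rintro rfl; simp [hv] at hb'
  have hcd : c' ≠ d' := by rintro rfl; simp [hv] at hd'eq
  have hac : a' ≠ c' := by rintro rfl; exact hca rfl
  have hbc : b' ≠ c' := by rintro rfl; exact hcav hb'
  have had : a' ≠ d' := by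
    rintro rfl
    refine hcav ?_
    rw [hd'eq, hvv]
  have hbd : b' ≠ d' := by
    rintro rfl
    rw [hb'] at hd'eq
    exact hca (add_right_cancel hd'eq).symm
  have hmem := hK a' b' c' d' hab hac had hbc hbd hcd (by
    rw [hb', hd'eq, show τ a' + (τ a' + v) + τ c' + (τ c' + v) =
      (τ a' + τ a') + (τ c' + τ c') + (v + v) by abel]
    simp only [ZModModule.add_self])
  -- `T` translates the plane `ψ + t = 1` by `v` and is the identity elsewhere: it extends the
  -- double transposition to an affine map of `M`.
  set T : M → M := fun m => m + (ψ m + t) • v with hT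
  have hTτ : ∀ x, τ ((Equiv.swap a' b' * Equiv.swap c' d') x) = T (τ x) := by
    intro x
    rw [Equiv.Perm.mul_apply]
    by_cases hx : ψ (τ x) + t = 1
    · simp only [hT]
      rw [hx, one_smul]
      rcases (hfib' _).mp hx with h | h | h | h
      · rw [hτ h, Equiv.swap_apply_of_ne_of_ne hac had, Equiv.swap_apply_left, hb']
      · rw [← hb'] at h
        rw [hτ h, Equiv.swap_apply_of_ne_of_ne hbc hbd, Equiv.swap_apply_right, hb', hvv]
      · rw [hτ h, Equiv.swap_apply_left, Equiv.swap_apply_of_ne_of_ne had.symm hbd.symm, hd'eq]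
      · rw [← hd'eq] at h
        rw [hτ h, Equiv.swap_apply_right, Equiv.swap_apply_of_ne_of_ne hac.symm hbc.symm, hd'eq,
          hvv]
    · have h0 : ψ (τ x) + t = 0 := (zmod_two_eq_zero_or_one _).resolve_right hx
      rw [hfib', ← hb', ← hd'eq, hτ.eq_iff, hτ.eq_iff, hτ.eq_iff, hτ.eq_iff] at hx
      simp only [not_or] at hx
      rw [Equiv.swap_apply_of_ne_of_ne hx.2.2.1 hx.2.2.2,
        Equiv.swap_apply_of_ne_of_ne hx.1 hx.2.1]
      simp only [hT]
      rw [h0, zero_smul, add_zero]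
  have hTadd : ∀ x y z, T (x + y + z) = T x + T y + T z := by
    intro x y z
    simp only [hT, map_add]
    have : ψ x + ψ y + ψ z + t = (ψ x + t) + (ψ y + t) + (ψ z + t) := by
      rw [show ψ x + t + (ψ y + t) + (ψ z + t) = (t + t) + (ψ x + ψ y + ψ z + t) by ring,
        ZModModule.add_self, zero_add]
    rw [this, add_smul, add_smul]
    abel
  have hTfix : ∀ m, φ m = m → T (φ m) = m := by
    intro m hm
    rw [hm]
    simp only [hT]
    rw [hψf m hm, zero_smul, add_zero]
  -- The image `φ d` lies in the plane since `ψ v = 0`, so `T` brings it back to `φ d + v = d`.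
  have hlt : {m | T (φ m) ≠ m}.ncard < {m | φ m ≠ m}.ncard := by
    refine Set.ncard_lt_ncard ⟨fun m hm h => hm (hTfix m h), fun hsub => hsub hd ?_⟩
    simp only [hT]
    have h1 : ψ (φ d) + t = 1 := by
      rw [hvdef, map_add, ← ZModModule.sub_eq_add, sub_eq_zero] at hψv
      rw [← hψv, hψd]
    rw [h1, one_smul, hvdef, add_comm d, ← add_assoc, ZModModule.add_self, zero_add]
  have key := ih _ (hN ▸ hlt) (fun m => T (φ m)) (fun x y z => by rw [hφ, hTadd])
    (fun m hm => hTfix m (hfix m hm)) (Equiv.swap a' b' * Equiv.swap c' d' * g)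
    (fun x => by rw [Equiv.Perm.mul_apply, hTτ, hg]) rfl
  exact (K.mul_mem_cancel_left hmem).mp key

end AffineGeneration

/-! ### Permutation groups identified with linear and affine groups -/

section Identification

lemma natCard_fin_three_zmod_two : Nat.card (Fin 3 → ZMod 2) = 8 := by
  rw [Nat.card_eq_fintype_card]
  decide

lemma gl_mulVec_injective (g : GL (Fin 3) (ZMod 2)) :
    Function.Injective fun m : Fin 3 → ZMod 2 => g.val *ᵥ m := by
  refine Function.LeftInverse.injective (g := fun m => g⁻¹.val *ᵥ m) fun m => ?_
  change _ *ᵥ (_ *ᵥ m) = m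
  rw [Matrix.mulVec_mulVec, ← Units.val_mul, inv_mul_cancel, Units.val_one, Matrix.one_mulVec]

lemma gl_mulVec_ne_zero (g : GL (Fin 3) (ZMod 2)) {m : Fin 3 → ZMod 2} (hm : m ≠ 0) :
    g.val *ᵥ m ≠ 0 := fun h =>
  hm (gl_mulVec_injective g (h.trans (Matrix.mulVec_zero _).symm))

lemma gl_inv_mulVec_mulVec (g : GL (Fin 3) (ZMod 2)) (m : Fin 3 → ZMod 2) :
    g⁻¹.val *ᵥ (g.val *ᵥ m) = m := by
  rw [Matrix.mulVec_mulVec, ← Units.val_mul, inv_mul_cancel, Units.val_one, Matrix.one_mulVec]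

lemma gl_mulVec_inv_mulVec (g : GL (Fin 3) (ZMod 2)) (m : Fin 3 → ZMod 2) :
    g.val *ᵥ (g⁻¹.val *ᵥ m) = m := by
  rw [Matrix.mulVec_mulVec, ← Units.val_mul, mul_inv_cancel, Units.val_one, Matrix.one_mulVec]

lemma gl_ext_of_mulVec {g h : GL (Fin 3) (ZMod 2)}
    (hgh : ∀ m : Fin 3 → ZMod 2, m ≠ 0 → g.val *ᵥ m = h.val *ᵥ m) : g = h := by
  refine Units.ext (Matrix.ext_of_mulVec_single fun i => hgh _ ?_)
  intro h0
  have := congrFun h0 i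
  simp at this

lemma exists_gl_of_additive {φ : (Fin 3 → ZMod 2) → Fin 3 → ZMod 2}
    (hadd : ∀ x y, φ (x + y) = φ x + φ y) (hinj : Function.Injective φ) :
    ∃ g : GL (Fin 3) (ZMod 2), ∀ m, g.val *ᵥ m = φ m := by
  let L : (Fin 3 → ZMod 2) →ₗ[ZMod 2] Fin 3 → ZMod 2 :=
    (AddMonoidHom.mk' φ hadd).toZModLinearMap 2
  have hL : IsUnit L := (Module.End.isUnit_iff L).mpr (Finite.injective_iff_bijective.mp hinj)
  refine ⟨Matrix.GeneralLinearGroup.toLin.symm hL.unit, fun m => ?_⟩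
  have h := congrArg (fun u : LinearMap.GeneralLinearGroup (ZMod 2) (Fin 3 → ZMod 2) => u.val m)
    (Matrix.GeneralLinearGroup.toLin.apply_symm_apply hL.unit)
  exact h

variable {X : Type*}

/-- The action of `GL₃(𝔽₂)` on a set identified with the nonzero vectors of `𝔽₂³`. -/
def glPerm (e : X ≃ {m : Fin 3 → ZMod 2 // m ≠ 0}) : GL (Fin 3) (ZMod 2) →* Equiv.Perm X where
  toFun g :=
    { toFun := fun x => e.symm ⟨g.val *ᵥ (e x).1, gl_mulVec_ne_zero g (e x).2⟩
      invFun := fun x => e.symm ⟨g⁻¹.val *ᵥ (e x).1, gl_mulVec_ne_zero g⁻¹ (e x).2⟩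
      left_inv := fun x => e.injective (Subtype.ext (by
        simp only [Equiv.apply_symm_apply, gl_inv_mulVec_mulVec]))
      right_inv := fun x => e.injective (Subtype.ext (by
        simp only [Equiv.apply_symm_apply, gl_mulVec_inv_mulVec])) }
  map_one' := Equiv.ext fun x => e.injective (Subtype.ext (by simp))
  map_mul' g h := Equiv.ext fun x => e.injective (Subtype.ext (by
    simp [Matrix.mulVec_mulVec]))

lemma glPerm_apply (e : X ≃ {m : Fin 3 → ZMod 2 // m ≠ 0}) (g : GL (Fin 3) (ZMod 2)) (x : X) :
    (e (glPerm e g x)).1 = g.val *ᵥ (e x).1 := by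
  change (e (e.symm _)).1 = _
  rw [Equiv.apply_symm_apply]

lemma glPerm_injective (e : X ≃ {m : Fin 3 → ZMod 2 // m ≠ 0}) :
    Function.Injective (glPerm e) := by
  intro g h hgh
  refine gl_ext_of_mulVec fun m hm => ?_
  have h1 := glPerm_apply e g (e.symm ⟨m, hm⟩)
  have h2 := glPerm_apply e h (e.symm ⟨m, hm⟩)
  rw [Equiv.apply_symm_apply] at h1 h2
  rw [← h1, ← h2, hgh]

lemma glPerm_range_le [DecidableEq X] (e : X ≃ {m : Fin 3 → ZMod 2 // m ≠ 0})
    {K : Subgroup (Equiv.Perm X)}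
    (hK : ∀ a b c d : X, a ≠ b → a ≠ c → a ≠ d → b ≠ c → b ≠ d → c ≠ d →
      (e a).1 + (e b).1 + (e c).1 + (e d).1 = 0 → Equiv.swap a b * Equiv.swap c d ∈ K) :
    (glPerm e).range ≤ K := by
  rintro _ ⟨g, rfl⟩
  refine mem_of_affine natCard_fin_three_zmod_two (τ := fun x => (e x).1)
    (Subtype.val_injective.comp e.injective) K hK (fun m => g.val *ᵥ m)
    (fun x y z => by simp only [Matrix.mulVec_add]) (fun m hm => ?_) _ (glPerm_apply e g)
  -- The origin is the only vector not coming from `X`, and linear maps fix it.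
  have : m = 0 := by
    by_contra h
    exact hm ⟨e.symm ⟨m, h⟩, by simp⟩
  rw [this, Matrix.mulVec_zero]

/-- A permutation of the nonzero vectors of `𝔽₂³` that preserves the relation `x + y + z = 0` is
linear. -/
lemma mem_range_glPerm (e : X ≃ {m : Fin 3 → ZMod 2 // m ≠ 0}) {π : Equiv.Perm X}
    (hπ : ∀ x y z, (e x).1 + (e y).1 + (e z).1 = 0 →
      (e (π x)).1 + (e (π y)).1 + (e (π z)).1 = 0) : π ∈ (glPerm e).range := by
  classical
  let φ : (Fin 3 → ZMod 2) → Fin 3 → ZMod 2 :=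
    fun m => if h : m ≠ 0 then (e (π (e.symm ⟨m, h⟩))).1 else 0
  have hφ : ∀ x, φ (e x).1 = (e (π x)).1 := fun x => by
    simp only [φ, dif_pos (e x).2, Subtype.coe_eta, Equiv.symm_apply_apply]
  have hφ0 : φ 0 = 0 := by simp [φ]
  have hex : ∀ m : Fin 3 → ZMod 2, m ≠ 0 → ∃ x, (e x).1 = m :=
    fun m hm => ⟨e.symm ⟨m, hm⟩, by simp⟩
  have hadd : ∀ x y, φ (x + y) = φ x + φ y := by
    intro x y
    by_cases hx : x = 0
    · rw [hx, hφ0, zero_add, zero_add]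
    by_cases hy : y = 0
    · rw [hy, hφ0, add_zero, add_zero]
    by_cases hxy : x + y = 0
    · rw [hxy, hφ0]
      rw [← ZModModule.sub_eq_add, sub_eq_zero] at hxy
      rw [hxy, ZModModule.add_self]
    obtain ⟨a, rfl⟩ := hex x hx
    obtain ⟨b, rfl⟩ := hex y hy
    obtain ⟨c, hc⟩ := hex _ hxy
    have := hπ a b c (by rw [hc, ZModModule.add_self])
    rw [← hc, hφ, hφ, hφ]
    rw [← ZModModule.sub_eq_add, sub_eq_zero] at this
    exact this.symm
  have hinj : Function.Injective φ := by
    refine (injective_iff_map_eq_zero (AddMonoidHom.mk' φ hadd)).mpr fun m hm => ?_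
    by_contra h
    obtain ⟨x, rfl⟩ := hex m h
    exact (e (π x)).2 ((hφ x).symm.trans hm)
  obtain ⟨g, hg⟩ := exists_gl_of_additive hadd hinj
  refine ⟨g, Equiv.ext fun x => e.injective (Subtype.ext ?_)⟩
  rw [glPerm_apply, hg, hφ]

/-- The action of the affine group of `𝔽₂³` on a set identified with `𝔽₂³`. -/
def affinePerm (e : X ≃ (Fin 3 → ZMod 2)) :
    Multiplicative (Fin 3 → ZMod 2) ⋊[glThreeAction] GL (Fin 3) (ZMod 2) →* Equiv.Perm X :=
  MonoidHom.toHomPerm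
    { toFun := fun a x => e.symm (a.left.toAdd + a.right.val *ᵥ e x)
      map_one' := funext fun x => e.injective (by
        rw [Equiv.apply_symm_apply]
        simp
        rfl)
      map_mul' := fun a b => funext fun x => e.injective (by
        change e (e.symm _) = e (e.symm (_ + _ *ᵥ e (e.symm _)))
        simp only [Equiv.apply_symm_apply, SemidirectProduct.mul_left,
          SemidirectProduct.mul_right, toAdd_mul, Matrix.mulVec_add, Units.val_mul, add_assoc,
          Matrix.mulVec_mulVec]
        rfl) }

lemma affinePerm_apply (e : X ≃ (Fin 3 → ZMod 2))
    (a : Multiplicative (Fin 3 → ZMod 2) ⋊[glThreeAction] GL (Fin 3) (ZMod 2)) (x : X) :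
    e (affinePerm e a x) = a.left.toAdd + a.right.val *ᵥ e x := by
  change e (e.symm _) = _
  rw [Equiv.apply_symm_apply]

lemma affinePerm_injective (e : X ≃ (Fin 3 → ZMod 2)) : Function.Injective (affinePerm e) := by
  intro a b hab
  have h : ∀ m, a.left.toAdd + a.right.val *ᵥ m = b.left.toAdd + b.right.val *ᵥ m := by
    intro m
    have h1 := affinePerm_apply e a (e.symm m)
    have h2 := affinePerm_apply e b (e.symm m)
    rw [Equiv.apply_symm_apply] at h1 h2
    rw [← h1, ← h2, hab]
  have h0 : a.left.toAdd = b.left.toAdd := by simpa using h 0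
  refine SemidirectProduct.ext (Multiplicative.toAdd.injective h0)
    (gl_ext_of_mulVec fun m _ => ?_)
  have := h m
  rwa [h0, add_right_inj] at this

lemma affinePerm_range_le [DecidableEq X] (e : X ≃ (Fin 3 → ZMod 2))
    {K : Subgroup (Equiv.Perm X)}
    (hK : ∀ a b c d : X, a ≠ b → a ≠ c → a ≠ d → b ≠ c → b ≠ d → c ≠ d →
      e a + e b + e c + e d = 0 → Equiv.swap a b * Equiv.swap c d ∈ K) :
    (affinePerm e).range ≤ K := by
  rintro _ ⟨a, rfl⟩
  refine mem_of_affine natCard_fin_three_zmod_two e.injective K hK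
    (fun m => a.left.toAdd + a.right.val *ᵥ m) (fun x y z => ?_)
    (fun m hm => absurd ⟨e.symm m, e.apply_symm_apply m⟩ hm) _ (affinePerm_apply e a)
  have : a.left.toAdd + a.left.toAdd = 0 := ZModModule.add_self _
  simp only [Matrix.mulVec_add]
  -- The two sides contain one and three copies of the translation vector; they differ by twice this
  -- vector, which is 0.
  rw [← sub_eq_zero, ← neg_eq_zero, ← this]
  abel

/-- A permutation of `𝔽₂³` that preserves the relation `w = x + y + z` is affine. -/
lemma mem_range_affinePerm (e : X ≃ (Fin 3 → ZMod 2)) {π : Equiv.Perm X}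
    (hπ : ∀ x y z w, e w = e x + e y + e z → e (π w) = e (π x) + e (π y) + e (π z)) :
    π ∈ (affinePerm e).range := by
  set v := e (π (e.symm 0)) with hv
  -- Subtracting the image `v` of the origin, which is adding it over `𝔽₂`, leaves the linear part.
  let φ : (Fin 3 → ZMod 2) → Fin 3 → ZMod 2 := fun m => v + e (π (e.symm m))
  have hvv : ∀ m, v + (v + m) = m := fun m => by rw [← add_assoc, ZModModule.add_self, zero_add]
  have hadd : ∀ x y, φ (x + y) = φ x + φ y := by
    intro x y
    have h := hπ (e.symm x) (e.symm y) (e.symm 0) (e.symm (x + y)) (by simp)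
    rw [← hv] at h
    change v + e (π (e.symm (x + y))) = v + e (π (e.symm x)) + (v + e (π (e.symm y)))
    rw [h]
    abel
  have hinj : Function.Injective φ := fun x y h =>
    e.symm.injective (π.injective (e.injective (add_left_cancel h)))
  obtain ⟨g, hg⟩ := exists_gl_of_additive hadd hinj
  refine ⟨⟨Multiplicative.ofAdd v, g⟩, Equiv.ext fun x => e.injective ?_⟩
  rw [affinePerm_apply]
  change v + g.val *ᵥ e x = _
  rw [hg]
  change v + (v + e (π (e.symm (e x)))) = _
  rw [hvv, Equiv.symm_apply_apply]

/-- Two injective homomorphisms with the same range have isomorphic sources. -/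
lemma nonempty_mulEquiv_of_range_eq {G H P : Type*} [Group G] [Group H] [Group P] {f : G →* P}
    {g : H →* P} (hf : Function.Injective f) (hg : Function.Injective g)
    (h : f.range = g.range) : Nonempty (G ≃* H) :=
  ⟨(f.ofInjective hf).trans ((MulEquiv.subgroupCongr h).trans (g.ofInjective hg).symm)⟩

end Identification

/-! ### Simplicity of `GL₃(𝔽₂)` -/

section Simplicity

/-- Gaussian elimination writes an invertible matrix as a product of transvections and an invertible
diagonal matrix. Over `𝔽₂` the diagonal matrix is 1 and the only nontrivial coefficient of a
transvection is 1. -/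
lemma gl_subgroup_eq_top {H : Subgroup (GL (Fin 3) (ZMod 2))}
    (h : ∀ i j, i ≠ j → ∀ g : GL (Fin 3) (ZMod 2), g.val = Matrix.transvection i j 1 → g ∈ H) :
    H = ⊤ := by
  refine eq_top_iff.mpr fun g _ => ?_
  obtain ⟨g', hg', hgg⟩ : ∃ g' ∈ H, g'.val = g.val := by
    refine Matrix.diagonal_transvection_induction_of_det_ne_zero (fun M => ∃ g' ∈ H, g'.val = M)
      g.val ((Matrix.isUnit_iff_isUnit_det _).mp g.isUnit).ne_zero ?_ ?_ ?_
    · intro d hd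
      rw [Matrix.det_diagonal, Finset.prod_ne_zero_iff] at hd
      refine ⟨1, one_mem H, ?_⟩
      rw [show d = fun _ => 1 from
        funext fun i => zmod_two_eq_one_of_ne_zero (hd i (Finset.mem_univ i)), Matrix.diagonal_one]
      rfl
    · rintro ⟨i, j, hij, c⟩
      rcases zmod_two_eq_zero_or_one c with rfl | rfl
      · exact ⟨1, one_mem H, by simp [Matrix.TransvectionStruct.toMatrix]⟩
      · have hdet : IsUnit (Matrix.transvection i j (1 : ZMod 2)) := by
          rw [Matrix.isUnit_iff_isUnit_det, Matrix.det_transvection_of_ne i j hij]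
          exact isUnit_one
        exact ⟨hdet.unit, h i j hij _ rfl, rfl⟩
    · rintro _ _ - - ⟨a, ha, rfl⟩ ⟨b, hb, rfl⟩
      exact ⟨a * b, mul_mem ha hb, rfl⟩
  rwa [← Units.ext hgg]

/-- These transvections are their own inverses, so the product is the commutator of those at `(i,
k)` and `(k, j)`, with `k` the third index. Hence `GL₃(𝔽₂)` is perfect. -/
lemma transvection_eq_commutator : ∀ i j : Fin 3, i ≠ j → ∃ k, i ≠ k ∧ k ≠ j ∧
    (Matrix.transvection i k (1 : ZMod 2) * Matrix.transvection k j 1 *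
      Matrix.transvection i k 1 * Matrix.transvection k j 1) = Matrix.transvection i j 1 := by
  decide

open scoped commutatorElement in
lemma commutator_gl_eq_top : commutator (GL (Fin 3) (ZMod 2)) = ⊤ := by
  refine gl_subgroup_eq_top fun i j hij g hg => ?_
  obtain ⟨k, hik, hkj, hk⟩ := transvection_eq_commutator i j hij
  have hsq : ∀ a b : Fin 3, a ≠ b →
      Matrix.transvection a b (1 : ZMod 2) * Matrix.transvection a b 1 = 1 := by
    intro a b hab
    rw [Matrix.transvection_mul_transvection_same a b hab, ZModModule.add_self,
      Matrix.transvection_zero]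
  let t : (a b : Fin 3) → a ≠ b → GL (Fin 3) (ZMod 2) := fun a b hab =>
    ⟨Matrix.transvection a b 1, Matrix.transvection a b 1, hsq a b hab, hsq a b hab⟩
  have : g = ⁅t i k hik, t k j hkj⁆ := by
    refine Units.ext ?_
    rw [hg, ← hk]
    rfl
  rw [this]
  exact Subgroup.commutator_mem_commutator (Subgroup.mem_top _) (Subgroup.mem_top _)

open LinearMap (GeneralLinearGroup)

/-- The group of elations with a given center. -/
def elationGroup (x : ℙ (ZMod 2) (Fin 3 → ZMod 2)) :
    Subgroup (GeneralLinearGroup (ZMod 2) (Fin 3 → ZMod 2)) where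
  carrier := {g | ∀ m, g.val m - m ∈ x.submodule}
  one_mem' := fun m => by simp
  mul_mem' := by
    intro g h hg hh m
    have : (g * h).val m - m = (g.val (h.val m) - h.val m) + (h.val m - m) := by
      rw [sub_add_sub_cancel]
      rfl
    rw [this]
    exact add_mem (hg _) (hh m)
  inv_mem' := by
    intro g hg m
    have h1 : g.val (g⁻¹.val m) = m := by
      rw [← Module.End.mul_apply, ← Units.val_mul, mul_inv_cancel]
      rfl
    have h2 := hg (g⁻¹.val m)
    rw [h1] at h2
    rw [← neg_sub]
    exact neg_mem h2

lemma mem_elationGroup {x : ℙ (ZMod 2) (Fin 3 → ZMod 2)}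
    {g : GeneralLinearGroup (ZMod 2) (Fin 3 → ZMod 2)} :
    g ∈ elationGroup x ↔ ∀ m, g.val m - m ∈ x.submodule := Iff.rfl

lemma general_val_injective (g : GeneralLinearGroup (ZMod 2) (Fin 3 → ZMod 2)) :
    Function.Injective g.val :=
  ((Module.End.isUnit_iff _).mp g.isUnit).1

/-- The line `x` has a single nonzero vector, and `g` maps the line into itself injectively; over
`𝔽₂` every map trivial modulo its center also fixes the center pointwise. -/
lemma elationGroup_fixes {x : ℙ (ZMod 2) (Fin 3 → ZMod 2)}
    {g : GeneralLinearGroup (ZMod 2) (Fin 3 → ZMod 2)} (hg : g ∈ elationGroup x)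
    {m : Fin 3 → ZMod 2} (hm : m ∈ x.submodule) : g.val m = m := by
  rw [Projectivization.submodule_eq, Submodule.mem_span_singleton] at hm
  obtain ⟨c, rfl⟩ := hm
  suffices h : g.val x.rep = x.rep by rw [map_smul, h]
  have h1 := hg x.rep
  rw [Projectivization.submodule_eq, Submodule.mem_span_singleton] at h1
  obtain ⟨c, hc⟩ := h1
  rcases zmod_two_eq_zero_or_one c with rfl | rfl
  · rw [zero_smul] at hc
    exact sub_eq_zero.mp hc.symm
  · rw [one_smul, eq_sub_iff_add_eq, ZModModule.add_self] at hc
    refine absurd (general_val_injective g ?_) x.rep_nonzero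
    rw [← hc, map_zero]

/-- The elations provide an Iwasawa structure for the action on the projective plane. -/
def elationIwasawa : MulAction.IwasawaStructure
    (GeneralLinearGroup (ZMod 2) (Fin 3 → ZMod 2)) (ℙ (ZMod 2) (Fin 3 → ZMod 2)) where
  T := elationGroup
  is_comm x := by
    refine ⟨⟨fun g h => Subtype.ext (Units.ext (LinearMap.ext fun m => ?_))⟩⟩
    -- Since `g` fixes the vector `h m - m` of the center, the displacements of `g` and `h` add up,
    -- which is symmetric in the two.
    have key : ∀ g h : elationGroup x, (g.1 * h.1).val m = g.1.val m - m + h.1.val m := by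
      intro g h
      have h1 := elationGroup_fixes g.2 (h.2 m)
      rw [map_sub] at h1
      change g.1.val (h.1.val m) = _
      rw [sub_eq_iff_eq_add.mp h1]
      abel
    change (g.1 * h.1).val m = (h.1 * g.1).val m
    rw [key, key]
    abel
  is_conj g x := by
    ext k
    rw [Subgroup.mem_pointwise_smul_iff_inv_smul_mem]
    have hx : (g • x).submodule = x.submodule.map g.val := by
      induction x using Projectivization.ind with
      | h v hv =>
        rw [Projectivization.smul_mk, Projectivization.submodule_mk, Projectivization.submodule_mk,
          Submodule.map_span, Set.image_singleton]
        rfl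
    have hinv : ∀ m, g.val (g⁻¹.val m) = m := fun m => by
      rw [← Module.End.mul_apply, ← Units.val_mul, mul_inv_cancel]
      rfl
    have hinv' : ∀ m, g⁻¹.val (g.val m) = m := fun m => by
      rw [← Module.End.mul_apply, ← Units.val_mul, inv_mul_cancel]
      rfl
    have hmem : ∀ m, m ∈ (g • x).submodule ↔ g⁻¹.val m ∈ x.submodule := by
      intro m
      rw [hx]
      constructor
      · rintro ⟨y, hy, rfl⟩
        rwa [hinv']
      · exact fun h => ⟨_, h, hinv m⟩
    have hconj : ∀ m, ((MulAut.conj g)⁻¹ • k).val m = g⁻¹.val (k.val (g.val m)) := by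
      intro m
      rw [← map_inv, MulAut.smul_def, MulAut.conj_apply, inv_inv]
      rfl
    rw [mem_elationGroup, mem_elationGroup]
    constructor
    · intro h m
      have h1 := (hmem _).mp (h (g.val m))
      rwa [map_sub, hinv', ← hconj] at h1
    · intro h m
      have h1 := h (g⁻¹.val m)
      rw [hconj, hinv] at h1
      rw [hmem, map_sub]
      exact h1
  is_generator := by
    have h : (iSup elationGroup).comap
        (Matrix.GeneralLinearGroup.toLin : GL (Fin 3) (ZMod 2) ≃* _).toMonoidHom = ⊤ := by
      refine gl_subgroup_eq_top fun i j hij g hg => ?_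
      have hi : (Pi.single i 1 : Fin 3 → ZMod 2) ≠ 0 := by simp
      -- The transvection at `(i, j)` moves `m` by `m j` times the `i`-th basis vector, so it is an
      -- elation with this vector as center.
      refine (le_iSup elationGroup (Projectivization.mk _ _ hi)) fun m => ?_
      change g.val *ᵥ m - m ∈ _
      rw [hg, Matrix.transvection, Matrix.add_mulVec, Matrix.one_mulVec, add_sub_cancel_left,
        Projectivization.submodule_mk, Submodule.mem_span_singleton]
      refine ⟨m j, ?_⟩
      ext k
      simp [Matrix.single_mulVec, Pi.single_apply, Function.update_apply]
    refine eq_top_iff.mpr fun g _ => ?_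
    have h1 : Matrix.GeneralLinearGroup.toLin.symm g ∈ (⊤ : Subgroup (GL (Fin 3) (ZMod 2))) :=
      Subgroup.mem_top _
    rw [← h, Subgroup.mem_comap] at h1
    simpa using h1

/-- Iwasawa's criterion: the action on the projective plane is 2-transitive, hence primitive; it is
faithful because 1 is the only nonzero scalar; and the group is perfect. -/
lemma isSimpleGroup_gl : IsSimpleGroup (GL (Fin 3) (ZMod 2)) := by
  let E : GL (Fin 3) (ZMod 2) ≃* GeneralLinearGroup (ZMod 2) (Fin 3 → ZMod 2) :=
    Matrix.GeneralLinearGroup.toLin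
  have hperf : commutator (GeneralLinearGroup (ZMod 2) (Fin 3 → ZMod 2)) = ⊤ := by
    have h := congrArg (Subgroup.map E.toMonoidHom) commutator_gl_eq_top
    have hr : E.toMonoidHom.range = ⊤ := MonoidHom.range_eq_top.mpr E.surjective
    rw [commutator_def, Subgroup.map_commutator, ← MonoidHom.range_eq_map, hr] at h
    rwa [commutator_def]
  have hnt : Nontrivial (GL (Fin 3) (ZMod 2)) := by
    refine ⟨⟨⟨Matrix.transvection 0 1 1, Matrix.transvection 0 1 1, by decide, by decide⟩, 1,
      fun h => ?_⟩⟩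
    have := congrArg (fun g : GL (Fin 3) (ZMod 2) => g.val 0 1) h
    revert this
    decide
  have hnt' : Nontrivial (GeneralLinearGroup (ZMod 2) (Fin 3 → ZMod 2)) :=
    E.symm.toEquiv.nontrivial
  have : MulAction.IsPreprimitive (GeneralLinearGroup (ZMod 2) (Fin 3 → ZMod 2))
      (ℙ (ZMod 2) (Fin 3 → ZMod 2)) :=
    MulAction.isPreprimitive_of_is_two_pretransitive inferInstance
  have hf : FaithfulSMul (GeneralLinearGroup (ZMod 2) (Fin 3 → ZMod 2))
      (ℙ (ZMod 2) (Fin 3 → ZMod 2)) := by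
    refine ⟨fun {g h} hgh => Units.ext (LinearMap.ext fun m => ?_)⟩
    by_cases hm : m = 0
    · rw [hm, map_zero, map_zero]
    have h1 := hgh (Projectivization.mk _ m hm)
    rw [Projectivization.smul_mk, Projectivization.smul_mk, Projectivization.mk_eq_mk_iff'] at h1
    obtain ⟨c, hc⟩ := h1
    rcases zmod_two_eq_zero_or_one c with rfl | rfl
    · rw [zero_smul] at hc
      exact absurd (general_val_injective g (hc.symm.trans (map_zero g.val).symm)) hm
    · rw [one_smul] at hc
      exact hc.symm
  have hs := elationIwasawa.isSimpleGroup hperf hf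
  exact E.symm.isSimpleGroup_congr.mp hs

lemma natCard_gl : Nat.card (GL (Fin 3) (ZMod 2)) = 168 := by
  rw [Matrix.card_GL_field]
  simp [Fin.prod_univ_three, ZMod.card]

end Simplicity

/-! ### Totally isotropic subspaces -/

section Isotropic

variable {M : Type*} [AddCommGroup M] [Module (ZMod 2) M] [Module.Finite (ZMod 2) M]

lemma natCard_eq_two_pow (W : Submodule (ZMod 2) M) :
    Nat.card W = 2 ^ Module.finrank (ZMod 2) W := by
  rw [Module.natCard_eq_pow_finrank (K := ZMod 2), Nat.card_zmod]

variable {B : LinearMap.BilinForm (ZMod 2) M}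

variable (B) in
/-- A subspace on which the bilinear form `B` vanishes. -/
def IsIsotropic (W : Submodule (ZMod 2) M) : Prop := ∀ x ∈ W, ∀ y ∈ W, B x y = 0

omit [Module.Finite (ZMod 2) M] in
lemma isIsotropic_iff {W : Submodule (ZMod 2) M} : IsIsotropic B W ↔ W ≤ B.orthogonal W :=
  ⟨fun h _ hx _ hy => h _ hy _ hx, fun h x hx _ hy => h hy x hx⟩

omit [Module.Finite (ZMod 2) M] in
lemma isIsotropic_span {S : Set M} (h : ∀ x ∈ S, ∀ y ∈ S, B x y = 0) :
    IsIsotropic B (Submodule.span (ZMod 2) S) := by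
  intro x hx y hy
  induction hx, hy using Submodule.span_induction₂ with
  | mem_mem x y hx hy => exact h x hx y hy
  | zero_left y hy => simp
  | zero_right x hx => simp
  | add_left x y z _ _ _ h1 h2 => simp [h1, h2]
  | add_right x y z _ _ _ h1 h2 => simp [h1, h2]
  | smul_left r x y _ _ h => simp [h]
  | smul_right r x y _ _ h => simp [h]

lemma IsIsotropic.two_mul_finrank_le (hB : B.Nondegenerate) {W : Submodule (ZMod 2) M}
    (hW : IsIsotropic B W) :
    2 * Module.finrank (ZMod 2) W ≤ Module.finrank (ZMod 2) M := by
  have h1 := Submodule.finrank_mono (isIsotropic_iff.mp hW)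
  rw [LinearMap.BilinForm.finrank_orthogonal hB] at h1
  have h2 := W.finrank_le
  omega

/-- For an alternating form any vector orthogonal to an isotropic `W` can be adjoined to it, so a
maximal `W` equals its orthogonal, whose dimension is complementary. -/
lemma maximal_isIsotropic_iff (hB : B.Nondegenerate) (hA : B.IsAlt) {W : Submodule (ZMod 2) M} :
    Maximal (IsIsotropic B) W ↔
      IsIsotropic B W ∧ 2 * Module.finrank (ZMod 2) W = Module.finrank (ZMod 2) M := by
  constructor
  · intro h
    refine ⟨h.prop, ?_⟩
    have hle : B.orthogonal W ≤ W := by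
      intro x hx
      have hiso : IsIsotropic B (Submodule.span (ZMod 2) (insert x (W : Set M))) := by
        refine isIsotropic_span ?_
        rintro a (rfl | ha) b (rfl | hb)
        · exact hA _
        · exact hA.isRefl _ _ (hx b hb)
        · exact hx a ha
        · exact h.prop a ha b hb
      exact h.le_of_ge hiso
        (fun y hy => Submodule.subset_span (Set.mem_insert_of_mem _ hy))
        (Submodule.subset_span (Set.mem_insert _ _))
    have h1 := Submodule.finrank_mono hle
    rw [LinearMap.BilinForm.finrank_orthogonal hB] at h1
    have h2 := h.prop.two_mul_finrank_le hB
    omega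
  · rintro ⟨h1, h2⟩
    refine ⟨h1, fun W' hW' hle => ?_⟩
    refine (Submodule.eq_of_le_of_finrank_le hle ?_).ge
    have := hW'.two_mul_finrank_le hB
    omega

variable (B) in
/-- The sequences of `k` linearly independent and pairwise orthogonal vectors. -/
abbrev IsotropicFrame (k : ℕ) : Type _ :=
  {s : Fin k → M // LinearIndependent (ZMod 2) s ∧ ∀ i j, B (s i) (s j) = 0}

omit [Module.Finite (ZMod 2) M] in
lemma mem_orthogonal_span_range {k : ℕ} {s : Fin k → M} {z : M} :
    z ∈ B.orthogonal (Submodule.span (ZMod 2) (Set.range s)) ↔ ∀ i, B (s i) z = 0 := by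
  constructor
  · exact fun h i => h _ (Submodule.subset_span ⟨i, rfl⟩)
  · intro h x hx
    induction hx using Submodule.span_induction with
    | mem x hx =>
      obtain ⟨i, rfl⟩ := hx
      exact h i
    | zero => simp
    | add x y _ _ hx hy =>
      simp [hx, hy]
    | smul c x _ hx =>
      simp [hx]

omit [Module.Finite (ZMod 2) M] in
lemma IsotropicFrame.isIsotropic {k : ℕ} (s : IsotropicFrame B k) :
    IsIsotropic B (Submodule.span (ZMod 2) (Set.range s.1)) := by
  refine isIsotropic_span ?_
  rintro _ ⟨i, rfl⟩ _ ⟨j, rfl⟩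
  exact s.2.2 i j

/-- An isotropic frame is an isotropic frame with one vector less, together with a vector
orthogonal to it and not in its span. -/
def isotropicFrameSucc (hA : B.IsAlt) (k : ℕ) : IsotropicFrame B (k + 1) ≃
    Σ s : IsotropicFrame B k, {z // z ∈ B.orthogonal (Submodule.span (ZMod 2) (Set.range s.1)) ∧
      z ∉ Submodule.span (ZMod 2) (Set.range s.1)} where
  toFun s := ⟨⟨Fin.tail s.1, by
      have h := s.2.1
      rw [← Fin.cons_self_tail s.1, linearIndependent_finCons] at h
      exact h.1, fun i j => s.2.2 i.succ j.succ⟩, ⟨s.1 0, by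
      have h := s.2.1
      rw [← Fin.cons_self_tail s.1, linearIndependent_finCons] at h
      exact ⟨mem_orthogonal_span_range.mpr fun i => s.2.2 i.succ 0, h.2⟩⟩⟩
  invFun p := ⟨Fin.cons p.2.1 p.1.1, linearIndependent_finCons.mpr ⟨p.1.2.1, p.2.2.2⟩, by
      have h := mem_orthogonal_span_range.mp p.2.2.1
      intro i j
      refine Fin.cases ?_ (fun i => ?_) i <;> refine Fin.cases ?_ (fun j => ?_) j
      · exact hA _
      · exact hA.isRefl _ _ (h j)
      · exact h i
      · exact p.1.2.2 i j⟩
  left_inv s := Subtype.ext (Fin.cons_self_tail s.1)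
  right_inv p := rfl

/-- The span `U` of a frame of length `k` has `2 ^ k` elements and lies in its orthogonal, which has
`2 ^ (dim M - k)`; the next vector is any element of the difference. -/
lemma natCard_isotropicFrame_succ (hB : B.Nondegenerate) (hA : B.IsAlt) (k : ℕ) :
    Nat.card (IsotropicFrame B (k + 1)) =
      Nat.card (IsotropicFrame B k) * (2 ^ (Module.finrank (ZMod 2) M - k) - 2 ^ k) := by
  have : Finite M := Module.finite_of_finite (ZMod 2)
  have := Fintype.ofFinite (IsotropicFrame B k)
  have hfib : ∀ s : IsotropicFrame B k,
      Nat.card {z // z ∈ B.orthogonal (Submodule.span (ZMod 2) (Set.range s.1)) ∧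
        z ∉ Submodule.span (ZMod 2) (Set.range s.1)} =
      2 ^ (Module.finrank (ZMod 2) M - k) - 2 ^ k := by
    intro s
    set U := Submodule.span (ZMod 2) (Set.range s.1) with hU
    have hdim : Module.finrank (ZMod 2) U = k := by
      rw [hU, finrank_span_eq_card s.2.1, Fintype.card_fin]
    have hle : (U : Set M) ⊆ B.orthogonal U := isIsotropic_iff.mp s.isIsotropic
    change Nat.card ((B.orthogonal U : Set M) \ U : Set M) = _
    have h1 : (U : Set M).ncard = 2 ^ k := by
      rw [← Nat.card_coe_set_eq]
      exact (natCard_eq_two_pow U).trans (by rw [hdim])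
    have h2 : (B.orthogonal U : Set M).ncard = 2 ^ (Module.finrank (ZMod 2) M - k) := by
      rw [← Nat.card_coe_set_eq]
      exact (natCard_eq_two_pow (B.orthogonal U)).trans
        (by rw [LinearMap.BilinForm.finrank_orthogonal hB, hdim])
    rw [Nat.card_coe_set_eq, Set.ncard_sdiff hle, h1, h2]
  rw [Nat.card_congr (isotropicFrameSucc hA k), Nat.card_sigma, Finset.sum_congr rfl
    fun s _ => hfib s, Finset.sum_const, Finset.card_univ, smul_eq_mul, Nat.card_eq_fintype_card]

/-- The frames spanning an isotropic subspace are its bases. -/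
def isotropicFrameFibre {k : ℕ} {W : Submodule (ZMod 2) M} (hW : IsIsotropic B W)
    (hk : Module.finrank (ZMod 2) W = k) :
    {s : IsotropicFrame B k // Submodule.span (ZMod 2) (Set.range s.1) = W} ≃
      {s : Fin k → W // LinearIndependent (ZMod 2) s} where
  toFun s := ⟨fun i => ⟨s.1.1 i, s.2.le (Submodule.subset_span ⟨i, rfl⟩)⟩,
    LinearIndependent.of_comp W.subtype s.1.2.1⟩
  invFun s := ⟨⟨fun i => s.1 i, s.2.map' W.subtype W.ker_subtype,
    fun i j => hW _ (s.1 i).2 _ (s.1 j).2⟩, by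
      refine Submodule.eq_of_le_of_finrank_eq (Submodule.span_le.mpr ?_) ?_
      · rintro _ ⟨i, rfl⟩
        exact (s.1 i).2
      · rw [hk]
        exact (finrank_span_eq_card (s.2.map' W.subtype W.ker_subtype)).trans (Fintype.card_fin k)⟩
  left_inv s := rfl
  right_inv s := rfl

/-- Double count of frames of length 3: there are `63 · 30 · 12`, and each maximal subspace is
spanned by `7 · 6 · 4 = 168` of them. -/
lemma ncard_maximal_isIsotropic (hB : B.Nondegenerate) (hA : B.IsAlt)
    (hM : Module.finrank (ZMod 2) M = 6) : {W | Maximal (IsIsotropic B) W}.ncard = 135 := by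
  have : Finite M := Module.finite_of_finite (ZMod 2)
  have : Finite (Submodule (ZMod 2) M) := Finite.of_injective _ SetLike.coe_injective
  have := Fintype.ofFinite {W // Maximal (IsIsotropic B) W}
  have h3 : Nat.card (IsotropicFrame B 3) = 63 * 30 * 12 := by
    have h0 : Nat.card (IsotropicFrame B 0) = 1 := by
      have : Unique (IsotropicFrame B 0) :=
        { default := ⟨Fin.elim0, linearIndependent_empty_type, fun i => i.elim0⟩
          uniq := fun s => Subtype.ext (funext fun i => i.elim0) }
      exact Nat.card_unique
    rw [natCard_isotropicFrame_succ hB hA, natCard_isotropicFrame_succ hB hA,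
      natCard_isotropicFrame_succ hB hA, h0, hM]
    norm_num
  let σ : IsotropicFrame B 3 → {W // Maximal (IsIsotropic B) W} := fun s =>
    ⟨Submodule.span (ZMod 2) (Set.range s.1), (maximal_isIsotropic_iff hB hA).mpr
      ⟨s.isIsotropic, by rw [finrank_span_eq_card s.2.1, Fintype.card_fin, hM]⟩⟩
  have hfib : ∀ W, Nat.card {s // σ s = W} = 168 := by
    rintro ⟨W, hW⟩
    obtain ⟨hW1, hW2⟩ := (maximal_isIsotropic_iff hB hA).mp hW
    have hk : Module.finrank (ZMod 2) W = 3 := by omega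
    have e : {s // σ s = ⟨W, hW⟩} ≃
        {s : IsotropicFrame B 3 // Submodule.span (ZMod 2) (Set.range s.1) = W} :=
      Equiv.subtypeEquivRight fun s => Subtype.ext_iff
    rw [Nat.card_congr (e.trans (isotropicFrameFibre hW1 hk)),
      card_linearIndependent (by rw [hk]), hk]
    simp [Fin.prod_univ_three, ZMod.card]
  have h4 := Nat.card_congr (Equiv.sigmaFiberEquiv σ)
  rw [Nat.card_sigma, Finset.sum_congr rfl fun W _ => hfib W, Finset.sum_const, h3,
    Finset.card_univ, smul_eq_mul, ← Nat.card_eq_fintype_card] at h4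
  rw [← Nat.card_coe_set_eq]
  change Nat.card {W // Maximal (IsIsotropic B) W} = 135
  omega

end Isotropic

/-! ### Finite verifications for type `E₇` -/

/-- The coordinates of the positive roots of type `E₇` with respect to the simple roots. -/
def positiveRootsE₇ : List (Fin 7 → ℤ) :=
  [![0, 0, 0, 0, 0, 0, 1], ![0, 0, 0, 0, 0, 1, 0], ![0, 0, 0, 0, 0, 1, 1], ![0, 0, 0, 0, 1, 0, 0],
    ![0, 0, 0, 0, 1, 1, 0], ![0, 0, 0, 0, 1, 1, 1], ![0, 0, 0, 1, 0, 0, 0], ![0, 0, 0, 1, 1, 0, 0],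
    ![0, 0, 0, 1, 1, 1, 0], ![0, 0, 0, 1, 1, 1, 1], ![0, 0, 1, 0, 0, 0, 0], ![0, 0, 1, 1, 0, 0, 0],
    ![0, 0, 1, 1, 1, 0, 0], ![0, 0, 1, 1, 1, 1, 0], ![0, 0, 1, 1, 1, 1, 1], ![0, 1, 0, 0, 0, 0, 0],
    ![0, 1, 0, 1, 0, 0, 0], ![0, 1, 0, 1, 1, 0, 0], ![0, 1, 0, 1, 1, 1, 0], ![0, 1, 0, 1, 1, 1, 1],
    ![0, 1, 1, 1, 0, 0, 0], ![0, 1, 1, 1, 1, 0, 0], ![0, 1, 1, 1, 1, 1, 0], ![0, 1, 1, 1, 1, 1, 1],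
    ![0, 1, 1, 2, 1, 0, 0], ![0, 1, 1, 2, 1, 1, 0], ![0, 1, 1, 2, 1, 1, 1], ![0, 1, 1, 2, 2, 1, 0],
    ![0, 1, 1, 2, 2, 1, 1], ![0, 1, 1, 2, 2, 2, 1], ![1, 0, 0, 0, 0, 0, 0], ![1, 0, 1, 0, 0, 0, 0],
    ![1, 0, 1, 1, 0, 0, 0], ![1, 0, 1, 1, 1, 0, 0], ![1, 0, 1, 1, 1, 1, 0], ![1, 0, 1, 1, 1, 1, 1],
    ![1, 1, 1, 1, 0, 0, 0], ![1, 1, 1, 1, 1, 0, 0], ![1, 1, 1, 1, 1, 1, 0], ![1, 1, 1, 1, 1, 1, 1],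
    ![1, 1, 1, 2, 1, 0, 0], ![1, 1, 1, 2, 1, 1, 0], ![1, 1, 1, 2, 1, 1, 1], ![1, 1, 1, 2, 2, 1, 0],
    ![1, 1, 1, 2, 2, 1, 1], ![1, 1, 1, 2, 2, 2, 1], ![1, 1, 2, 2, 1, 0, 0], ![1, 1, 2, 2, 1, 1, 0],
    ![1, 1, 2, 2, 1, 1, 1], ![1, 1, 2, 2, 2, 1, 0], ![1, 1, 2, 2, 2, 1, 1], ![1, 1, 2, 2, 2, 2, 1],
    ![1, 1, 2, 3, 2, 1, 0], ![1, 1, 2, 3, 2, 1, 1], ![1, 1, 2, 3, 2, 2, 1], ![1, 1, 2, 3, 3, 2, 1],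
    ![1, 2, 2, 3, 2, 1, 0], ![1, 2, 2, 3, 2, 1, 1], ![1, 2, 2, 3, 2, 2, 1], ![1, 2, 2, 3, 3, 2, 1],
    ![1, 2, 2, 4, 3, 2, 1], ![1, 2, 3, 4, 3, 2, 1], ![2, 2, 3, 4, 3, 2, 1]]

set_option maxRecDepth 100000 in
lemma positiveRootsE₇_norm : ∀ c ∈ positiveRootsE₇, c ⬝ᵥ (CartanMatrix.E₇ *ᵥ c) = 2 := by
  decide +kernel

set_option maxRecDepth 100000 in
-- The vector `![0, 1, 0, 0, 1, 0, 1]` spans the kernel of the Cartan matrix modulo 2, so equality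
-- up to this vector is equality of classes in `R/2P`: every nonzero class contains a root.
lemma exists_positiveRootsE₇ : ∀ m : Fin 7 → ZMod 2, m = 0 ∨ m = ![0, 1, 0, 0, 1, 0, 1] ∨
    ∃ c ∈ positiveRootsE₇, (fun i => (c i : ZMod 2)) = m ∨
      (fun i => (c i : ZMod 2)) = m + ![0, 1, 0, 0, 1, 0, 1] := by
  decide +kernel

lemma ker_E₇ : ∀ m : Fin 7 → ZMod 2, m ᵥ* (CartanMatrix.E₇.map (Int.cast : ℤ → ZMod 2)) = 0 ↔
    m = 0 ∨ m = ![0, 1, 0, 0, 1, 0, 1] := by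
  decide +kernel

/-! ### The lattices of type `E₇` and `E₈` -/

namespace SimpleRoots

section Coordinates

variable {n : ℕ} {A : Matrix (Fin n) (Fin n) ℤ} {V : Type*}
  [NormedAddCommGroup V] [InnerProductSpace ℝ V] (D : SimpleRoots A V)

/-- The element of the root lattice with given coordinates. -/
def ofCoord (c : Fin n → ℤ) : D.rootLattice :=
  ⟨∑ i, c i • D.basis i, D.mem_rootLattice_iff.mpr ⟨c, rfl⟩⟩

lemma ofCoord_surjective (x : D.rootLattice) : ∃ c, D.ofCoord c = x := by
  obtain ⟨c, hc⟩ := D.mem_rootLattice_iff.mp x.2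
  exact ⟨c, Subtype.ext hc⟩

lemma inner_ofCoord (c d : Fin n → ℤ) :
    inner ℝ (D.ofCoord c : V) (D.ofCoord d : V) = ((c ⬝ᵥ (A *ᵥ d) : ℤ) : ℝ) := by
  simp only [ofCoord, sum_inner, inner_sum, dotProduct, Matrix.mulVec, Int.cast_sum, Int.cast_mul,
    Finset.mul_sum]
  rw [Finset.sum_comm]
  refine Finset.sum_congr rfl fun i _ => Finset.sum_congr rfl fun j _ => ?_
  rw [← Int.cast_smul_eq_zsmul ℝ, ← Int.cast_smul_eq_zsmul ℝ, real_inner_smul_left,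
    real_inner_smul_right, D.inner_basis]
  ring

/-- The coordinates of `p` are its products with the simple roots multiplied by the inverse Gram
matrix `B / d`, so those of `d p` are integers. -/
lemma smul_mem_rootLattice {B : Matrix (Fin n) (Fin n) ℤ} {d : ℤ} (hB : A * B = d • 1) {p : V}
    (hp : p ∈ D.weightLattice) : (d : ℝ) • p ∈ D.rootLattice := by
  choose k hk using D.mem_weightLattice_iff.mp hp
  refine D.mem_rootLattice_iff.mpr ⟨fun j => ∑ i, k i * B i j, ?_⟩
  have hk' : ∀ i, (k i : ℝ) = ∑ j, D.basis.repr p j * A j i := by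
    intro i
    rw [← hk]
    conv_lhs => rw [← D.basis.sum_repr p, sum_inner]
    refine Finset.sum_congr rfl fun j _ => ?_
    rw [real_inner_smul_left, D.inner_basis]
  conv_rhs => rw [← D.basis.sum_repr p, Finset.smul_sum]
  refine Finset.sum_congr rfl fun j _ => ?_
  rw [smul_smul, ← Int.cast_smul_eq_zsmul ℝ]
  congr 1
  push_cast
  simp only [hk', Finset.sum_mul]
  rw [Finset.sum_comm]
  have hAB : ∀ l, ∑ i, (A l i : ℝ) * B i j = if l = j then (d : ℝ) else 0 := by
    intro l
    have h := congrFun (congrFun hB l) j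
    rw [Matrix.mul_apply, Matrix.smul_apply, Matrix.one_apply] at h
    have h' := congrArg (Int.cast : ℤ → ℝ) h
    push_cast at h'
    rw [h']
    split_ifs <;> simp
  simp only [mul_assoc, ← Finset.mul_sum, hAB]
  simp [mul_comm]

lemma exists_frame {F : Matrix (Fin n) (Fin n) ℤ} (hF : F * A * Fᵀ = (2 : ℤ) • 1) :
    ∃ v : Fin n → V, (∀ i, v i ∈ D.roots) ∧ ∀ i j, i ≠ j → inner ℝ (v i) (v j) = (0 : ℝ) := by
  have h : ∀ i j, inner ℝ (D.ofCoord (F i) : V) (D.ofCoord (F j) : V) =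
      (((2 : ℤ) • (1 : Matrix (Fin n) (Fin n) ℤ)) i j : ℝ) := by
    intro i j
    rw [inner_ofCoord, ← hF, Matrix.mul_assoc, Matrix.mul_apply]
    rfl
  refine ⟨fun i => D.ofCoord (F i), fun i => ?_, fun i j hij => ?_⟩
  · refine D.mem_roots_of_inner_self (D.ofCoord (F i)).2 ?_
    rw [h]
    simp
  · rw [h]
    simp [hij]

/-- The combinations of the simple roots with coefficients in `𝔽₂`. -/
def coordMap : (Fin n → ZMod 2) →ₗ[ZMod 2] D.ModTwoP :=
  Fintype.linearCombination (ZMod 2) fun i => D.twoP.mkQ (D.ofCoord (Pi.single i 1))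

lemma mkQ_ofCoord (c : Fin n → ℤ) :
    D.twoP.mkQ (D.ofCoord c) = D.coordMap fun i => (c i : ZMod 2) := by
  have hc : D.ofCoord c = ∑ i, c i • D.ofCoord (Pi.single i 1) := by
    refine Subtype.ext ?_
    simp only [ofCoord, Submodule.coe_sum, Submodule.coe_smul, Pi.single_apply]
    refine Finset.sum_congr rfl fun i _ => ?_
    simp
  rw [hc, map_sum, coordMap, Fintype.linearCombination_apply]
  refine Finset.sum_congr rfl fun i _ => ?_
  rw [map_smul]
  exact (Int.cast_smul_eq_zsmul (ZMod 2) (c i) _).symm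

lemma coordMap_surjective : Function.Surjective D.coordMap := by
  intro x
  obtain ⟨y, rfl⟩ := D.twoP.mkQ_surjective x
  obtain ⟨c, rfl⟩ := D.ofCoord_surjective y
  exact ⟨_, (D.mkQ_ofCoord c).symm⟩

lemma form_coordMap (c d : Fin n → ZMod 2) :
    D.form (D.coordMap c) (D.coordMap d) = (c ᵥ* A.map (Int.cast : ℤ → ZMod 2)) ⬝ᵥ d := by
  have h : ∀ i j, D.form (D.twoP.mkQ (D.ofCoord (Pi.single i 1)))
      (D.twoP.mkQ (D.ofCoord (Pi.single j 1))) = (A i j : ZMod 2) := by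
    intro i j
    rw [form_mk]
    congr 1
    have h1 : (D.intInner (D.ofCoord (Pi.single i 1)) (D.ofCoord (Pi.single j 1)) : ℝ) =
        (A i j : ℝ) := by
      rw [intInner_cast, inner_ofCoord]
      simp
    exact_mod_cast h1
  simp only [coordMap, Fintype.linearCombination_apply, map_sum, map_smul, LinearMap.sum_apply,
    LinearMap.smul_apply, h, smul_eq_mul, dotProduct, Matrix.vecMul, Matrix.map_apply,
    Finset.mul_sum, Finset.sum_mul]
  refine Finset.sum_congr rfl fun j _ => Finset.sum_congr rfl fun i _ => ?_
  ring

/-- Nondegeneracy of the form on `R/2P` identifies the kernel of the coordinate map with the kernel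
of the Cartan matrix modulo 2, which gives the dimension. -/
lemma coordMap_eq_zero_iff {c : Fin n → ZMod 2} :
    D.coordMap c = 0 ↔ c ᵥ* A.map (Int.cast : ℤ → ZMod 2) = 0 := by
  constructor
  · intro h
    ext j
    have h1 := D.form_coordMap c (Pi.single j 1)
    rw [h, map_zero, LinearMap.zero_apply, dotProduct_single, mul_one] at h1
    exact h1.symm
  · intro h
    refine D.eq_zero_of_form fun y => ?_
    obtain ⟨d, rfl⟩ := D.coordMap_surjective y
    rw [form_coordMap, h, zero_dotProduct]

lemma finrank_modTwoP_add_finrank_ker : Module.finrank (ZMod 2) D.ModTwoP +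
    Module.finrank (ZMod 2) (LinearMap.ker D.coordMap) = n := by
  have h := D.coordMap.finrank_range_add_finrank_ker
  rwa [LinearMap.range_eq_top.mpr D.coordMap_surjective, finrank_top,
    Module.finrank_fin_fun] at h

end Coordinates

/-! ### Type `E₇`: dimension of `R/2P`, norms of weights, tameness -/

section E₇

variable {V : Type*} [NormedAddCommGroup V] [InnerProductSpace ℝ V]
  (D : SimpleRoots CartanMatrix.E₇ V)

lemma finrank_modTwoP_E₇ : Module.finrank (ZMod 2) D.ModTwoP = 6 := by
  have hker : LinearMap.ker D.coordMap =
      Submodule.span (ZMod 2) {(![0, 1, 0, 0, 1, 0, 1] : Fin 7 → ZMod 2)} := by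
    ext c
    rw [LinearMap.mem_ker, coordMap_eq_zero_iff, ker_E₇, Submodule.mem_span_singleton]
    constructor
    · rintro (rfl | rfl)
      · exact ⟨0, zero_smul _ _⟩
      · exact ⟨1, one_smul _ _⟩
    · rintro ⟨a, rfl⟩
      rcases zmod_two_eq_zero_or_one a with rfl | rfl
      · exact Or.inl (zero_smul _ _)
      · exact Or.inr (one_smul _ _)
  have h := D.finrank_modTwoP_add_finrank_ker
  rw [hker, finrank_span_singleton (by decide)] at h
  omega

/-- Every nonzero class modulo `2P` is the class of a root. -/
lemma exists_tildeP_eq_E₇ {x : D.ModTwoP} (hx : x ≠ 0) :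
    ∃ s : D.weylGroup, IsGroupReflection s ∧ D.tildeP s = x := by
  obtain ⟨m, rfl⟩ := D.coordMap_surjective x
  have hr : D.coordMap ![0, 1, 0, 0, 1, 0, 1] = 0 :=
    D.coordMap_eq_zero_iff.mpr ((ker_E₇ _).mpr (Or.inr rfl))
  rcases exists_positiveRootsE₇ m with rfl | rfl | ⟨c, hc, hcm⟩
  · exact absurd (map_zero _) hx
  · exact absurd hr hx
  have hroot : (D.ofCoord c : V) ∈ D.roots := by
    refine D.mem_roots_of_inner_self (D.ofCoord c).2 ?_
    rw [inner_ofCoord, positiveRootsE₇_norm c hc]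
    norm_num
  refine ⟨⟨_, D.rootReflection_mem_weylGroup hroot⟩, isGroupReflection_of_root hroot rfl, ?_⟩
  rw [tildeP_eq (α := D.ofCoord c) hroot rfl, mkQ_ofCoord]
  rcases hcm with h | h
  · rw [h]
  · rw [h, map_add, hr, add_zero]

lemma two_smul_mem_E₇ {p : V} (hp : p ∈ D.weightLattice) : (2 : ℝ) • p ∈ D.rootLattice := by
  -- The matrix is twice the inverse of the Cartan matrix.
  have := D.smul_mem_rootLattice (B := !![4, 4, 6, 8, 6, 4, 2; 4, 7, 8, 12, 9, 6, 3;
    6, 8, 12, 16, 12, 8, 4; 8, 12, 16, 24, 18, 12, 6; 6, 9, 12, 18, 15, 10, 5;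
    4, 6, 8, 12, 10, 8, 4; 2, 3, 4, 6, 5, 4, 3]) (d := 2) (by decide +kernel) hp
  exact_mod_cast this

/-- Modulo 2 the coordinates of `2p` are 0 or the radical vector `r`. In the second case `2p = r +
2c`, so `(p, p) = (r, r)/4 + (r, c) + (c, c)` with `(r, r) = 6`; the last two terms are even since
`r ∈ 2P` and `R` is even. -/
lemma weightLattice_E₇ {p : V} (hp : p ∈ D.weightLattice) :
    p ∈ D.rootLattice ∨ ∃ k : ℤ, inner ℝ p p = (3 / 2 + 2 * k : ℝ) := by
  have h2 := D.two_smul_mem_E₇ hp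
  obtain ⟨m, hm⟩ := D.ofCoord_surjective ⟨_, h2⟩
  have hm' : (D.ofCoord m : V) = (2 : ℝ) • p := congrArg Subtype.val hm
  have hmem : D.ofCoord m ∈ D.twoP := D.mem_twoP_iff.mpr ⟨p, hp, hm'.symm⟩
  have hhalf : ∀ c : Fin 7 → ℤ, m = (fun i => 2 * c i) → p = D.ofCoord c := by
    intro c hc
    have : (D.ofCoord m : V) = (2 : ℝ) • (D.ofCoord c : V) := by
      simp only [ofCoord, hc, mul_smul, Finset.smul_sum]
      refine Finset.sum_congr rfl fun i _ => ?_
      simp [two_smul]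
    exact smul_right_injective V two_ne_zero (hm'.symm.trans this)
  rw [← Submodule.Quotient.mk_eq_zero, ← Submodule.mkQ_apply, mkQ_ofCoord, coordMap_eq_zero_iff,
    ker_E₇] at hmem
  rcases hmem with h | h
  · left
    have : ∀ i, ∃ c, m i = 2 * c := fun i =>
      (ZMod.intCast_zmod_eq_zero_iff_dvd _ 2).mp (congrFun h i)
    choose c hc using this
    rw [hhalf c (funext hc)]
    exact (D.ofCoord c).2
  · right
    have : ∀ i, ∃ c, m i = ![0, 1, 0, 0, 1, 0, 1] i + 2 * c := by
      intro i
      have h1 : ((m i - ![0, 1, 0, 0, 1, 0, 1] i : ℤ) : ZMod 2) = 0 := by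
        have h2 := congrFun h i
        rw [Int.cast_sub, h2, sub_eq_zero]
        fin_cases i <;> rfl
      obtain ⟨c, hc⟩ := (ZMod.intCast_zmod_eq_zero_iff_dvd _ 2).mp h1
      exact ⟨c, by push_cast at hc; omega⟩
    choose c hc using this
    set r : Fin 7 → ℤ := ![0, 1, 0, 0, 1, 0, 1] with hr
    have hsum : (2 : ℝ) • p = (D.ofCoord r : V) + (2 : ℝ) • (D.ofCoord c : V) := by
      rw [← hm']
      simp only [ofCoord, Finset.smul_sum, ← Finset.sum_add_distrib]
      refine Finset.sum_congr rfl fun i _ => ?_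
      rw [hc i, add_smul, mul_smul]
      simp [two_smul]
    -- `r` is a sum of three pairwise orthogonal simple roots, whence the norm 6.
    have hrr : inner ℝ (D.ofCoord r : V) (D.ofCoord r : V) = (6 : ℝ) := by
      rw [inner_ofCoord, show r ⬝ᵥ (CartanMatrix.E₇ *ᵥ r) = 6 by decide +kernel]
      norm_num
    have hrc : ∃ k : ℤ, inner ℝ (D.ofCoord r : V) (D.ofCoord c : V) = (2 * k : ℝ) := by
      have hr2 : D.ofCoord r ∈ D.twoP := by
        rw [← Submodule.Quotient.mk_eq_zero, ← Submodule.mkQ_apply, mkQ_ofCoord,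
          coordMap_eq_zero_iff, ker_E₇]
        right
        funext i
        fin_cases i <;> rfl
      obtain ⟨q, hq, hqr⟩ := D.mem_twoP_iff.mp hr2
      obtain ⟨k, hk⟩ := D.inner_int_of_weightLattice hq (D.ofCoord c).2
      exact ⟨k, by rw [← hqr, real_inner_smul_left, hk]⟩
    obtain ⟨k, hk⟩ := hrc
    obtain ⟨l, hl⟩ := D.even_inner_self (D.ofCoord c).2
    refine ⟨k + l, ?_⟩
    have h4 := congrArg (fun x : V => (inner ℝ x x : ℝ)) hsum
    simp only [real_inner_add_add_self, real_inner_smul_left, real_inner_smul_right, hrr, hk, hl]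
      at h4
    push_cast
    linarith

/-- Norms of weights lie in `2ℤ` on `R` and in `3/2 + 2ℤ` off it: `1/2` and `1` never occur, and `2`
occurs only in `R`. -/
lemma isTame_E₇ : D.IsTame where
  two_smul_mem p hp := D.two_smul_mem_E₇ hp
  inner_self_ne_half p hp h := by
    rcases D.weightLattice_E₇ hp with h1 | ⟨k, hk⟩
    · obtain ⟨k, hk⟩ := D.even_inner_self h1
      have h2 : (4 * k : ℝ) = 1 := by linarith
      have h3 : 4 * k = 1 := by exact_mod_cast h2
      omega
    · have h2 : (2 * k : ℝ) = -1 := by linarith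
      have h3 : 2 * k = -1 := by exact_mod_cast h2
      omega
  inner_self_ne_one p hp h := by
    rcases D.weightLattice_E₇ hp with h1 | ⟨k, hk⟩
    · obtain ⟨k, hk⟩ := D.even_inner_self h1
      have h2 : (2 * k : ℝ) = 1 := by linarith
      have h3 : 2 * k = 1 := by exact_mod_cast h2
      omega
    · have h2 : (4 * k : ℝ) = -1 := by linarith
      have h3 : 4 * k = -1 := by exact_mod_cast h2
      omega
  mem_of_inner_self p hp h := by
    rcases D.weightLattice_E₇ hp with h1 | ⟨k, hk⟩
    · exact h1
    · have h2 : (4 * k : ℝ) = 1 := by linarith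
      have h3 : 4 * k = 1 := by exact_mod_cast h2
      omega
  frame := D.exists_frame (F := !![0, 0, 0, 0, 0, 0, 1; 0, 0, 0, 0, 1, 0, 0; 0, 0, 1, 0, 0, 0, 0;
    0, 1, 0, 0, 0, 0, 0; 0, 1, 1, 2, 1, 0, 0; 0, 1, 1, 2, 2, 2, 1; 2, 2, 3, 4, 3, 2, 1])
    (by decide +kernel)

end E₇

/-! ### Type `E₈`: unimodularity and tameness -/

section E₈

variable {V : Type*} [NormedAddCommGroup V] [InnerProductSpace ℝ V]
  (D : SimpleRoots CartanMatrix.E₈ V)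

/-- The inverse of the Cartan matrix of type `E₈`. -/
def inverseCartanE₈ : Matrix (Fin 8) (Fin 8) ℤ :=
  !![4, 5, 7, 10, 8, 6, 4, 2; 5, 8, 10, 15, 12, 9, 6, 3; 7, 10, 14, 20, 16, 12, 8, 4;
    10, 15, 20, 30, 24, 18, 12, 6; 8, 12, 16, 24, 20, 15, 10, 5; 6, 9, 12, 18, 15, 12, 8, 4;
    4, 6, 8, 12, 10, 8, 6, 3; 2, 3, 4, 6, 5, 4, 3, 2]

lemma E₈_mul_inverse : CartanMatrix.E₈ * inverseCartanE₈ = 1 := by decide +kernel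

/-- The Cartan matrix is invertible over the integers, so the root lattice is its own dual. -/
lemma weightLattice_E₈ : D.weightLattice = D.rootLattice := by
  refine le_antisymm (fun p hp => ?_) D.rootLattice_le_weightLattice
  have := D.smul_mem_rootLattice (B := inverseCartanE₈) (d := 1)
    (by rw [E₈_mul_inverse, one_smul]) hp
  simpa using this

lemma finrank_modTwoP_E₈ : Module.finrank (ZMod 2) D.ModTwoP = 8 := by
  have hker : LinearMap.ker D.coordMap = ⊥ := by
    refine LinearMap.ker_eq_bot'.mpr fun c hc => ?_
    rw [coordMap_eq_zero_iff] at hc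
    have h := congrArg (fun M : Matrix (Fin 8) (Fin 8) ℤ => M.map (Int.castRingHom (ZMod 2)))
      E₈_mul_inverse
    simp only [Matrix.map_mul, Matrix.map_one _ (map_zero _) (map_one _)] at h
    rw [← Matrix.vecMul_one c, ← h, ← Matrix.vecMul_vecMul]
    have hc' : c ᵥ* CartanMatrix.E₈.map (Int.castRingHom (ZMod 2)) = 0 := hc
    rw [hc', Matrix.zero_vecMul]
  have h := D.finrank_modTwoP_add_finrank_ker
  rw [hker, finrank_bot] at h
  omega

lemma isTame_E₈ : D.IsTame where
  two_smul_mem p hp := by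
    rw [weightLattice_E₈] at hp
    rw [two_smul]
    exact add_mem hp hp
  inner_self_ne_half p hp h := by
    rw [weightLattice_E₈] at hp
    obtain ⟨k, hk⟩ := D.even_inner_self hp
    have h2 : (4 * k : ℝ) = 1 := by linarith
    have h3 : 4 * k = 1 := by exact_mod_cast h2
    omega
  inner_self_ne_one p hp h := by
    rw [weightLattice_E₈] at hp
    obtain ⟨k, hk⟩ := D.even_inner_self hp
    have h2 : (2 * k : ℝ) = 1 := by linarith
    have h3 : 2 * k = 1 := by exact_mod_cast h2
    omega
  mem_of_inner_self p hp _ := by rwa [weightLattice_E₈] at hp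
  frame := D.exists_frame (F := !![0, 0, 0, 0, 0, 0, 0, 1; 0, 0, 0, 0, 0, 1, 0, 0;
    0, 0, 0, 1, 0, 0, 0, 0; 0, 1, 1, 1, 0, 0, 0, 0; 0, 1, 1, 2, 2, 1, 0, 0;
    0, 1, 1, 2, 2, 2, 2, 1; 2, 2, 4, 5, 4, 3, 2, 1; 2, 3, 3, 5, 4, 3, 2, 1])
    (by decide +kernel)

lemma twoP_eq_twoR_E₈ : D.twoP = D.twoR := by
  ext x
  rw [mem_twoP_iff, mem_twoR_iff, weightLattice_E₈]

end E₈

end SimpleRoots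

namespace SimpleRoots

/-! ### The action on the classes of roots -/

section Classes

variable {n : ℕ} {A : Matrix (Fin n) (Fin n) ℤ} {V : Type*}
  [NormedAddCommGroup V] [InnerProductSpace ℝ V] {D : SimpleRoots A V}

lemma map_mem_weightLattice {g : V ≃ₗᵢ[ℝ] V} (hg : g ∈ D.weylGroup) {p : V}
    (hp : p ∈ D.weightLattice) : g p ∈ D.weightLattice := by
  refine D.mem_weightLattice_iff.mpr fun i => ?_
  have hi : g⁻¹ (D.basis i) ∈ D.rootLattice :=
    D.map_mem_rootLattice (inv_mem hg) (Submodule.subset_span (D.basis_mem_roots i))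
  obtain ⟨k, hk⟩ := D.inner_int_of_weightLattice hp hi
  refine ⟨k, ?_⟩
  rw [← hk, ← g.inner_map_map p]
  congr 1
  exact (g.apply_symm_apply _).symm

/-- The action of the Weyl group on the root lattice. -/
def latticeMap (g : D.weylGroup) : D.rootLattice →ₗ[ℤ] D.rootLattice where
  toFun x := ⟨(g : V ≃ₗᵢ[ℝ] V) x, D.map_mem_rootLattice g.2 x.2⟩
  map_add' _ _ := Subtype.ext (map_add _ _ _)
  map_smul' c x := Subtype.ext (map_zsmul (g : V ≃ₗᵢ[ℝ] V) c (x : V))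

/-- The action of the Weyl group on the classes modulo `2P`. -/
def modTwoPMap (g : D.weylGroup) : D.ModTwoP →ₗ[ℤ] D.ModTwoP :=
  D.twoP.mapQ D.twoP (latticeMap g) (by
    intro x hx
    obtain ⟨p, hp, h⟩ := D.mem_twoP_iff.mp hx
    refine D.mem_twoP_iff.mpr ⟨(g : V ≃ₗᵢ[ℝ] V) p, map_mem_weightLattice g.2 hp, ?_⟩
    rw [← map_smul, h]
    rfl)

lemma IsTame.modTwoPMap_tildeP (hD : D.IsTame) (g : D.weylGroup) {s : D.weylGroup}
    (hs : IsGroupReflection s) : modTwoPMap g (D.tildeP s) = D.tildeP (g * s * g⁻¹) := by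
  have hα : (latticeMap g (D.rootOf s) : V) ∈ D.roots := D.map_mem_roots g.2 (hD.rootOf_mem hs)
  rw [tildeP_eq (s := g * s * g⁻¹) hα]
  · rfl
  · rw [Subgroup.coe_mul, Subgroup.coe_mul, Subgroup.coe_inv, hD.coe_eq hs]
    exact conj_rootReflection _ (hD.inner_rootOf_self hs)

lemma IsTame.exists_modTwoPMap (hD : D.IsTame) {C : Subgroup D.weylGroup} (hC : IsCube C)
    {π : Equiv.Perm (cubeBase C)} (hπ : π ∈ (cubeAction hC).range) :
    ∃ g, ∀ s : cubeBase C, D.tildeP (π s) = modTwoPMap g (D.tildeP s) := by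
  obtain ⟨x, rfl⟩ := hπ
  induction x using QuotientGroup.induction_on with
  | H g =>
  refine ⟨g, fun s => ?_⟩
  rw [cubeAction_mk, hD.modTwoPMap_tildeP _ s.2.2]

lemma IsTame.isIsotropic_cubeSpan (hD : D.IsTame) {C : Subgroup D.weylGroup} (hC : IsCube C) :
    IsIsotropic D.form (D.cubeSpan C) := by
  refine isIsotropic_span ?_
  rintro _ ⟨s, hs, rfl⟩ _ ⟨t, ht, rfl⟩
  exact hD.form_eq_zero_of_commute hs.2 ht.2 (hC.1 s hs.1 t ht.1)

lemma tildeP_mem_cubeSpan {C : Subgroup D.weylGroup} (s : cubeBase C) :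
    D.tildeP s ∈ D.cubeSpan C :=
  Submodule.subset_span ⟨s, s.2, rfl⟩

end Classes

/-! ### Maximal cubes of type `E₇` -/

section E₇

variable {V : Type*} [NormedAddCommGroup V] [InnerProductSpace ℝ V]
  (D : SimpleRoots CartanMatrix.E₇ V)

lemma ncard_nonzero {M : Type*} [AddCommGroup M] [Module (ZMod 2) M] [Module.Finite (ZMod 2) M]
    (W : Submodule (ZMod 2) M) :
    {x | x ∈ W ∧ x ≠ 0}.ncard = 2 ^ Module.finrank (ZMod 2) W - 1 := by
  have : Finite M := Module.finite_of_finite (ZMod 2)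
  have h : {x | x ∈ W ∧ x ≠ 0} = (W : Set M) \ {0} := rfl
  rw [h, Set.ncard_sdiff_singleton_of_mem W.zero_mem, ← natCard_eq_two_pow,
    ← Nat.card_coe_set_eq]
  rfl

lemma maximal_isTotallyIsotropic_iff_E₇ {W : Submodule (ZMod 2) D.ModTwoP} :
    Maximal D.IsTotallyIsotropic W ↔
      IsIsotropic D.form W ∧ Module.finrank (ZMod 2) W = 3 := by
  have h := maximal_isIsotropic_iff D.form_nondegenerate D.form_isAlt (W := W)
  rw [D.finrank_modTwoP_E₇] at h
  refine h.trans (and_congr_right fun _ => ?_)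
  omega

/-- The seven classes are distinct and nonzero and span an isotropic subspace of dimension at most
3, which has at most seven nonzero vectors. Both bounds are therefore attained. -/
lemma maximalCube_E₇ {C : Subgroup D.weylGroup} (hC : IsMaximalCube C) :
    Maximal D.IsTotallyIsotropic (D.cubeSpan C) ∧
      Set.BijOn D.tildeP (cubeBase C) {x | x ∈ D.cubeSpan C ∧ x ≠ 0} := by
  have hD := D.isTame_E₇
  have : Finite D.ModTwoP := Module.finite_of_finite (ZMod 2)
  have hinj : Set.InjOn D.tildeP (cubeBase C) := hD.tildeP_injOn.mono fun s hs => hs.2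
  have hmaps : Set.MapsTo D.tildeP (cubeBase C) {x | x ∈ D.cubeSpan C ∧ x ≠ 0} :=
    fun s hs => ⟨Submodule.subset_span ⟨s, hs, rfl⟩, hD.tildeP_ne_zero hs.2⟩
  have hiso := hD.isIsotropic_cubeSpan hC.1
  have hle := hiso.two_mul_finrank_le D.form_nondegenerate
  rw [D.finrank_modTwoP_E₇] at hle
  have hcard : (D.tildeP '' cubeBase C).ncard = 7 := by
    rw [Set.InjOn.ncard_image hinj, hD.ncard_cubeBase hC]
  have hsub := Set.ncard_le_ncard hmaps.image_subset
  rw [hcard, ncard_nonzero] at hsub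
  have hdim : Module.finrank (ZMod 2) (D.cubeSpan C) = 3 := by
    have h3 : Module.finrank (ZMod 2) (D.cubeSpan C) ≤ 3 := by omega
    generalize Module.finrank (ZMod 2) (D.cubeSpan C) = d at *
    interval_cases d <;> simp_all
  refine ⟨D.maximal_isTotallyIsotropic_iff_E₇.mpr ⟨hiso, hdim⟩, hmaps, hinj, ?_⟩
  refine (Set.eq_of_subset_of_ncard_le hmaps.image_subset ?_).ge
  rw [hcard, ncard_nonzero, hdim]
  norm_num

lemma span_nonzero {M : Type*} [AddCommGroup M] [Module (ZMod 2) M] (W : Submodule (ZMod 2) M) :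
    Submodule.span (ZMod 2) {x | x ∈ W ∧ x ≠ 0} = W := by
  refine le_antisymm (Submodule.span_le.mpr fun x hx => hx.1) fun x hx => ?_
  by_cases h : x = 0
  · rw [h]
    exact zero_mem _
  · exact Submodule.subset_span ⟨hx, h⟩

/-- Orthogonal classes make the reflections commute, and the cube they generate has no other
reflections; its rank is the number 7 of nonzero vectors of `W`. -/
lemma isMaximalCube_closure_E₇ {S : Set D.weylGroup} (hS : ∀ s ∈ S, IsGroupReflection s)
    {W : Submodule (ZMod 2) D.ModTwoP} (hW : Maximal D.IsTotallyIsotropic W)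
    (hSW : Set.BijOn D.tildeP S {x | x ∈ W ∧ x ≠ 0}) :
    IsMaximalCube (Subgroup.closure S) ∧ cubeBase (Subgroup.closure S) = S ∧
      D.cubeSpan (Subgroup.closure S) = W := by
  have hD := D.isTame_E₇
  obtain ⟨hcube, hbase⟩ := hD.isCube_closure hS fun s hs t ht =>
    hD.commute_of_form_eq_zero (hS s hs) (hS t ht)
      (hW.prop _ (hSW.mapsTo hs).1 _ (hSW.mapsTo ht).1)
  refine ⟨⟨hcube, ?_⟩, hbase, ?_⟩
  · rw [hbase, hD.reducedRank_eq, ← Set.InjOn.ncard_image hSW.injOn, hSW.image_eq,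
      ncard_nonzero, (D.maximal_isTotallyIsotropic_iff_E₇.mp hW).2]
    norm_num
  · rw [cubeSpan, hbase, hSW.image_eq, span_nonzero]

lemma exists_bijOn_E₇ (W : Submodule (ZMod 2) D.ModTwoP) :
    Set.BijOn D.tildeP {s | IsGroupReflection s ∧ D.tildeP s ∈ W} {x | x ∈ W ∧ x ≠ 0} := by
  refine ⟨fun s hs => ⟨hs.2, D.isTame_E₇.tildeP_ne_zero hs.1⟩,
    D.isTame_E₇.tildeP_injOn.mono fun s hs => hs.1, ?_⟩
  rintro x ⟨hx, hx0⟩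
  obtain ⟨s, hs, rfl⟩ := D.exists_tildeP_eq_E₇ hx0
  exact ⟨s, ⟨hs, hx⟩, rfl⟩

lemma exists_maximalCube_iff_E₇ (S : Set D.weylGroup) :
    (∃ C : Subgroup D.weylGroup, IsMaximalCube C ∧ cubeBase C = S) ↔
      (∀ s ∈ S, IsGroupReflection s) ∧
      ∃ W : Submodule (ZMod 2) D.ModTwoP, Maximal D.IsTotallyIsotropic W ∧
        Set.BijOn D.tildeP S {x | x ∈ W ∧ x ≠ 0} := by
  constructor
  · rintro ⟨C, hC, rfl⟩
    exact ⟨fun s hs => hs.2, _, D.maximalCube_E₇ hC⟩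
  · rintro ⟨hS, W, hW, hSW⟩
    obtain ⟨h1, h2, -⟩ := D.isMaximalCube_closure_E₇ hS hW hSW
    exact ⟨_, h1, h2⟩

lemma bijOn_cubeSpan_E₇ :
    Set.BijOn D.cubeSpan {C | IsMaximalCube C} {W | Maximal D.IsTotallyIsotropic W} := by
  refine ⟨fun C hC => (D.maximalCube_E₇ hC).1, fun C hC C' hC' h => ?_, fun W hW => ?_⟩
  · have h1 := (D.maximalCube_E₇ hC).2
    have h2 := (D.maximalCube_E₇ hC').2
    rw [h] at h1
    have hbase : cubeBase C = cubeBase C' := by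
      refine (D.isTame_E₇.tildeP_injOn.image_eq_image_iff (fun s hs => hs.2)
        fun s hs => hs.2).mp ?_
      rw [h1.image_eq, h2.image_eq]
    rw [← hC.1.2, ← hC'.1.2, hbase]
  · obtain ⟨h1, -, h3⟩ := D.isMaximalCube_closure_E₇ (fun s hs => hs.1) hW (D.exists_bijOn_E₇ W)
    exact ⟨_, h1, h3⟩

lemma ncard_maximalCube_E₇ : {C : Subgroup D.weylGroup | IsMaximalCube C}.ncard = 135 := by
  rw [← Set.InjOn.ncard_image D.bijOn_cubeSpan_E₇.injOn, D.bijOn_cubeSpan_E₇.image_eq]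
  exact ncard_maximal_isIsotropic D.form_nondegenerate D.form_isAlt D.finrank_modTwoP_E₇

end E₇

/-! ### The projective plane -/

section Plane

variable {W : Type*} [AddCommGroup W] [Module (ZMod 2) W]

lemma mk_eq_mk_iff_zmod_two {v w : W} (hv : v ≠ 0) (hw : w ≠ 0) :
    Projectivization.mk (ZMod 2) v hv = Projectivization.mk (ZMod 2) w hw ↔ v = w := by
  rw [Projectivization.mk_eq_mk_iff']
  constructor
  · rintro ⟨a, rfl⟩
    rcases zmod_two_eq_zero_or_one a with rfl | rfl
    · exact absurd (zero_smul _ _) hv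
    · rw [one_smul]
  · rintro rfl
    exact ⟨1, one_smul _ _⟩

/-- A subspace of dimension at most 2 has at most four vectors. Three distinct points with nonzero
sum would force the five vectors `0, x, y, z, x + y` into it. -/
lemma isCollinear_mk_iff {x y z : W} (hx : x ≠ 0) (hy : y ≠ 0) (hz : z ≠ 0) :
    Projectivization.IsCollinear {Projectivization.mk (ZMod 2) x hx,
      Projectivization.mk (ZMod 2) y hy, Projectivization.mk (ZMod 2) z hz} ↔
      x = y ∨ x = z ∨ y = z ∨ x + y + z = 0 := by
  classical
  constructor
  · rintro ⟨P, hfin, hdim, hsub⟩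
    by_contra! h
    obtain ⟨hxy, hxz, hyz, hxyz⟩ := h
    have hmem : ∀ {w : W} (hw : w ≠ 0),
        Projectivization.mk (ZMod 2) w hw ∈ P → w ∈ P.submodule := by
      intro w hw h
      rw [← Projectivization.Subspace.submodule.symm_apply_apply P] at h
      exact h
    have hx' := hmem hx (hsub (by simp))
    have hy' := hmem hy (hsub (by simp))
    have hz' := hmem hz (hsub (by simp))
    have : Finite P.submodule := Module.finite_of_finite (ZMod 2)
    have hcard : Nat.card P.submodule ≤ 4 := by
      rw [Module.natCard_eq_pow_finrank (K := ZMod 2), Nat.card_zmod]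
      exact (Nat.pow_le_pow_right (by norm_num) hdim).trans (by norm_num)
    have hne : x + y ≠ 0 := by
      intro h
      rw [← ZModModule.sub_eq_add, sub_eq_zero] at h
      exact hxy h
    have hne' : z ≠ x + y := by
      rintro rfl
      exact hxyz (ZModModule.add_self _)
    let F : Finset W := {0, x, y, z, x + y}
    have hF : F.card = 5 := by
      simp only [F]
      rw [Finset.card_insert_of_notMem, Finset.card_insert_of_notMem,
        Finset.card_insert_of_notMem, Finset.card_insert_of_notMem, Finset.card_singleton]
      · simpa using hne'
      · simp [hyz, hx]
      · simp [hxy, hxz, hy]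
      · simp [hx.symm, hy.symm, hz.symm, hne.symm]
    have hle : (F : Set W).ncard ≤ (P.submodule : Set W).ncard := by
      refine Set.ncard_le_ncard ?_ (Set.toFinite (P.submodule : Set W))
      intro w hw
      simp only [F, Finset.coe_insert, Finset.coe_singleton, Set.mem_insert_iff,
        Set.mem_singleton_iff] at hw
      rcases hw with rfl | rfl | rfl | rfl | rfl
      · exact zero_mem _
      · exact hx'
      · exact hy'
      · exact hz'
      · exact add_mem hx' hy'
    rw [Set.ncard_coe_finset, hF, ← Nat.card_coe_set_eq] at hle
    exact absurd (hle.trans hcard) (by norm_num)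
  · rintro (rfl | rfl | rfl | h)
    · rw [Set.insert_eq_of_mem (by simp)]
      exact Projectivization.isCollinear_pair _ _
    · rw [Set.pair_comm, Set.insert_eq_of_mem (by simp)]
      exact Projectivization.isCollinear_pair _ _
    · rw [Set.pair_eq_singleton]
      exact Projectivization.isCollinear_pair _ _
    · have hspan : z ∈ Submodule.span (ZMod 2) {x, y} := by
        rw [← ZModModule.sub_eq_add, sub_eq_zero] at h
        rw [← h]
        exact add_mem (Submodule.subset_span (by simp)) (Submodule.subset_span (by simp))
      refine ⟨(Submodule.span (ZMod 2) {x, y}).projectivization, ?_, ?_, ?_⟩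
      · rw [Projectivization.Subspace.submodule.apply_symm_apply]
        exact Module.Finite.span_of_finite _ (Set.toFinite _)
      · rw [Projectivization.Subspace.submodule.apply_symm_apply]
        refine (finrank_span_le_card ({x, y} : Set W)).trans ?_
        rw [Set.toFinset_insert, Set.toFinset_singleton]
        exact Finset.card_le_two
      · rintro _ (rfl | rfl | rfl)
        · exact (Submodule.mk_mem_projectivization_iff _ _).mpr (Submodule.subset_span (by simp))
        · exact (Submodule.mk_mem_projectivization_iff _ _).mpr (Submodule.subset_span (by simp))
        · exact (Submodule.mk_mem_projectivization_iff _ _).mpr hspan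

end Plane

end SimpleRoots

namespace SimpleRoots

/-! ### Type `E₇`: the projective plane on the base and the group `Φ` -/

section E₇

variable {V : Type*} [NormedAddCommGroup V] [InnerProductSpace ℝ V]
  (D : SimpleRoots CartanMatrix.E₇ V)

lemma finrank_cubeSpan_E₇ {C : Subgroup D.weylGroup} (hC : IsMaximalCube C) :
    Module.finrank (ZMod 2) (D.cubeSpan C) = 3 :=
  (D.maximal_isTotallyIsotropic_iff_E₇.mp (D.maximalCube_E₇ hC).1).2

/-- The base of a maximal cube of type `E₇` is in bijection with the nonzero vectors of the
span of the classes of its elements. -/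
def baseEquivE₇ {C : Subgroup D.weylGroup} (hC : IsMaximalCube C) :
    cubeBase C ≃ {x : D.cubeSpan C // x ≠ 0} :=
  Equiv.ofBijective (fun s => ⟨⟨D.tildeP s, tildeP_mem_cubeSpan s⟩, fun h =>
      D.isTame_E₇.tildeP_ne_zero s.2.2 (congrArg Subtype.val h)⟩) (by
    obtain ⟨-, hinj, hsurj⟩ := (D.maximalCube_E₇ hC).2
    constructor
    · intro s t h
      refine Subtype.ext (hinj s.2 t.2 ?_)
      exact congrArg (fun x : {x : D.cubeSpan C // x ≠ 0} => (x.1 : D.ModTwoP)) h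
    · rintro ⟨⟨x, hx⟩, hx0⟩
      obtain ⟨s, hs, hsx⟩ := hsurj ⟨hx, fun h => hx0 (Subtype.ext h)⟩
      exact ⟨⟨s, hs⟩, Subtype.ext (Subtype.ext hsx)⟩)

/-- The base of a maximal cube of type `E₇` as a projective plane. -/
def planeEquivE₇ {C : Subgroup D.weylGroup} (hC : IsMaximalCube C) :
    cubeBase C ≃ ℙ (ZMod 2) (D.cubeSpan C) :=
  (D.baseEquivE₇ hC).trans (Equiv.ofBijective (fun x => Projectivization.mk (ZMod 2) x.1 x.2) (by
    constructor
    · rintro ⟨x, hx⟩ ⟨y, hy⟩ h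
      exact Subtype.ext ((mk_eq_mk_iff_zmod_two hx hy).mp h)
    · intro p
      induction p using Projectivization.ind with
      | h v hv => exact ⟨⟨v, hv⟩, rfl⟩))

lemma planeEquivE₇_apply {C : Subgroup D.weylGroup} (hC : IsMaximalCube C) (s : cubeBase C) :
    D.planeEquivE₇ hC s = Projectivization.mk (ZMod 2) (D.baseEquivE₇ hC s).1
      (D.baseEquivE₇ hC s).2 := rfl

lemma isCollinear_planeEquivE₇_iff {C : Subgroup D.weylGroup} (hC : IsMaximalCube C)
    (x y z : cubeBase C) :
    Projectivization.IsCollinear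
      {D.planeEquivE₇ hC x, D.planeEquivE₇ hC y, D.planeEquivE₇ hC z} ↔
      x = y ∨ x = z ∨ y = z ∨ D.tildeP x + D.tildeP y + D.tildeP z = 0 := by
  simp only [planeEquivE₇_apply]
  rw [isCollinear_mk_iff]
  simp only [← Subtype.ext_iff (p := fun x : D.cubeSpan C => x ≠ 0), EmbeddingLike.apply_eq_iff_eq]
  rw [← Submodule.coe_eq_zero]
  rfl

/-- The identification of the base of a maximal cube of type `E₇` with the nonzero vectors of
`𝔽₂³`. -/
def vectorEquivE₇ {C : Subgroup D.weylGroup} (hC : IsMaximalCube C) :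
    cubeBase C ≃ {m : Fin 3 → ZMod 2 // m ≠ 0} :=
  (D.baseEquivE₇ hC).trans
    ((Module.finBasisOfFinrankEq (ZMod 2) (D.cubeSpan C)
      (D.finrank_cubeSpan_E₇ hC)).equivFun.toEquiv.subtypeEquiv fun _ =>
        not_congr (LinearEquiv.map_eq_zero_iff (Module.finBasisOfFinrankEq (ZMod 2) (D.cubeSpan C)
          (D.finrank_cubeSpan_E₇ hC)).equivFun).symm)

lemma vectorEquivE₇_apply {C : Subgroup D.weylGroup} (hC : IsMaximalCube C) (s : cubeBase C) :
    (D.vectorEquivE₇ hC s).1 = (Module.finBasisOfFinrankEq (ZMod 2) (D.cubeSpan C)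
      (D.finrank_cubeSpan_E₇ hC)).equivFun (D.baseEquivE₇ hC s).1 := rfl

lemma vectorEquivE₇_sum_three {C : Subgroup D.weylGroup} (hC : IsMaximalCube C)
    (x y z : cubeBase C) :
    (D.vectorEquivE₇ hC x).1 + (D.vectorEquivE₇ hC y).1 + (D.vectorEquivE₇ hC z).1 = 0 ↔
      D.tildeP x + D.tildeP y + D.tildeP z = 0 := by
  simp only [vectorEquivE₇_apply, ← map_add]
  rw [LinearEquiv.map_eq_zero_iff, ← Submodule.coe_eq_zero]
  rfl

lemma vectorEquivE₇_sum_four {C : Subgroup D.weylGroup} (hC : IsMaximalCube C)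
    (x y z w : cubeBase C) :
    (D.vectorEquivE₇ hC x).1 + (D.vectorEquivE₇ hC y).1 + (D.vectorEquivE₇ hC z).1 +
      (D.vectorEquivE₇ hC w).1 = 0 ↔
      D.tildeP x + D.tildeP y + D.tildeP z + D.tildeP w = 0 := by
  simp only [vectorEquivE₇_apply, ← map_add]
  rw [LinearEquiv.map_eq_zero_iff, ← Submodule.coe_eq_zero]
  rfl

/-- Conjugation acts on classes through a linear map, so it preserves vanishing sums; conversely,
the double transpositions supported on zero-sum quadruples are in the image and generate `GL₃(𝔽₂)`.
-/
lemma cubeAction_range_E₇ {C : Subgroup D.weylGroup} (hC : IsMaximalCube C) :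
    (cubeAction hC.1).range = (glPerm (D.vectorEquivE₇ hC)).range := by
  classical
  refine le_antisymm (fun π hπ => ?_) (glPerm_range_le _ ?_)
  · obtain ⟨g, hg⟩ := D.isTame_E₇.exists_modTwoPMap hC.1 hπ
    refine mem_range_glPerm _ fun x y z h => ?_
    rw [vectorEquivE₇_sum_three] at h ⊢
    rw [hg, hg, hg, ← map_add, ← map_add, h, map_zero]
  · intro a b c d hab hac had hbc hbd hcd h
    rw [vectorEquivE₇_sum_four] at h
    exact D.isTame_E₇.swap_mul_swap_mem_range hC.1 hab hac had hbc hbd hcd h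

lemma mem_range_iff_isCollinear_E₇ {C : Subgroup D.weylGroup} (hC : IsMaximalCube C)
    (π : Equiv.Perm (cubeBase C)) :
    π ∈ (cubeAction hC.1).range ↔ ∀ x y z : cubeBase C,
      Projectivization.IsCollinear
        {D.planeEquivE₇ hC (π x), D.planeEquivE₇ hC (π y), D.planeEquivE₇ hC (π z)} ↔
      Projectivization.IsCollinear
        {D.planeEquivE₇ hC x, D.planeEquivE₇ hC y, D.planeEquivE₇ hC z} := by
  simp only [isCollinear_planeEquivE₇_iff, EmbeddingLike.apply_eq_iff_eq]
  constructor
  · intro hπ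
    have key : ∀ π ∈ (cubeAction hC.1).range, ∀ x y z : cubeBase C,
        D.tildeP x + D.tildeP y + D.tildeP z = 0 →
          D.tildeP (π x) + D.tildeP (π y) + D.tildeP (π z) = 0 := by
      intro π hπ x y z h
      obtain ⟨g, hg⟩ := D.isTame_E₇.exists_modTwoPMap hC.1 hπ
      rw [hg, hg, hg, ← map_add, ← map_add, h, map_zero]
    intro x y z
    have h : D.tildeP (π x) + D.tildeP (π y) + D.tildeP (π z) = 0 ↔
        D.tildeP x + D.tildeP y + D.tildeP z = 0 := by
      refine ⟨fun h => ?_, key π hπ x y z⟩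
      have := key _ (inv_mem hπ) _ _ _ h
      simpa using this
    rw [h]
  · intro h
    rw [D.cubeAction_range_E₇ hC]
    refine mem_range_glPerm _ fun x y z hxyz => ?_
    -- Triples with repetitions are collinear too. Nonzero vectors with sum zero are distinct, so
    -- here collinearity of the images does mean sum zero.
    have hne : ∀ {a b c : cubeBase C}, (D.vectorEquivE₇ hC a).1 + (D.vectorEquivE₇ hC b).1 +
        (D.vectorEquivE₇ hC c).1 = 0 → a ≠ b := by
      rintro a b c habc rfl
      rw [ZModModule.add_self, zero_add] at habc
      exact (D.vectorEquivE₇ hC c).2 habc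
    have hxy := hne hxyz
    have hxz : x ≠ z := hne (c := y) (by rw [add_right_comm]; exact hxyz)
    have hyz : y ≠ z := hne (c := x) (by rw [add_comm, ← add_assoc]; exact hxyz)
    rw [vectorEquivE₇_sum_three] at hxyz ⊢
    have h1 := (h x y z).mpr (Or.inr (Or.inr (Or.inr hxyz)))
    simpa [hxy, hxz, hyz] using h1

lemma nonempty_mulEquiv_E₇ {C : Subgroup D.weylGroup} (hC : IsMaximalCube C) :
    Nonempty (cubePhi C ≃* GL (Fin 3) (ZMod 2)) :=
  nonempty_mulEquiv_of_range_eq (D.isTame_E₇.cubeAction_injective hC) (glPerm_injective _)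
    (D.cubeAction_range_E₇ hC)

end E₇

/-! ### Maximal cubes of type `E₈` -/

section E₈

variable {V : Type*} [NormedAddCommGroup V] [InnerProductSpace ℝ V]
  (D : SimpleRoots CartanMatrix.E₈ V)

/-- For type `E₈` the quotients `R / 2P` and `R / 2R` coincide. -/
def modEquivE₈ : D.ModTwoP ≃ₗ[ZMod 2] D.ModTwoR :=
  let e := Submodule.quotEquivOfEq D.twoP D.twoR D.twoP_eq_twoR_E₈
  { e.toAddEquiv with map_smul' := fun c x => ZMod.map_smul e c x }

lemma modEquivE₈_mkQ (x : D.rootLattice) : D.modEquivE₈ (D.twoP.mkQ x) = D.twoR.mkQ x := rfl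

lemma modEquivE₈_tildeP (s : D.weylGroup) : D.modEquivE₈ (D.tildeP s) = D.tildeR s := rfl

lemma tildeR_injOn_E₈ : Set.InjOn D.tildeR {s | IsGroupReflection s} := fun _ hs _ ht h =>
  D.isTame_E₈.tildeP_injOn hs ht (D.modEquivE₈.injective h)

variable {C : Subgroup D.weylGroup}

lemma direction_le_E₈ :
    (D.cubeAffineSpan C).direction ≤ (D.cubeSpan C).map D.modEquivE₈.toLinearMap := by
  rw [cubeAffineSpan, direction_affineSpan, vectorSpan_def]
  refine Submodule.span_le.mpr ?_
  rintro _ ⟨_, ⟨s, hs, rfl⟩, _, ⟨t, ht, rfl⟩, rfl⟩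
  exact ⟨_, sub_mem (Submodule.subset_span ⟨s, hs, rfl⟩) (Submodule.subset_span ⟨t, ht, rfl⟩), rfl⟩

/-- Replacing `y` by `y + 2p` changes the norm by `4 (y, p) + 4 (p, p)`. So `(x, x)/2` modulo 2 is a
function on `R/2R`. -/
lemma inner_self_congr_E₈ {x y : D.rootLattice} (h : D.twoR.mkQ x = D.twoR.mkQ y) :
    4 ∣ D.intInner x x - D.intInner y y := by
  rw [← sub_eq_zero, ← map_sub, Submodule.mkQ_apply, Submodule.Quotient.mk_eq_zero,
    mem_twoR_iff] at h
  obtain ⟨p, hp, h⟩ := h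
  obtain ⟨k, hk⟩ := D.inner_int_of_rootLattice hp hp
  obtain ⟨l, hl⟩ := D.inner_int_of_rootLattice y.2 hp
  refine ⟨l + k, ?_⟩
  have hx : (x : V) = (y : V) + (2 : ℝ) • p := by
    rw [h, Submodule.coe_sub]
    abel
  have h1 : (D.intInner x x : ℝ) - D.intInner y y = 4 * (l + k) := by
    rw [D.intInner_cast, D.intInner_cast, hx, real_inner_add_add_self, real_inner_smul_right,
      real_inner_smul_right, real_inner_smul_left, hk, hl]
    ring
  exact_mod_cast h1

/-- Half the norm modulo 2 is additive on the isotropic span of the base: there `(x, y)` is even, so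
the cross term `2 (x, y)` is divisible by 4. Differences of orthogonal roots have norm 4, so it
vanishes on the whole direction. -/
lemma exists_four_dvd_E₈ (hC : IsCube C) {w : D.ModTwoR}
    (hw : w ∈ (D.cubeAffineSpan C).direction) :
    ∃ x : D.rootLattice, D.twoR.mkQ x = w ∧ 4 ∣ D.intInner x x := by
  have hD := D.isTame_E₈
  have hle := D.direction_le_E₈ (C := C)
  rw [cubeAffineSpan, direction_affineSpan, vectorSpan_def] at hw hle
  induction hw using Submodule.span_induction with
  | mem w hw =>
    obtain ⟨_, ⟨s, hs, rfl⟩, _, ⟨t, ht, rfl⟩, rfl⟩ := hw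
    refine ⟨D.rootOf s - D.rootOf t, map_sub _ _ _, ?_⟩
    by_cases hst : s = t
    · refine ⟨0, ?_⟩
      have h1 : (D.intInner (D.rootOf s - D.rootOf t) (D.rootOf s - D.rootOf t) : ℝ) = 0 := by
        rw [D.intInner_cast, hst, sub_self]
        simp
      exact_mod_cast h1
    · refine ⟨1, ?_⟩
      have h1 : (D.intInner (D.rootOf s - D.rootOf t) (D.rootOf s - D.rootOf t) : ℝ) = 4 := by
        rw [D.intInner_cast, Submodule.coe_sub, real_inner_sub_sub_self,
          hD.inner_rootOf_self hs.2, hD.inner_rootOf_self ht.2, hD.inner_cubeBase hC hs ht hst]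
        norm_num
      exact_mod_cast h1
  | zero => exact ⟨0, map_zero _, by simp [intInner]⟩
  | add a b ha hb iha ihb =>
    obtain ⟨x, rfl, k, hk⟩ := iha
    obtain ⟨y, rfl, l, hl⟩ := ihb
    refine ⟨x + y, map_add _ _ _, ?_⟩
    obtain ⟨x', hx', hxx⟩ := hle ha
    obtain ⟨y', hy', hyy⟩ := hle hb
    rw [D.modEquivE₈.injective (hxx.trans (D.modEquivE₈_mkQ x).symm)] at hx'
    rw [D.modEquivE₈.injective (hyy.trans (D.modEquivE₈_mkQ y).symm)] at hy'
    have hxy := hD.isIsotropic_cubeSpan hC _ hx' _ hy'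
    rw [form_mk, ZMod.intCast_zmod_eq_zero_iff_dvd] at hxy
    obtain ⟨m, hm⟩ := hxy
    refine ⟨k + l + m, ?_⟩
    have h1 : (D.intInner (x + y) (x + y) : ℝ) = D.intInner x x + 2 * D.intInner x y +
        D.intInner y y := by
      rw [D.intInner_cast, D.intInner_cast, D.intInner_cast, D.intInner_cast, Submodule.coe_add,
        real_inner_add_add_self]
    have h2 : D.intInner (x + y) (x + y) = D.intInner x x + 2 * D.intInner x y +
        D.intInner y y := by exact_mod_cast h1
    push_cast at hm
    rw [h2, hk, hl, hm]
    ring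
  | smul c a ha iha =>
    rcases zmod_two_eq_zero_or_one c with rfl | rfl
    · exact ⟨0, by rw [map_zero, zero_smul], by simp [intInner]⟩
    · rwa [one_smul]

/-- A root has norm 2, which is not divisible by 4. Thus the affine span of the base misses the
origin. -/
lemma tildeR_notMem_direction_E₈ (hC : IsCube C) (s : cubeBase C) :
    D.tildeR s ∉ (D.cubeAffineSpan C).direction := by
  intro h
  obtain ⟨x, hx, hx4⟩ := D.exists_four_dvd_E₈ hC h
  have h1 := D.inner_self_congr_E₈ hx
  have h2 : (D.intInner (D.rootOf s) (D.rootOf s) : ℝ) = 2 := by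
    rw [D.intInner_cast, D.isTame_E₈.inner_rootOf_self s.2.2]
  have h3 : D.intInner (D.rootOf s) (D.rootOf s) = 2 := by exact_mod_cast h2
  rw [h3] at h1
  omega

lemma tildeR_mem_cubeAffineSpan (s : cubeBase C) : D.tildeR s ∈ D.cubeAffineSpan C :=
  subset_affineSpan _ _ ⟨s, s.2, rfl⟩

lemma natCard_cubeBase_E₈ (hC : IsMaximalCube C) : Nat.card (cubeBase C) = 8 := by
  rw [Nat.card_coe_set_eq, D.isTame_E₈.ncard_cubeBase hC]

instance finite_modTwoR_E₈ : Module.Finite (ZMod 2) D.ModTwoR :=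
  Module.Finite.equiv D.modEquivE₈

lemma nonempty_cubeBase_E₈ (hC : IsMaximalCube C) : Nonempty (cubeBase C) := by
  have : Nat.card (cubeBase C) ≠ 0 := by
    rw [D.natCard_cubeBase_E₈ hC]
    norm_num
  exact (Nat.card_ne_zero.mp this).1

/-- The class map of the base into the affine space it spans. -/
def affineMapE₈ (s : cubeBase C) : D.cubeAffineSpan C :=
  ⟨D.tildeR s, D.tildeR_mem_cubeAffineSpan s⟩

lemma affineMapE₈_injective : Function.Injective (D.affineMapE₈ (C := C)) := fun s t h =>
  Subtype.ext (D.tildeR_injOn_E₈ s.2.2 t.2.2 (congrArg Subtype.val h))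

/-- The direction is a proper subspace of an isotropic subspace of an 8-dimensional space, hence of
something of dimension at most 4. -/
lemma finrank_direction_lt_E₈ (hC : IsMaximalCube C) :
    Module.finrank (ZMod 2) (D.cubeAffineSpan C).direction ≤ 3 := by
  obtain ⟨s⟩ := D.nonempty_cubeBase_E₈ hC
  have hlt : (D.cubeAffineSpan C).direction < (D.cubeSpan C).map D.modEquivE₈.toLinearMap :=
    lt_of_le_of_ne D.direction_le_E₈ fun h => D.tildeR_notMem_direction_E₈ hC.1 s (by
      rw [h]
      exact ⟨_, tildeP_mem_cubeSpan s, rfl⟩)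
  have h1 := Submodule.finrank_lt_finrank_of_lt hlt
  rw [LinearEquiv.finrank_map_eq D.modEquivE₈] at h1
  have h2 := (D.isTame_E₈.isIsotropic_cubeSpan hC.1).two_mul_finrank_le D.form_nondegenerate
  rw [D.finrank_modTwoP_E₈] at h2
  omega

lemma natCard_cubeAffineSpan_E₈ (hC : IsMaximalCube C) :
    Nat.card (D.cubeAffineSpan C) = 2 ^ Module.finrank (ZMod 2) (D.cubeAffineSpan C).direction := by
  obtain ⟨s⟩ := D.nonempty_cubeBase_E₈ hC
  have : Nonempty (D.cubeAffineSpan C) := ⟨D.affineMapE₈ s⟩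
  rw [← natCard_eq_two_pow]
  exact Nat.card_congr (Equiv.vaddConst (D.affineMapE₈ s)).symm

/-- Eight distinct classes do not fit into an affine space of dimension less than 3. -/
lemma finrank_direction_E₈ (hC : IsMaximalCube C) :
    Module.finrank (ZMod 2) (D.cubeAffineSpan C).direction = 3 := by
  have : Finite D.ModTwoR := Module.finite_of_finite (ZMod 2)
  have h1 := Nat.card_le_card_of_injective _ (D.affineMapE₈_injective (C := C))
  rw [D.natCard_cubeBase_E₈ hC, D.natCard_cubeAffineSpan_E₈ hC] at h1
  have h2 := D.finrank_direction_lt_E₈ hC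
  generalize Module.finrank (ZMod 2) (D.cubeAffineSpan C).direction = d at *
  interval_cases d <;> simp_all

/-- The base of a maximal cube of type `E₈` is in bijection with the affine space spanned by the
classes of its elements. -/
def affineEquivE₈ (hC : IsMaximalCube C) : cubeBase C ≃ D.cubeAffineSpan C :=
  Equiv.ofBijective D.affineMapE₈ (by
    have : Finite D.ModTwoR := Module.finite_of_finite (ZMod 2)
    rw [Nat.bijective_iff_injective_and_card]
    refine ⟨D.affineMapE₈_injective, ?_⟩
    rw [D.natCard_cubeBase_E₈ hC, D.natCard_cubeAffineSpan_E₈ hC, D.finrank_direction_E₈ hC]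
    norm_num)

lemma coe_affineEquivE₈ (hC : IsMaximalCube C) (s : cubeBase C) :
    (D.affineEquivE₈ hC s : D.ModTwoR) = D.tildeR s := rfl

/-- In characteristic 2 the sum `a + b + c` is the affine combination `(a - b) + c`, so it stays in
the affine span, all of whose points are classes of the base. -/
lemma exists_tildeR_eq_E₈ (hC : IsMaximalCube C) (a b c : cubeBase C) :
    ∃ s : cubeBase C, D.tildeR s = D.tildeR a + D.tildeR b + D.tildeR c := by
  have h : D.tildeR a + D.tildeR b + D.tildeR c ∈ D.cubeAffineSpan C := by
    have h1 := AffineSubspace.vadd_mem_of_mem_direction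
      (AffineSubspace.vsub_mem_direction (D.tildeR_mem_cubeAffineSpan a)
        (D.tildeR_mem_cubeAffineSpan b)) (D.tildeR_mem_cubeAffineSpan c)
    rwa [vsub_eq_sub, vadd_eq_add, ZModModule.sub_eq_add] at h1
  obtain ⟨s, hs⟩ := (D.affineEquivE₈ hC).surjective ⟨_, h⟩
  exact ⟨s, congrArg Subtype.val hs⟩

lemma existsUnique_of_triple_E₈ (hC : IsMaximalCube C) (T : Finset D.weylGroup)
    (hT : (T : Set D.weylGroup) ⊆ cubeBase C) (hT3 : T.card = 3) :
    ∃! s, s ∈ cubeBase C ∧ s ∉ T ∧ D.tildeR s = D.classSum T := by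
  classical
  obtain ⟨a, b, c, hab, hac, hbc, rfl⟩ := Finset.card_eq_three.mp hT3
  have hsum : D.classSum {a, b, c} = D.tildeR a + D.tildeR b + D.tildeR c := by
    rw [classSum, Finset.sum_insert (by simp [hab, hac]), Finset.sum_insert (by simp [hbc]),
      Finset.sum_singleton, add_assoc]
  have ha : a ∈ cubeBase C := hT (by simp)
  have hb : b ∈ cubeBase C := hT (by simp)
  have hc : c ∈ cubeBase C := hT (by simp)
  obtain ⟨s, hs⟩ := D.exists_tildeR_eq_E₈ hC ⟨a, ha⟩ ⟨b, hb⟩ ⟨c, hc⟩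
  have hinj := D.tildeR_injOn_E₈
  -- If the sum of three classes were one of them, the other two would coincide.
  have hcancel : ∀ {x y z : D.ModTwoR}, x = x + y + z → y = z := by
    intro x y z h
    rw [add_assoc, left_eq_add, ← ZModModule.sub_eq_add, sub_eq_zero] at h
    exact h
  refine ⟨s, ⟨s.2, ?_, hs.trans hsum.symm⟩, fun t ht => hinj ht.1.2 s.2.2 ?_⟩
  · simp only [Finset.mem_insert, Finset.mem_singleton, not_or]
    refine ⟨fun h => hbc ?_, fun h => hac ?_, fun h => hab ?_⟩
    · rw [h] at hs
      exact hinj hb.2 hc.2 (hcancel hs)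
    · rw [h] at hs
      exact hinj ha.2 hc.2 (hcancel (x := D.tildeR b) (hs.trans (by dsimp only; abel)))
    · rw [h] at hs
      exact hinj ha.2 hb.2 (hcancel (x := D.tildeR c) (hs.trans (by dsimp only; abel)))
  · rw [ht.2.2, hsum, hs]

/-- A block through three points is completed by a fourth whose class is the sum of theirs, and this
point exists and is unique. -/
lemma isSteinerSystem_E₈ (hC : IsMaximalCube C) :
    IsSteinerSystem 3 4 8 (cubeBase C) (D.cubeBlocks C) := by
  classical
  have hD := D.isTame_E₈
  refine ⟨hD.finite_cubeBase hC, hD.ncard_cubeBase hC, fun B hB => ⟨hB.1, hB.2.1⟩,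
    fun T hT hT3 => ?_⟩
  obtain ⟨s, ⟨hs, hsT, hsum⟩, huniq⟩ := D.existsUnique_of_triple_E₈ hC T hT hT3
  have hins : ∀ t, t ∉ T → D.classSum (insert t T) = D.tildeR t + D.classSum T :=
    fun t ht => Finset.sum_insert ht
  refine ⟨insert s T, ⟨⟨?_, ?_, ?_⟩, Finset.subset_insert s T⟩, ?_⟩
  · rw [Finset.coe_insert]
    exact Set.insert_subset hs hT
  · rw [Finset.card_insert_of_notMem hsT, hT3]
  · rw [hins s hsT, hsum, ZModModule.add_self]
  · rintro B ⟨⟨hB1, hB2, hB3⟩, hTB⟩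
    obtain ⟨t, htB, htT⟩ := Finset.exists_mem_notMem_of_card_lt_card
      (show T.card < B.card by omega)
    have hB : insert t T = B := Finset.eq_of_subset_of_card_le
      (Finset.insert_subset htB hTB) (by rw [Finset.card_insert_of_notMem htT]; omega)
    rw [← hB, hins t htT, ← ZModModule.sub_eq_add, sub_eq_zero] at hB3
    rw [← hB, huniq t ⟨hB1 htB, htT, hB3⟩]

/-- The identification of the base of a maximal cube of type `E₈` with `𝔽₂³`, with origin `o`. -/
def vectorEquivE₈ (hC : IsMaximalCube C) (o : cubeBase C) : cubeBase C ≃ (Fin 3 → ZMod 2) :=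
  haveI : Nonempty (D.cubeAffineSpan C) := ⟨D.affineMapE₈ o⟩
  (D.affineEquivE₈ hC).trans ((Equiv.vaddConst (D.affineEquivE₈ hC o)).symm.trans
    (Module.finBasisOfFinrankEq (ZMod 2) (D.cubeAffineSpan C).direction
      (D.finrank_direction_E₈ hC)).equivFun.toEquiv)

lemma vectorEquivE₈_sum (hC : IsMaximalCube C) (o x y z w : cubeBase C) :
    D.vectorEquivE₈ hC o x + D.vectorEquivE₈ hC o y + D.vectorEquivE₈ hC o z +
      D.vectorEquivE₈ hC o w = 0 ↔
      D.tildeR x + D.tildeR y + D.tildeR z + D.tildeR w = 0 := by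
  have : Nonempty (D.cubeAffineSpan C) := ⟨D.affineMapE₈ o⟩
  have h : ∀ s, D.vectorEquivE₈ hC o s = (Module.finBasisOfFinrankEq (ZMod 2)
      (D.cubeAffineSpan C).direction (D.finrank_direction_E₈ hC)).equivFun
        (D.affineEquivE₈ hC s -ᵥ D.affineEquivE₈ hC o) := fun s => rfl
  simp only [h, ← map_add]
  rw [LinearEquiv.map_eq_zero_iff, ← Submodule.coe_eq_zero]
  simp only [Submodule.coe_add, AffineSubspace.coe_vsub, coe_affineEquivE₈, vsub_eq_sub]
  have h4 : D.tildeR o + D.tildeR o = 0 := ZModModule.add_self _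
  -- The number of terms is even, so the choice of origin cancels out.
  rw [show D.tildeR x - D.tildeR o + (D.tildeR y - D.tildeR o) + (D.tildeR z - D.tildeR o) +
    (D.tildeR w - D.tildeR o) = D.tildeR x + D.tildeR y + D.tildeR z + D.tildeR w -
      ((D.tildeR o + D.tildeR o) + (D.tildeR o + D.tildeR o)) by abel, h4, add_zero, sub_zero]

lemma vectorEquivE₈_eq_iff (hC : IsMaximalCube C) (o x y z w : cubeBase C) :
    D.vectorEquivE₈ hC o w = D.vectorEquivE₈ hC o x + D.vectorEquivE₈ hC o y +
      D.vectorEquivE₈ hC o z ↔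
      D.tildeR x + D.tildeR y + D.tildeR z + D.tildeR w = 0 := by
  rw [← D.vectorEquivE₈_sum hC o, ← ZModModule.sub_eq_add _ (D.vectorEquivE₈ hC o w), sub_eq_zero,
    eq_comm]

lemma tildeR_sum_iff (x y z w : cubeBase C) :
    D.tildeR x + D.tildeR y + D.tildeR z + D.tildeR w = 0 ↔
      D.tildeP x + D.tildeP y + D.tildeP z + D.tildeP w = 0 := by
  simp only [← modEquivE₈_tildeP, ← map_add]
  exact LinearEquiv.map_eq_zero_iff _

/-- As for `E₇`, with sums of four classes in place of sums of three: vanishing of `x + y + z + w`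
is the affine relation `w = x + y + z`, which does not depend on an origin. -/
lemma cubeAction_range_E₈ (hC : IsMaximalCube C) (o : cubeBase C) :
    (cubeAction hC.1).range = (affinePerm (D.vectorEquivE₈ hC o)).range := by
  classical
  refine le_antisymm (fun π hπ => ?_) (affinePerm_range_le _ ?_)
  · obtain ⟨g, hg⟩ := D.isTame_E₈.exists_modTwoPMap hC.1 hπ
    refine mem_range_affinePerm _ fun x y z w h => ?_
    rw [vectorEquivE₈_eq_iff, tildeR_sum_iff] at h ⊢
    rw [hg, hg, hg, hg, ← map_add, ← map_add, ← map_add, h, map_zero]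
  · intro a b c d hab hac had hbc hbd hcd h
    rw [vectorEquivE₈_sum, tildeR_sum_iff] at h
    exact D.isTame_E₈.swap_mul_swap_mem_range hC.1 hab hac had hbc hbd hcd h

lemma nonempty_mulEquiv_E₈ (hC : IsMaximalCube C) : Nonempty (cubePhi C ≃*
    (Multiplicative (Fin 3 → ZMod 2) ⋊[glThreeAction] GL (Fin 3) (ZMod 2))) := by
  obtain ⟨o⟩ := D.nonempty_cubeBase_E₈ hC
  exact nonempty_mulEquiv_of_range_eq (D.isTame_E₈.cubeAction_injective hC)
    (affinePerm_injective _) (D.cubeAction_range_E₈ hC o)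

lemma mem_range_iff_affine_E₈ (hC : IsMaximalCube C) [Nonempty (D.cubeAffineSpan C)]
    (π : Equiv.Perm (cubeBase C)) :
    π ∈ (cubeAction hC.1).range ↔
      ∃ φ : D.cubeAffineSpan C ≃ᵃ[ZMod 2] D.cubeAffineSpan C,
        ∀ s : cubeBase C, φ (D.affineEquivE₈ hC s) = D.affineEquivE₈ hC (π s) := by
  obtain ⟨o⟩ := D.nonempty_cubeBase_E₈ hC
  rw [D.cubeAction_range_E₈ hC o]
  constructor
  · rintro ⟨a, rfl⟩
    let b := (Module.finBasisOfFinrankEq (ZMod 2) (D.cubeAffineSpan C).direction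
      (D.finrank_direction_E₈ hC)).equivFun
    have hb : ∀ s, D.vectorEquivE₈ hC o s =
        b (D.affineEquivE₈ hC s -ᵥ D.affineEquivE₈ hC o) := fun s => rfl
    let L : (Fin 3 → ZMod 2) ≃ₗ[ZMod 2] (Fin 3 → ZMod 2) :=
      (Matrix.GeneralLinearGroup.toLin a.right).toLinearEquiv
    have hL : ∀ m, L m = a.right.val *ᵥ m := fun m => rfl
    have ho : D.vectorEquivE₈ hC o o = 0 := by rw [hb, vsub_self, map_zero]
    have key : ∀ s, D.affineEquivE₈ hC (affinePerm (D.vectorEquivE₈ hC o) a s) =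
        ((b.trans L).trans b.symm) (D.affineEquivE₈ hC s -ᵥ D.affineEquivE₈ hC o) +ᵥ
          D.affineEquivE₈ hC (affinePerm (D.vectorEquivE₈ hC o) a o) := by
      intro s
      rw [eq_vadd_iff_vsub_eq]
      refine b.injective ?_
      rw [LinearEquiv.trans_apply, LinearEquiv.trans_apply, LinearEquiv.apply_symm_apply, ← hb, hL,
        ← vsub_sub_vsub_cancel_right _ _ (D.affineEquivE₈ hC o), map_sub, ← hb, ← hb,
        affinePerm_apply, affinePerm_apply, ho, Matrix.mulVec_zero, add_zero, add_sub_cancel_left]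
    -- The linear part is the matrix of `a` carried back to the direction by the coordinates `b`;
    -- the translation part is absorbed in the image of the base point `o`.
    refine ⟨AffineEquiv.mk' (fun p => D.affineEquivE₈ hC (affinePerm (D.vectorEquivE₈ hC o) a
      ((D.affineEquivE₈ hC).symm p))) ((b.trans L).trans b.symm) (D.affineEquivE₈ hC o)
      (fun p => ?_), fun s => ?_⟩
    · obtain ⟨s, rfl⟩ := (D.affineEquivE₈ hC).surjective p
      simp only [Equiv.symm_apply_apply]
      exact key s
    · change D.affineEquivE₈ hC (affinePerm _ a ((D.affineEquivE₈ hC).symm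
        (D.affineEquivE₈ hC s))) = _
      rw [Equiv.symm_apply_apply]
  · rintro ⟨φ, hφ⟩
    refine mem_range_affinePerm _ fun x y z w h => ?_
    rw [vectorEquivE₈_eq_iff] at h ⊢
    -- Vanishing of a sum of four classes reads `w = (x - y) + z` in the affine space, a relation
    -- that affine maps preserve.
    have hsum : ∀ x y z w : cubeBase C,
        D.tildeR x + D.tildeR y + D.tildeR z + D.tildeR w = 0 ↔
        D.affineEquivE₈ hC w = (D.affineEquivE₈ hC x -ᵥ D.affineEquivE₈ hC y) +ᵥ
          D.affineEquivE₈ hC z := by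
      intro x y z w
      rw [Subtype.ext_iff]
      change _ ↔ D.tildeR w = D.tildeR x - D.tildeR y + D.tildeR z
      rw [ZModModule.sub_eq_add, ← ZModModule.sub_eq_add _ (D.tildeR w), sub_eq_zero, eq_comm]
    rw [hsum] at h ⊢
    rw [← hφ, ← hφ, ← hφ, ← hφ, h, AffineEquiv.map_vadd]
    congr 1
    exact AffineMap.linearMap_vsub φ.toAffineMap _ _

end E₈

end SimpleRoots

end

theorem mainTheorem12 :
    (∀ (V : Type*) [NormedAddCommGroup V] [InnerProductSpace ℝ V]
      (D : SimpleRoots CartanMatrix.E₇ V),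
      -- the class of a reflection is well defined
      (∀ s : D.weylGroup, IsGroupReflection s →
        ∃ α ∈ D.roots, (s : V ≃ₗᵢ[ℝ] V) = rootReflection α) ∧
      (∀ (s : D.weylGroup) (α : D.rootLattice), (α : V) ∈ D.roots →
        (s : V ≃ₗᵢ[ℝ] V) = rootReflection (α : V) → D.tildeP s = D.twoP.mkQ α) ∧
      -- the bases of the maximal cubes are the sets of nonzero vectors of the maximal totally
      -- isotropic subspaces, the correspondence is bijective, and there are 135 maximal cubes
      (∀ S : Set D.weylGroup,
        (∃ C : Subgroup D.weylGroup, IsMaximalCube C ∧ cubeBase C = S) ↔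
          (∀ s ∈ S, IsGroupReflection s) ∧
          ∃ W : Submodule (ZMod 2) D.ModTwoP, Maximal D.IsTotallyIsotropic W ∧
            Set.BijOn D.tildeP S {x | x ∈ W ∧ x ≠ 0}) ∧
      Set.BijOn D.cubeSpan {C | IsMaximalCube C} {W | Maximal D.IsTotallyIsotropic W} ∧
      {C : Subgroup D.weylGroup | IsMaximalCube C}.ncard = 135 ∧
      ∀ C : Subgroup D.weylGroup, IsMaximalCube C →
        -- the base is a projective plane over the field with two elements
        Module.finrank (ZMod 2) (D.cubeSpan C) = 3 ∧
        (∃ e : cubeBase C ≃ ℙ (ZMod 2) (D.cubeSpan C),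
          (∀ s : cubeBase C, (e s).submodule.map (D.cubeSpan C).subtype =
            Submodule.span (ZMod 2) {D.tildeP s}) ∧
          -- the associated group is the group of automorphisms of this plane
          ∃ f : cubePhi C →* Equiv.Perm (cubeBase C), IsConjugationAction f ∧
            Function.Injective f ∧
            ∀ π : Equiv.Perm (cubeBase C), π ∈ f.range ↔
              ∀ x y z : cubeBase C,
                Projectivization.IsCollinear {e (π x), e (π y), e (π z)} ↔
                  Projectivization.IsCollinear {e x, e y, e z}) ∧
        IsSimpleGroup (cubePhi C) ∧
        Nat.card (cubePhi C) = 168 ∧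
        Nonempty (cubePhi C ≃* GL (Fin 3) (ZMod 2))) ∧
    (∀ (V : Type*) [NormedAddCommGroup V] [InnerProductSpace ℝ V]
      (D : SimpleRoots CartanMatrix.E₈ V),
      -- the class of a reflection is well defined
      (∀ s : D.weylGroup, IsGroupReflection s →
        ∃ α ∈ D.roots, (s : V ≃ₗᵢ[ℝ] V) = rootReflection α) ∧
      (∀ (s : D.weylGroup) (α : D.rootLattice), (α : V) ∈ D.roots →
        (s : V ≃ₗᵢ[ℝ] V) = rootReflection (α : V) → D.tildeR s = D.twoR.mkQ α) ∧
      ∀ C : Subgroup D.weylGroup, IsMaximalCube C →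
        -- (i)
        (∀ T : Finset D.weylGroup, (T : Set D.weylGroup) ⊆ cubeBase C → T.card = 3 →
          ∃! s, s ∈ cubeBase C ∧ s ∉ T ∧ D.tildeR s = D.classSum T) ∧
        -- (ii)
        IsSteinerSystem 3 4 8 (cubeBase C) (D.cubeBlocks C) ∧
        -- (iii) the base is an affine space of dimension 3 over the field with two elements
        Module.finrank (ZMod 2) (D.cubeAffineSpan C).direction = 3 ∧
        (∃ (_ : Nonempty (D.cubeAffineSpan C)) (e : cubeBase C ≃ D.cubeAffineSpan C),
          (∀ s : cubeBase C, (e s : D.ModTwoR) = D.tildeR s) ∧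
          -- the associated group is the group of automorphisms of this affine space
          ∃ f : cubePhi C →* Equiv.Perm (cubeBase C), IsConjugationAction f ∧
            Function.Injective f ∧
            ∀ π : Equiv.Perm (cubeBase C), π ∈ f.range ↔
              ∃ φ : D.cubeAffineSpan C ≃ᵃ[ZMod 2] D.cubeAffineSpan C,
                ∀ s : cubeBase C, φ (e s) = e (π s)) ∧
        Nonempty (cubePhi C ≃*
          (Multiplicative (Fin 3 → ZMod 2) ⋊[glThreeAction] GL (Fin 3) (ZMod 2)))) := by
  refine ⟨fun V _ _ D => ⟨D.isTame_E₇.exists_root, fun s α hα hs => D.tildeP_eq hα hs,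
    D.exists_maximalCube_iff_E₇, D.bijOn_cubeSpan_E₇, D.ncard_maximalCube_E₇, fun C hC => ?_⟩,
    fun V _ _ D => ⟨D.isTame_E₈.exists_root, fun s α hα hs => D.tildeR_eq hα hs, fun C hC => ?_⟩⟩
  · obtain ⟨e⟩ := D.nonempty_mulEquiv_E₇ hC
    have := isSimpleGroup_gl
    refine ⟨D.finrank_cubeSpan_E₇ hC, ⟨D.planeEquivE₇ hC, fun s => ?_, cubeAction hC.1,
      isConjugationAction_cubeAction _, D.isTame_E₇.cubeAction_injective hC,
      D.mem_range_iff_isCollinear_E₇ hC⟩, e.isSimpleGroup, ?_, ⟨e⟩⟩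
    · rw [D.planeEquivE₇_apply, Projectivization.submodule_mk, Submodule.map_span,
        Set.image_singleton]
      rfl
    · rw [Nat.card_congr e.toEquiv, natCard_gl]
  · obtain ⟨o⟩ := D.nonempty_cubeBase_E₈ hC
    have : Nonempty (D.cubeAffineSpan C) := ⟨D.affineMapE₈ o⟩
    exact ⟨D.existsUnique_of_triple_E₈ hC, D.isSteinerSystem_E₈ hC, D.finrank_direction_E₈ hC,
      ⟨this, D.affineEquivE₈ hC, fun s => rfl, cubeAction hC.1, isConjugationAction_cubeAction _,
        D.isTame_E₈.cubeAction_injective hC, D.mem_range_iff_affine_E₈ hC⟩,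
      D.nonempty_mulEquiv_E₈ hC⟩
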